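/- Let $(\mathcal S,\mathcal E)$ be a finite set system in which every set has at most $s\ge 2$ elements and every element lies in at least one and at most $t\ge 2$ sets; sets and elements carry integer IDs. Let $\mathrm{OPT}$ be the value of an optimal fractional set cover. All logarithms are to base $2$; since $s,t$ are only upper bounds, in the algorithm they are first rounded up so that $\log s$ and $T:=\sqrt{\log t}$ are integers (namely to $2^{\lceil \log s\rceil}$ and $2^{\lceil\sqrt{\log t}\rceil^2}$). Algorithm. For $i\in[\log s]$, $k\in[\log t]$ and $S\in\mathcal S$, independently: $B_i(S)\subseteq S$ includes each element of $S$ with probability $p_i=\min(1,\log^5 s\cdot\log^5 t\cdot 2^i/s)$, and $\mathcal S_{i,k}\subseteq\mathcal S$ includes each set with probability $2^k/t$. Start with $\mathcal S_{cvr}=\emptyset$. An element is free if no set of $\mathcal S_{cvr}$ contains it and it does not pretend to be covered. For stages $i=1,\dots,\log s$ and, within a stage, phases $j=0,\dots,T-1$, let $E$ be the set of elements that are free at the beginning of the phase, and do the following. (1) Add to $\mathcal S_{cvr}$ every set $S$ with $|B_i(S)\cap E|\ge \log^{10}s\cdot\log^{10}t$. (2) For $jT<k\le (j+1)T$ let $\widehat{\mathcal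 S}_{i,k}=\{S\in\mathcal S_{i,k}: |B_i(S)\cap E|/p_i\ge s/2^i\}$; every $e\in E$ that for some such $k$ lies in at least $\log^{10}s\cdot\log^{10}t\cdot 2^T$ sets of $\widehat{\mathcal S}_{i,k}$ from now on pretends to be covered. (3) For $\ell=1,\dots,T$ add simultaneously all $S\in\widehat{\mathcal S}_{i,jT+\ell}$ with $|B_i(S)\cap E'|/p_i\ge s/2^i$, where $E'$ is the current set of free elements. Finally, for every element contained in no set of $\mathcal S_{cvr}$, add the set of smallest ID that contains it, and return $\mathcal S_{cvr}$. An LCA is, for given $s,t$, a procedure that receives the ID of a set $S$, adaptively asks neighbor queries ("what is the $n$-th element of a given set?", "what is the $n$-th set containing a given element?"), reads bits of a tape of independent fair random bits, and answers whether $S$ is in the cover. Theorem. There is an absolute constant $C>0$ such that for all $s,t\ge 2$: (a) on every such set system the algorithm always returns a set cover, and $\mathbb E[|\mathcal S_{cvr}|]\le C\cdot\log s\cdot\mathrm{OPT}$; (b) there is an LCA, depending only on $s$ and $t$, that simulates the algorithm: there is a measure-preserving map from random tapes to random samples $(B_i(S),\mathcal S_{i,k})$, not depending on the set system, such that on every such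 set system and for every tape the LCA answers yes exactly for the sets returned by the algorithm with the corresponding samples. In particular, for every tape the sets with answer yes form a set cover, and its expected size is at most $C\cdot\log s\cdot\mathrm{OPT}$. For every tape and every set, the LCA asks at most $(st)^{C\cdot\log s\cdot\sqrt{\log t}}$ neighbor queries. -/

import Mathlib

open MeasureTheory ProbabilityTheory

namespace SetCover

/-! ### Set systems, set covers, fractional set covers -/

/-- A finite set cover instance. Sets and elements carry natural-number IDs (two separate name
spaces), and the incidence relation is given by adjacency lists in an arbitrary order.
Every element lies in at least one set, so that a set cover exists. -/
structure SetSystem where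
  /-- the IDs of the sets -/
  sets : Finset ℕ
  /-- the IDs of the elements -/
  elts : Finset ℕ
  /-- the list of the elements of a set -/
  elemsOf : ℕ → List ℕ
  /-- the list of the sets that contain an element -/
  setsOf : ℕ → List ℕ
  nodup_elemsOf : ∀ S ∈ sets, (elemsOf S).Nodup
  nodup_setsOf : ∀ e ∈ elts, (setsOf e).Nodup
  elemsOf_subset : ∀ S ∈ sets, ∀ e ∈ elemsOf S, e ∈ elts
  setsOf_subset : ∀ e ∈ elts, ∀ S ∈ setsOf e, S ∈ sets
  mem_iff : ∀ S ∈ sets, ∀ e ∈ elts, e ∈ elemsOf S ↔ S ∈ setsOf e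
  coverable : ∀ e ∈ elts, ∃ S ∈ sets, e ∈ elemsOf S

namespace SetSystem

/-- Every set has at most `s` elements and every element lies in at most `t` sets. -/
def Bounded (I : SetSystem) (s t : ℕ) : Prop :=
  (∀ S ∈ I.sets, (I.elemsOf S).length ≤ s) ∧ (∀ e ∈ I.elts, (I.setsOf e).length ≤ t)

/-- `C` is a set cover: a subfamily of the sets whose union is the whole universe. -/
def IsSetCover (I : SetSystem) (C : Finset ℕ) : Prop :=
  C ⊆ I.sets ∧ ∀ e ∈ I.elts, ∃ S ∈ C, e ∈ I.elemsOf S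

/-- `x` is a fractional set cover. -/
def IsFractionalCover (I : SetSystem) (x : ℕ → ℝ) : Prop :=
  (∀ S ∈ I.sets, 0 ≤ x S) ∧ ∀ e ∈ I.elts, 1 ≤ ∑ S ∈ I.sets with e ∈ I.elemsOf S, x S

/-- The value of an optimal fractional set cover. -/
noncomputable def opt (I : SetSystem) : ℝ :=
  sInf {v : ℝ | ∃ x : ℕ → ℝ, I.IsFractionalCover x ∧ v = ∑ S ∈ I.sets, x S}

/-- The elements that are not contained in any set of `C`. -/
def uncovered (I : SetSystem) (C : Finset ℕ) : Finset ℕ :=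
  I.elts.filter fun e => ∀ S ∈ C, e ∉ I.elemsOf S

end SetSystem

/-! ### The random samples

The algorithm is run with parameters `a, T ≥ 1`, which stand for `s = 2 ^ a` and `t = 2 ^ (T ^ 2)`,
so that `log s = a`, `log t = T ^ 2` and the phase length `√(log t) = T` are integers. -/

/-- The number of stages for the bound `s` on the set sizes: `⌈log₂ s⌉`. -/
def numStages (s : ℕ) : ℕ := Nat.clog 2 s

/-- The phase length for the bound `t` on the element degrees: `⌈√(log₂ t)⌉`. -/
noncomputable def phaseLength (t : ℕ) : ℕ := ⌈√(Real.logb 2 t)⌉₊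

/-- `log⁵ s · log⁵ t` -/
def logFive (a T : ℕ) : ℕ := a ^ 5 * (T ^ 2) ^ 5

/-- `log¹⁰ s · log¹⁰ t` -/
def logTen (a T : ℕ) : ℕ := a ^ 10 * (T ^ 2) ^ 10

/-- `p_i = min (1, log⁵ s · log⁵ t · 2 ^ i / s)` -/
def elemProb (a T i : ℕ) : ℚ := min 1 (logFive a T * 2 ^ i / 2 ^ a)

/-- `2 ^ k / t` (truncated at `1`, which matters only for the unused indices `k > log t`) -/
def setProb (T k : ℕ) : ℚ := min 1 (2 ^ k / 2 ^ (T ^ 2))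

/-- The names of the random choices. -/
inductive Coin
  /-- is the element `e` of the set `S` included in `B_i(S)`? -/
  | elem (i S e : ℕ)
  /-- is the set `S` included in `𝒮_{i,k}`? -/
  | set (i k S : ℕ)

/-- An outcome of all the random choices. -/
abbrev Samples := Coin → Bool

/-- The probability with which a random choice is `true`. -/
def coinProb (a T : ℕ) : Coin → ℚ
  | .elem i _ _ => elemProb a T i
  | .set _ k _ => setProb T k

theorem coinProb_mem (a T : ℕ) (c : Coin) : (coinProb a T c : ℝ) ∈ unitInterval := by
  have h : 0 ≤ coinProb a T c ∧ coinProb a T c ≤ 1 := by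
    cases c
    · exact ⟨le_min zero_le_one (by positivity), min_le_left _ _⟩
    · exact ⟨le_min zero_le_one (by positivity), min_le_left _ _⟩
  exact ⟨by exact_mod_cast h.1, by exact_mod_cast h.2⟩

/-- All random choices are independent, each with its own probability. -/
noncomputable def sampleLaw (a T : ℕ) : Measure Samples :=
  Measure.infinitePi fun c => bernoulliMeasure true false ⟨coinProb a T c, coinProb_mem a T c⟩

/-! ### The algorithm -/

/-- The state of the algorithm: the sets added so far, and the elements that pretend to be
covered. -/
structure State where
  cover : Finset ℕ
  pretend : Finset ℕ

section Algorithm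

variable (I : SetSystem) (a T : ℕ) (ω : Samples)

/-- The free elements: those that are neither covered nor pretend to be covered. -/
def free (st : State) : Finset ℕ := I.uncovered st.cover \ st.pretend

/-- The sampled subset `B_i(S)` of `S`. -/
def sampleB (i S : ℕ) : Finset ℕ := (I.elemsOf S).toFinset.filter fun e => ω (.elem i S e) = true

/-- The sampled subfamily `𝒮_{i,k}`. -/
def sampleS (i k : ℕ) : Finset ℕ := I.sets.filter fun S => ω (.set i k S) = true

/-- The estimate `|B_i(S) ∩ E| / p_i` of the number of elements of `S` in `E`. -/
def estimate (i S : ℕ) (E : Finset ℕ) : ℚ := (sampleB I ω i S ∩ E).card / elemProb a T i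

/-- `𝒮̂_{i,k}`: the sets of `𝒮_{i,k}` whose estimated number of elements in `E` is at least
`s / 2 ^ i`, where `E` is the set of free elements at the beginning of the phase. -/
def sparseS (i k : ℕ) (E : Finset ℕ) : Finset ℕ :=
  (sampleS I ω i k).filter fun S => (2 ^ a / 2 ^ i : ℚ) ≤ estimate I a T ω i S E

/-- The sets `S` with `|B_i(S) ∩ E| ≥ log¹⁰ s · log¹⁰ t`. -/
def badSets (i : ℕ) (E : Finset ℕ) : Finset ℕ :=
  I.sets.filter fun S => logTen a T ≤ (sampleB I ω i S ∩ E).card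

/-- The elements of `E` that lie in at least `log¹⁰ s · log¹⁰ t · 2 ^ T` sets of `𝒮̂_{i,k}` for
some iteration `k` of phase `j`. -/
def badElts (i j : ℕ) (E : Finset ℕ) : Finset ℕ :=
  (Finset.Icc (j * T + 1) ((j + 1) * T)).biUnion fun k => E.filter fun e =>
    logTen a T * 2 ^ T ≤ ((sparseS I a T ω i k E).filter fun S => e ∈ I.elemsOf S).card

/-- One iteration: all sets of the family `F` whose current estimated number of free elements is at
least `s / 2 ^ i` are added in parallel. -/
def iteration (i : ℕ) (F : Finset ℕ) (st : State) : State :=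
  { st with
    cover := st.cover ∪
      F.filter fun S => (2 ^ a / 2 ^ i : ℚ) ≤ estimate I a T ω i S (free I st) }

/-- Phase `j` of stage `i`: add the bad sets, let the bad elements pretend to be covered, and then
perform the iterations `ℓ = 1, …, T` on the families `𝒮̂_{i, j T + ℓ}`, which are fixed at the
beginning of the phase. -/
def phase (i : ℕ) (st : State) (j : ℕ) : State :=
  let E := free I st
  (List.range' 1 T).foldl
    (fun st' ℓ => iteration I a T ω i (sparseS I a T ω i (j * T + ℓ) E) st')
    { cover := st.cover ∪ badSets I a T ω i E
      pretend := st.pretend ∪ badElts I a T ω i j E }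

/-- Stage `i`: the phases `j = 0, …, T - 1`. -/
def stage (st : State) (i : ℕ) : State := (List.range T).foldl (phase I a T ω i) st

/-- The state after the stages `i = 1, …, log s`. -/
def mainLoop : State := (List.range' 1 a).foldl (stage I a T ω) ⟨∅, ∅⟩

/-- For every element not covered by `C`, the set of smallest ID that contains it. -/
def cleanUp (C : Finset ℕ) : Finset ℕ :=
  I.sets.filter fun S => ∃ e ∈ I.uncovered C, e ∈ I.elemsOf S ∧
    ∀ S' ∈ I.sets, e ∈ I.elemsOf S' → S ≤ S'

/-- The family of sets returned by the algorithm. -/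
def phasedCover : Finset ℕ :=
  (mainLoop I a T ω).cover ∪ cleanUp I (mainLoop I a T ω).cover

end Algorithm

/-! ### Local computation algorithms -/

/-- Neighbor queries: the `n`-th element of the set `S`, the `n`-th set containing the element
`e` (counted from `0`). -/
inductive Query
  | elemOf (S n : ℕ)
  | setOf (e n : ℕ)

/-- The answer to a neighbor query, `none` if there is no such neighbor. -/
def SetSystem.answer (I : SetSystem) : Query → Option ℕ
  | .elemOf S n => if S ∈ I.sets then (I.elemsOf S)[n]? else none
  | .setOf e n => if e ∈ I.elts then (I.setsOf e)[n]? else none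

/-- An adaptive procedure that in each step either asks a neighbor query, or reads a bit of the
random tape, or stops with a yes/no answer. -/
inductive Procedure
  | halt (answer : Bool)
  | ask (q : Query) (next : Option ℕ → Procedure)
  | readBit (position : ℕ) (next : Bool → Procedure)

/-- A tape of random bits. -/
abbrev Tape := ℕ → Bool

/-- The law of the tape: independent fair bits. -/
noncomputable def tapeLaw : Measure Tape :=
  Measure.infinitePi fun _ => bernoulliMeasure true false ⟨1 / 2, by norm_num, by norm_num⟩

/-- The answer of a procedure on a given input and tape. -/
def Procedure.output (I : SetSystem) (τ : Tape) : Procedure → Bool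
  | halt b => b
  | ask q next => (next (I.answer q)).output I τ
  | readBit n next => (next (τ n)).output I τ

/-- The number of neighbor queries that a procedure asks on a given input and tape. -/
def Procedure.queries (I : SetSystem) (τ : Tape) : Procedure → ℕ
  | halt _ => 0
  | ask q next => (next (I.answer q)).queries I τ + 1
  | readBit n next => (next (τ n)).queries I τ

/-- A local computation algorithm: the procedure that is run to decide whether the set with a given
ID is in the cover. It learns about the input only through neighbor queries, and different runs
share nothing but the tape. -/
abbrev LCA := ℕ → Procedure

/-- The family of the sets for which the LCA answers yes. -/
def LCA.cover (L : LCA) (I : SetSystem) (τ : Tape) : Finset ℕ :=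
  I.sets.filter fun S => (L S).output I τ = true

end SetCover

namespace SetCover

/-! ### Averaging over finitely many independent coins -/

section Averaging

open Classical

variable {ι : Type*} (p : ι → ℝ)

/-! Write D = `logFive a T`, N = `logTen a T` = D², s = 2^a, t = 2^(T²), and θ = s/2^i for the
threshold of stage i. The algorithm is a parallel greedy algorithm analysed by charging and weak LP
duality; the randomness is handled by deferred decisions.

Size. With high probability a stage leaves every set with fewer than 2θ free elements: its last
iteration samples every set, so no large estimate survives it (`prob_large_part_le`). With high
probability a set that is added still has at least θ/2 free elements (`prob_added_small_le`) and is
charged to them (`card_addedSets_le`). An element is charged O(1) times per stage in expectation.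
Indeed, let d heavy sets contain it and be sampled at rate q. It survives the iteration with
probability (1-q)^d, the next rate is 2q, and 2qd(1-q)^d ≤ 2(1-(1-q)^d). So the expected number of
sets covering it in one iteration is at most twice the probability of being covered in the previous
one, up to a small error (`expect_multiplicity_succ_le`), and these probabilities telescope. A stage
thus costs O(1/θ) times the expected number of elements free at its start. By weak duality
(`sum_le_sum_fractional`) this number is at most OPT times the largest expected free part of a set,
about 4θ. Hence each of the log s stages costs O(OPT). Bad sets, pretending elements and the
clean-up contribute errors of order (st)^O(T) · exp(-D/8), which are bounded because D = (aT²)^5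
(`error_le`, `pow_mul_exp_le`).

Deferred decisions. A stage reuses one sample `B_i(S)` throughout, so its run depends on the sample
that is to be analysed. But while S is not added and its estimates at the phase starts remain large,
the run is a function of the other coins (`iterState_congr_of_notMem`). By `avg_ind_le_of_fiber` it
suffices to bound an event conditionally on the other coins near an outcome of the event; there the
run is frozen and a Chernoff bound for fresh coins applies. Similarly, the membership coins of the
sets containing e in future iterations influence the past only by making elements that share a set
with e pretend (`iterState_congr_of_noBadNeighbor`). Pretending is rare by induction on the phases
(`pretendProb_le`): an element in many heavy sets would have been covered by the last iteration of
the previous phase, unless one of its at most st neighbors pretended in that phase. So the bound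
grows by a factor st + 1 per phase.

Queries. Freeness is decided recursively. Once e survives the first two steps of a phase, only N·2^T
candidate sets with at most N sampled free elements each matter, so an iteration multiplies the cost
by O(N²·2^T) (`computes_stepProc`). Over T iterations the factor 2^T becomes 2^(T²) = t, which is
why phases have length √(log t). A phase multiplies the cost by (st)^O(1) (`phaseFactor_le`), and
there are aT phases. -/

/-- The average of `f` over the coin `c`, the other coins being kept. -/
noncomputable def coinAvg (c : ι) (f : (ι → Bool) → ℝ) (ω : ι → Bool) : ℝ :=
  p c * f (Function.update ω c true) + (1 - p c) * f (Function.update ω c false)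

/-- The average of `f` over the coins in the list `A`, the other coins being kept. -/
noncomputable def avg (A : List ι) (f : (ι → Bool) → ℝ) : (ι → Bool) → ℝ :=
  A.foldr (coinAvg p) f

/-- The indicator of a proposition as a real number. -/
noncomputable def ind (P : Prop) : ℝ := if P then 1 else 0

theorem ind_nonneg (P : Prop) : 0 ≤ ind P := by unfold ind; split_ifs <;> norm_num

theorem ind_le_one (P : Prop) : ind P ≤ 1 := by unfold ind; split_ifs <;> norm_num

theorem ind_of {P : Prop} (h : P) : ind P = 1 := if_pos h

theorem ind_of_not {P : Prop} (h : ¬P) : ind P = 0 := if_neg h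

theorem ind_mono {P Q : Prop} (h : P → Q) : ind P ≤ ind Q := by
  by_cases hP : P
  · rw [ind_of hP, ind_of (h hP)]
  · rw [ind_of_not hP]; exact ind_nonneg _

theorem ind_le_of_imp {P : Prop} {x : ℝ} (hx : 0 ≤ x) (h : P → 1 ≤ x) : ind P ≤ x := by
  by_cases hP : P
  · rw [ind_of hP]; exact h hP
  · rw [ind_of_not hP]; exact hx

theorem ind_or_le (P Q : Prop) : ind (P ∨ Q) ≤ ind P + ind Q := by
  refine ind_le_of_imp (add_nonneg (ind_nonneg _) (ind_nonneg _)) ?_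
  rintro (h | h)
  · rw [ind_of h]; linarith [ind_nonneg Q]
  · rw [ind_of h]; linarith [ind_nonneg P]

theorem ind_exists_le {α : Type*} (F : Finset α) (P : α → Prop) :
    ind (∃ x ∈ F, P x) ≤ ∑ x ∈ F, ind (P x) := by
  refine ind_le_of_imp (Finset.sum_nonneg fun _ _ => ind_nonneg _) ?_
  rintro ⟨x, hx, h⟩
  rw [← ind_of h]
  exact Finset.single_le_sum (f := fun x => ind (P x)) (fun _ _ => ind_nonneg _) hx

theorem card_filter_eq_sum_ind {α : Type*} (F : Finset α) (P : α → Prop) [DecidablePred P] :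
    ((F.filter P).card : ℝ) = ∑ x ∈ F, ind (P x) := by
  rw [Finset.card_filter]
  push_cast
  refine Finset.sum_congr rfl fun x _ => ?_
  unfold ind
  congr

@[simp] theorem avg_nil (f : (ι → Bool) → ℝ) : avg p [] f = f := rfl

theorem avg_cons (c : ι) (A : List ι) (f : (ι → Bool) → ℝ) :
    avg p (c :: A) f = coinAvg p c (avg p A f) := rfl

/-- Averaging out one coin is a projection, and these projections commute. The tower property needs
nothing else, and repetitions in a list of coins are harmless. -/
theorem coinAvg_comm (c d : ι) (f : (ι → Bool) → ℝ) :
    coinAvg p c (coinAvg p d f) = coinAvg p d (coinAvg p c f) := by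
  by_cases h : c = d
  · rw [h]
  · funext ω
    simp only [coinAvg]
    rw [Function.update_comm h, Function.update_comm h, Function.update_comm h,
      Function.update_comm h]
    ring

theorem coinAvg_idem (c : ι) (f : (ι → Bool) → ℝ) :
    coinAvg p c (coinAvg p c f) = coinAvg p c f := by
  funext ω
  simp only [coinAvg, Function.update_idem]
  ring

theorem avg_coinAvg_comm (A : List ι) (c : ι) (f : (ι → Bool) → ℝ) :
    avg p A (coinAvg p c f) = coinAvg p c (avg p A f) := by
  induction A with
  | nil => rfl
  | cons d A ih => rw [avg_cons, ih, coinAvg_comm, avg_cons]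

theorem avg_coinAvg_of_mem {A : List ι} {c : ι} (hc : c ∈ A) (f : (ι → Bool) → ℝ) :
    avg p A (coinAvg p c f) = avg p A f := by
  induction A with
  | nil => simp at hc
  | cons d A ih =>
    rcases List.mem_cons.1 hc with rfl | h
    · rw [avg_cons, avg_coinAvg_comm, coinAvg_idem, avg_cons]
    · rw [avg_cons, ih h, avg_cons]

/-- The tower property. -/
theorem avg_avg_of_subset {K A : List ι} (h : A ⊆ K) (f : (ι → Bool) → ℝ) :
    avg p K (avg p A f) = avg p K f := by
  induction A with
  | nil => rfl
  | cons c A ih =>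
    rw [avg_cons, avg_coinAvg_of_mem p (h List.mem_cons_self),
      ih fun x hx => h (List.mem_cons_of_mem _ hx)]

theorem avg_const (A : List ι) (x : ℝ) : avg p A (fun _ => x) = fun _ => x := by
  induction A with
  | nil => rfl
  | cons c A ih => rw [avg_cons, ih]; funext ω; simp only [coinAvg]; ring

theorem avg_add (A : List ι) (f g : (ι → Bool) → ℝ) :
    avg p A (fun ω => f ω + g ω) = fun ω => avg p A f ω + avg p A g ω := by
  induction A with
  | nil => rfl
  | cons c A ih =>
    rw [avg_cons, ih]; funext ω; simp only [avg_cons, coinAvg]; ring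

theorem avg_mul_left (A : List ι) (x : ℝ) (f : (ι → Bool) → ℝ) :
    avg p A (fun ω => x * f ω) = fun ω => x * avg p A f ω := by
  induction A with
  | nil => rfl
  | cons c A ih =>
    rw [avg_cons, ih]; funext ω; simp only [avg_cons, coinAvg]; ring

theorem avg_sum {α : Type*} (A : List ι) (F : Finset α) (f : α → (ι → Bool) → ℝ) :
    avg p A (fun ω => ∑ x ∈ F, f x ω) = fun ω => ∑ x ∈ F, avg p A (f x) ω := by
  induction F using Finset.induction_on with
  | empty => simpa using avg_const p A 0
  | insert x F hx ih =>
    simp only [Finset.sum_insert hx]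
    rw [avg_add, ih]

variable {p}

/-- Only the outcomes that agree with `ω` off `A` matter. -/
theorem avg_mono_fiber (hp : ∀ c, p c ∈ unitInterval) {A : List ι} {f g : (ι → Bool) → ℝ} {ω : ι → Bool}
    (h : ∀ ω', (∀ c, c ∉ A → ω' c = ω c) → f ω' ≤ g ω') : avg p A f ω ≤ avg p A g ω := by
  induction A generalizing ω with
  | nil => exact h ω fun _ _ => rfl
  | cons c A ih =>
    simp only [avg_cons, coinAvg]
    have key : ∀ b, avg p A f (Function.update ω c b) ≤ avg p A g (Function.update ω c b) := by
      intro b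
      refine ih fun ω' hω' => h ω' fun d hd => ?_
      rw [List.mem_cons, not_or] at hd
      rw [hω' d hd.2, Function.update_of_ne hd.1]
    have h1 := (hp c).1
    have h2 := (hp c).2
    exact add_le_add (mul_le_mul_of_nonneg_left (key _) h1)
      (mul_le_mul_of_nonneg_left (key _) (by linarith))

theorem avg_mono (hp : ∀ c, p c ∈ unitInterval) {A : List ι} {f g : (ι → Bool) → ℝ} (h : ∀ ω, f ω ≤ g ω) (ω : ι → Bool) :
    avg p A f ω ≤ avg p A g ω :=
  avg_mono_fiber hp fun ω' _ => h ω'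

theorem avg_nonneg (hp : ∀ c, p c ∈ unitInterval) {A : List ι} {f : (ι → Bool) → ℝ} (h : ∀ ω, 0 ≤ f ω) (ω : ι → Bool) :
    0 ≤ avg p A f ω := by
  have := avg_mono (A := A) hp h ω
  rwa [avg_const] at this

/-- The base points may differ on `A`: the induction overwrites these coordinates one at a time,
until the two outcomes coincide. -/
theorem avg_congr_fiber {A : List ι} {f g : (ι → Bool) → ℝ} {ω ω₁ : ι → Bool}
    (hω : ∀ c, c ∉ A → ω₁ c = ω c)
    (h : ∀ ω', (∀ c, c ∉ A → ω' c = ω c) → f ω' = g ω') : avg p A f ω = avg p A g ω₁ := by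
  induction A generalizing ω ω₁ with
  | nil =>
    have : ω₁ = ω := funext fun c => hω c (by simp)
    rw [this]; exact h ω fun _ _ => rfl
  | cons c A ih =>
    simp only [avg_cons, coinAvg]
    have key : ∀ b, avg p A f (Function.update ω c b) = avg p A g (Function.update ω₁ c b) := by
      intro b
      refine ih (fun d hd => ?_) fun ω' hω' => h ω' fun d hd => ?_
      · by_cases hdc : d = c
        · subst hdc; simp
        · rw [Function.update_of_ne hdc, Function.update_of_ne hdc]
          exact hω d (by simp [hdc, hd])
      · rw [List.mem_cons, not_or] at hd
        rw [hω' d hd.2, Function.update_of_ne hd.1]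
    rw [key, key]

/-- The average over `A` does not depend on the coins in `A`. -/
theorem avg_congr_base {A : List ι} {f : (ι → Bool) → ℝ} {ω ω₁ : ι → Bool}
    (hω : ∀ c, c ∉ A → ω₁ c = ω c) : avg p A f ω = avg p A f ω₁ :=
  avg_congr_fiber hω fun _ _ => rfl

/-- To bound the probability of an event, it suffices to bound its conditional probability given
the coins off `A` in the neighborhood of an outcome of the event. -/
theorem avg_ind_le_of_fiber (hp : ∀ c, p c ∈ unitInterval) {K A : List ι} (hA : A ⊆ K) {P : (ι → Bool) → Prop} {δ : ℝ}
    (hδ : 0 ≤ δ) (h : ∀ ω, P ω → avg p A (fun ω' => ind (P ω')) ω ≤ δ) (ω₀ : ι → Bool) :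
    avg p K (fun ω => ind (P ω)) ω₀ ≤ δ := by
  rw [← avg_avg_of_subset p hA]
  have : ∀ ω, avg p A (fun ω' => ind (P ω')) ω ≤ δ := by
    intro ω
    -- On a fiber that meets the event, the base point can be moved to an outcome of the event; on a
    -- fiber that misses it, the average is zero.
    by_cases hex : ∃ ω', (∀ c, c ∉ A → ω' c = ω c) ∧ P ω'
    · obtain ⟨ω', h1, h2⟩ := hex
      rw [avg_congr_base h1]
      exact h ω' h2
    · have h0 : avg p A (fun ω' => ind (P ω')) ω ≤ avg p A (fun _ => 0) ω := by
        refine avg_mono_fiber hp fun ω' hω' => ?_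
        rw [ind_of_not fun hP => hex ⟨ω', hω', hP⟩]
      rw [avg_const] at h0
      exact h0.trans hδ
  have h1 := avg_mono (A := K) hp this ω₀
  rwa [avg_const] at h1

/-- The average of a product of functions of distinct coins. -/
theorem avg_prod {α : Type*} (A : List ι) (F : Finset α) (c : α → ι)
    (hc : Set.InjOn c F) (hA : ∀ x ∈ F, c x ∈ A) (g : α → Bool → ℝ) :
    avg p A (fun ω => ∏ x ∈ F, g x (ω (c x))) =
      fun _ => ∏ x ∈ F, (p (c x) * g x true + (1 - p (c x)) * g x false) := by
  induction F using Finset.induction_on with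
  | empty => simpa using avg_const p A 1
  | insert x F hx ih =>
    -- By idempotence the coin of `x` may be averaged once more, first, which splits off its factor.
    rw [← avg_coinAvg_of_mem p (hA x (Finset.mem_insert_self _ _))]
    have h1 : coinAvg p (c x) (fun ω => ∏ y ∈ insert x F, g y (ω (c y))) = fun ω =>
        (p (c x) * g x true + (1 - p (c x)) * g x false) * ∏ y ∈ F, g y (ω (c y)) := by
      funext ω
      have h2 : ∀ b, ∏ y ∈ F, g y (Function.update ω (c x) b (c y)) = ∏ y ∈ F, g y (ω (c y)) := by
        intro b
        refine Finset.prod_congr rfl fun y hy => ?_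
        rw [Function.update_of_ne]
        intro hxy
        have := hc (by simp [hy]) (by simp) hxy
        exact hx (this ▸ hy)
      simp only [coinAvg, Finset.prod_insert hx, h2, Function.update_self]
      ring
    rw [h1, avg_mul_left, ih (hc.mono (by simp)) fun y hy => hA y (Finset.mem_insert_of_mem hy)]
    simp only [Finset.prod_insert hx]

/-- Moment generating function of a binomial variable, with 1 + x ≤ exp x applied to each factor.
The two tail bounds are Markov's inequality with z = 2 and z = 1/2. -/
theorem avg_pow_count (hp : ∀ c, p c ∈ unitInterval) {α : Type*} (A : List ι) (F : Finset α) (c : α → ι)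
    (hc : Set.InjOn c F) (hA : ∀ x ∈ F, c x ∈ A) (z q : ℝ) (hz : 0 ≤ z)
    (hq : ∀ x ∈ F, p (c x) = q) (ω : ι → Bool) :
    avg p A (fun ω => z ^ (F.filter fun x => ω (c x) = true).card) ω ≤
      Real.exp ((z - 1) * (F.card * q)) := by
  have h1 : (fun ω : ι → Bool => z ^ (F.filter fun x => ω (c x) = true).card) =
      fun ω => ∏ x ∈ F, (fun _ b => if b = true then z else 1) x (ω (c x)) := by
    funext ω
    rw [Finset.prod_ite, Finset.prod_const, Finset.prod_const_one, mul_one]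
  rw [h1, avg_prod A F c hc hA (fun _ b => if b = true then z else 1)]
  have h2 : ∀ x ∈ F, p (c x) * (if true = true then z else 1) +
      (1 - p (c x)) * (if false = true then z else 1) ≤ Real.exp ((z - 1) * q) := by
    intro x hx
    rw [hq x hx]
    have := Real.add_one_le_exp ((z - 1) * q)
    simp only [if_true, Bool.false_eq_true, if_false]
    linarith
  calc _ ≤ ∏ x ∈ F, Real.exp ((z - 1) * q) := by
        refine Finset.prod_le_prod (fun x hx => ?_) h2
        have h3 := (hp (c x)).1
        have h4 := (hp (c x)).2
        simp only [if_true, Bool.false_eq_true, if_false]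
        have := mul_nonneg h3 hz
        linarith
    _ = _ := by
        rw [Finset.prod_const, ← Real.exp_nat_mul]
        congr 1
        ring

/-- Upper tail: the number of heads is at least `b`. -/
theorem avg_ind_le_count (hp : ∀ c, p c ∈ unitInterval) {α : Type*} (A : List ι) (F : Finset α) (c : α → ι)
    (hc : Set.InjOn c F) (hA : ∀ x ∈ F, c x ∈ A) (q : ℝ)
    (hq : ∀ x ∈ F, p (c x) = q) (b : ℕ) (ω : ι → Bool) :
    avg p A (fun ω => ind (b ≤ (F.filter fun x => ω (c x) = true).card)) ω ≤
      (1 / 2) ^ b * Real.exp (F.card * q) := by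
  have h1 := avg_pow_count hp A F c hc hA 2 q (by norm_num) hq ω
  calc _ ≤ avg p A (fun ω => (1 / 2) ^ b * 2 ^ (F.filter fun x => ω (c x) = true).card) ω := by
        refine avg_mono hp (fun ω => ind_le_of_imp (by positivity) fun h => ?_) ω
        rw [one_div, inv_pow, inv_mul_eq_div, one_le_div (by positivity)]
        exact pow_le_pow_right₀ (by norm_num) h
    _ ≤ _ := by
        rw [avg_mul_left]
        refine mul_le_mul_of_nonneg_left (h1.trans (le_of_eq ?_)) (by positivity)
        congr 1; ring

/-- Lower tail: the number of heads is less than `b`. -/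
theorem avg_ind_count_lt (hp : ∀ c, p c ∈ unitInterval) {α : Type*} (A : List ι) (F : Finset α) (c : α → ι)
    (hc : Set.InjOn c F) (hA : ∀ x ∈ F, c x ∈ A) (q : ℝ)
    (hq : ∀ x ∈ F, p (c x) = q) (b : ℕ) (ω : ι → Bool) :
    avg p A (fun ω => ind ((F.filter fun x => ω (c x) = true).card < b)) ω ≤
      2 ^ b * Real.exp (-(F.card * q / 2)) := by
  have h1 := avg_pow_count hp A F c hc hA (1 / 2) q (by norm_num) hq ω
  calc _ ≤ avg p A (fun ω => 2 ^ b * (1 / 2) ^ (F.filter fun x => ω (c x) = true).card) ω := by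
        refine avg_mono hp (fun ω => ind_le_of_imp (by positivity) fun h => ?_) ω
        rw [one_div, inv_pow, ← div_eq_mul_inv, one_le_div (by positivity)]
        exact pow_le_pow_right₀ (by norm_num) h.le
    _ ≤ _ := by
        rw [avg_mul_left]
        refine mul_le_mul_of_nonneg_left (h1.trans (le_of_eq ?_)) (by positivity)
        congr 1; ring

/-- A function of finitely many coins is a finite combination of cylinder indicators. This reduces
integrability and integration to products of single coins. -/
theorem eq_sum_prod_ind {K : Finset ι} {f : (ι → Bool) → ℝ}
    (hf : ∀ ω ω', (∀ c ∈ K, ω c = ω' c) → f ω = f ω') (ω : ι → Bool) :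
    f ω = ∑ B ∈ K.powerset, f (fun c => decide (c ∈ B)) *
      ∏ c ∈ K, ind (ω c = decide (c ∈ B)) := by
  rw [Finset.sum_eq_single (K.filter fun c => ω c = true)]
  · rw [Finset.prod_eq_one, mul_one]
    · refine hf _ _ fun c hc => ?_
      cases h : ω c <;> simp [hc, h]
    · intro c hc
      refine ind_of ?_
      cases h : ω c <;> simp [hc, h]
  · intro B hB hne
    rw [Finset.mem_powerset] at hB
    have : ∃ c ∈ K, ¬(ω c = decide (c ∈ B)) := by
      by_contra! hall
      refine hne (Finset.ext fun c => ?_)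
      rw [Finset.mem_filter]
      constructor
      · intro hc
        exact ⟨hB hc, by rw [hall c (hB hc)]; simpa using hc⟩
      · rintro ⟨hc, h⟩
        rw [hall c hc] at h
        simpa using h
    obtain ⟨c, hc, h⟩ := this
    rw [Finset.prod_eq_zero hc (ind_of_not h), mul_zero]
  · intro h
    exact absurd (Finset.mem_powerset.2 (Finset.filter_subset _ _)) h

theorem integrable_and_integral_prod_ind (p : ι → unitInterval) (K : Finset ι) (b : ι → Bool) :
    Integrable (fun ω : ι → Bool => ∏ c ∈ K, ind (ω c = b c))
        (Measure.infinitePi fun c => bernoulliMeasure true false (p c)) ∧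
      ∫ ω, ∏ c ∈ K, ind (ω c = b c)
        ∂(Measure.infinitePi fun c => bernoulliMeasure true false (p c)) =
      ∏ c ∈ K, ((p c : ℝ) * ind (true = b c) + (1 - p c) * ind (false = b c)) := by
  have h1 : (fun ω : ι → Bool => ∏ c ∈ K, ind (ω c = b c)) =
      (Set.pi K fun c => {b c}).indicator fun _ => 1 := by
    funext ω
    by_cases h : ω ∈ Set.pi (K : Set ι) fun c => {b c}
    · rw [Set.indicator_of_mem h]
      exact Finset.prod_eq_one fun c hc => ind_of (h c hc)
    · rw [Set.indicator_of_notMem h]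
      simp only [Set.mem_pi, Finset.mem_coe, Set.mem_singleton_iff, not_forall] at h
      obtain ⟨c, hc, h⟩ := h
      exact Finset.prod_eq_zero hc (ind_of_not h)
  have hm : MeasurableSet (Set.pi (K : Set ι) fun c => {b c}) :=
    MeasurableSet.pi K.countable_toSet fun _ _ => measurableSet_singleton _
  rw [h1]
  refine ⟨(integrable_const (1 : ℝ)).indicator hm, ?_⟩
  rw [integral_indicator_const _ hm, smul_eq_mul, mul_one, measureReal_def,
    Measure.infinitePi_pi _ fun _ _ => measurableSet_singleton _, ENNReal.toReal_prod]
  refine Finset.prod_congr rfl fun c _ => ?_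
  rw [← measureReal_def, bernoulliMeasure_real_apply _ (measurableSet_singleton _)]
  cases h : b c <;> simp [ind]

/-- The integral of a function of finitely many independent coins is a finite average. -/
theorem integrable_and_integral_eq_avg (p : ι → unitInterval) (K : Finset ι) {f : (ι → Bool) → ℝ}
    (hf : ∀ ω ω', (∀ c ∈ K, ω c = ω' c) → f ω = f ω') (ω₀ : ι → Bool) :
    Integrable f (Measure.infinitePi fun c => bernoulliMeasure true false (p c)) ∧
      ∫ ω, f ω ∂(Measure.infinitePi fun c => bernoulliMeasure true false (p c)) =
        avg (fun c => (p c : ℝ)) K.toList f ω₀ := by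
  have h0 : f = fun ω => ∑ B ∈ K.powerset, f (fun c => decide (c ∈ B)) *
      ∏ c ∈ K, ind (ω c = decide (c ∈ B)) := funext (eq_sum_prod_ind hf)
  have h1 := fun B : Finset ι => integrable_and_integral_prod_ind p K fun c => decide (c ∈ B)
  constructor
  · rw [h0]
    exact integrable_finsetSum _ fun B _ => (h1 B).1.const_mul _
  · have h2 : ∀ B : Finset ι, avg (fun c => (p c : ℝ)) K.toList
        (fun ω => ∏ c ∈ K, ind (ω c = decide (c ∈ B))) ω₀ =
        ∏ c ∈ K, ((p c : ℝ) * ind (true = decide (c ∈ B)) +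
          (1 - p c) * ind (false = decide (c ∈ B))) := fun B => by
      rw [avg_prod K.toList K (fun c => c) (Set.injOn_id _) (by simp)
        fun c b => ind (b = decide (c ∈ B))]
    calc _ = ∑ B ∈ K.powerset, f (fun c => decide (c ∈ B)) *
          ∏ c ∈ K, ((p c : ℝ) * ind (true = decide (c ∈ B)) +
            (1 - p c) * ind (false = decide (c ∈ B))) := by
          conv_lhs => rw [h0]
          rw [integral_finsetSum _ fun B _ => (h1 B).1.const_mul _]
          exact Finset.sum_congr rfl fun B _ => by rw [integral_const_mul, (h1 B).2]
      _ = _ := by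
          conv_rhs => rw [h0]
          rw [avg_sum]
          refine Finset.sum_congr rfl fun B _ => ?_
          rw [avg_mul_left]
          exact congrArg _ (h2 B).symm

end Averaging


/-! ### The run of the algorithm -/

section Run

variable (I : SetSystem) (a T : ℕ) (ω : Samples)

/-- The state after the first `r` stages. -/
def stateBefore (r : ℕ) : State := (List.range' 1 r).foldl (stage I a T ω) ⟨∅, ∅⟩

/-- The state after the first `j` phases of stage `r + 1`. -/
def phaseState (r j : ℕ) : State :=
  (List.range j).foldl (phase I a T ω (r + 1)) (stateBefore I a T ω r)

/-- The state after the first `ℓ` iterations of phase `j` of stage `r + 1`. -/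
def iterState (r j ℓ : ℕ) : State :=
  (List.range' 1 ℓ).foldl
    (fun st' l => iteration I a T ω (r + 1)
      (sparseS I a T ω (r + 1) (j * T + l) (free I (phaseState I a T ω r j))) st')
    { cover := (phaseState I a T ω r j).cover ∪
        badSets I a T ω (r + 1) (free I (phaseState I a T ω r j))
      pretend := (phaseState I a T ω r j).pretend ∪
        badElts I a T ω (r + 1) j (free I (phaseState I a T ω r j)) }

/-- The elements that are free before phase `j` of stage `r + 1`. -/
abbrev phaseFree (r j : ℕ) : Finset ℕ := free I (phaseState I a T ω r j)

/-- The elements that are free after `ℓ` iterations of phase `j` of stage `r + 1`. -/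
abbrev iterFree (r j ℓ : ℕ) : Finset ℕ := free I (iterState I a T ω r j ℓ)

/-- The sets added in iteration `ℓ + 1` of phase `j` of stage `r + 1`. -/
def addedSets (r j ℓ : ℕ) : Finset ℕ :=
  (sparseS I a T ω (r + 1) (j * T + (ℓ + 1)) (phaseFree I a T ω r j)).filter fun S =>
    (2 ^ a / 2 ^ (r + 1) : ℚ) ≤ estimate I a T ω (r + 1) S (iterFree I a T ω r j ℓ)

theorem stateBefore_succ (r : ℕ) : stateBefore I a T ω (r + 1) = phaseState I a T ω r T := by
  simp only [stateBefore, phaseState, List.range'_concat, List.foldl_append, List.foldl_cons,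
    List.foldl_nil, stage]
  rw [show 1 + 1 * r = r + 1 by ring]

theorem phaseState_zero (r : ℕ) : phaseState I a T ω r 0 = stateBefore I a T ω r := rfl

theorem phaseState_succ (r j : ℕ) :
    phaseState I a T ω r (j + 1) = iterState I a T ω r j T := by
  simp only [phaseState, List.range_succ, List.foldl_append, List.foldl_cons, List.foldl_nil,
    phase, iterState]

theorem iterState_succ (r j ℓ : ℕ) :
    iterState I a T ω r j (ℓ + 1) =
      { iterState I a T ω r j ℓ with
        cover := (iterState I a T ω r j ℓ).cover ∪ addedSets I a T ω r j ℓ } := by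
  conv_lhs => rw [iterState, List.range'_concat, List.foldl_append]
  simp only [List.foldl_cons, List.foldl_nil]
  rw [show 1 + 1 * ℓ = ℓ + 1 by ring]
  rfl

theorem mainLoop_eq : mainLoop I a T ω = stateBefore I a T ω a := rfl

variable {I a T ω}

theorem mem_free {st : State} {e : ℕ} :
    e ∈ free I st ↔ (e ∈ I.elts ∧ ∀ S ∈ st.cover, e ∉ I.elemsOf S) ∧ e ∉ st.pretend := by
  simp [free, SetSystem.uncovered]

theorem free_subset_elts {st : State} : free I st ⊆ I.elts := fun _ h => (mem_free.1 h).1.1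

theorem free_anti {st st' : State} (h : st.cover ⊆ st'.cover) (h' : st.pretend ⊆ st'.pretend) :
    free I st' ⊆ free I st := by
  intro e he
  rw [mem_free] at he ⊢
  exact ⟨⟨he.1.1, fun S hS => he.1.2 S (h hS)⟩, fun hp => he.2 (h' hp)⟩

theorem elemProb_nonneg (a T i : ℕ) : 0 ≤ elemProb a T i := le_min zero_le_one (by positivity)

theorem setProb_nonneg (T k : ℕ) : 0 ≤ setProb T k := le_min zero_le_one (by positivity)

/-- Within a stage the sample is fixed and the free set shrinks, so an estimate that is large now
was large at all earlier times of the stage. -/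
theorem estimate_mono {i S : ℕ} {E E' : Finset ℕ} (h : E ⊆ E') :
    estimate I a T ω i S E ≤ estimate I a T ω i S E' := by
  unfold estimate
  refine div_le_div_of_nonneg_right ?_ (elemProb_nonneg a T i)
  exact_mod_cast Finset.card_le_card (Finset.inter_subset_inter_left h)

theorem iterState_zero_cover (r j : ℕ) : (iterState I a T ω r j 0).cover =
    (phaseState I a T ω r j).cover ∪ badSets I a T ω (r + 1) (phaseFree I a T ω r j) := rfl

theorem iterState_pretend (r j ℓ : ℕ) : (iterState I a T ω r j ℓ).pretend =
    (phaseState I a T ω r j).pretend ∪ badElts I a T ω (r + 1) j (phaseFree I a T ω r j) := by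
  induction ℓ with
  | zero => rfl
  | succ ℓ ih => rw [iterState_succ]; exact ih

theorem iterState_cover_mono {r j ℓ ℓ' : ℕ} (h : ℓ ≤ ℓ') :
    (iterState I a T ω r j ℓ).cover ⊆ (iterState I a T ω r j ℓ').cover := by
  induction h with
  | refl => exact subset_rfl
  | step _ ih => rw [iterState_succ]; exact ih.trans Finset.subset_union_left

theorem phaseState_cover_subset (r j ℓ : ℕ) :
    (phaseState I a T ω r j).cover ⊆ (iterState I a T ω r j ℓ).cover :=
  Finset.subset_union_left.trans (iterState_cover_mono (Nat.zero_le ℓ))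

theorem iterFree_anti {r j ℓ ℓ' : ℕ} (h : ℓ ≤ ℓ') :
    iterFree I a T ω r j ℓ' ⊆ iterFree I a T ω r j ℓ :=
  free_anti (iterState_cover_mono h) (by rw [iterState_pretend, iterState_pretend])

theorem iterFree_subset_phaseFree (r j ℓ : ℕ) :
    iterFree I a T ω r j ℓ ⊆ phaseFree I a T ω r j :=
  free_anti (phaseState_cover_subset _ _ _)
    (by rw [iterState_pretend]; exact Finset.subset_union_left)

theorem phaseFree_anti {r j j' : ℕ} (h : j ≤ j') :
    phaseFree I a T ω r j' ⊆ phaseFree I a T ω r j := by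
  induction h with
  | refl => exact subset_rfl
  | @step m _ ih =>
    refine Finset.Subset.trans ?_ ih
    rw [phaseFree, phaseState_succ]
    exact iterFree_subset_phaseFree _ _ _

theorem badSets_subset (i : ℕ) (E : Finset ℕ) : badSets I a T ω i E ⊆ I.sets :=
  Finset.filter_subset _ _

theorem sparseS_subset (i k : ℕ) (E : Finset ℕ) : sparseS I a T ω i k E ⊆ I.sets :=
  (Finset.filter_subset _ _).trans (Finset.filter_subset _ _)

theorem addedSets_subset (r j ℓ : ℕ) : addedSets I a T ω r j ℓ ⊆ I.sets :=
  (Finset.filter_subset _ _).trans (sparseS_subset _ _ _)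

theorem iterState_cover_subset_sets {r j : ℕ} (h : (phaseState I a T ω r j).cover ⊆ I.sets)
    (ℓ : ℕ) : (iterState I a T ω r j ℓ).cover ⊆ I.sets := by
  induction ℓ with
  | zero => exact Finset.union_subset h (badSets_subset _ _)
  | succ ℓ ih => rw [iterState_succ]; exact Finset.union_subset ih (addedSets_subset _ _ _)

theorem phaseState_cover_subset_sets {r : ℕ} (h : (stateBefore I a T ω r).cover ⊆ I.sets)
    (j : ℕ) : (phaseState I a T ω r j).cover ⊆ I.sets := by
  induction j with
  | zero => exact h
  | succ j ih => rw [phaseState_succ]; exact iterState_cover_subset_sets ih T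

theorem stateBefore_cover_subset_sets (r : ℕ) : (stateBefore I a T ω r).cover ⊆ I.sets := by
  induction r with
  | zero => exact Finset.empty_subset _
  | succ r ih => rw [stateBefore_succ]; exact phaseState_cover_subset_sets ih T

theorem isSetCover_phasedCover (I : SetSystem) (a T : ℕ) (ω : Samples) :
    I.IsSetCover (phasedCover I a T ω) := by
  constructor
  · refine Finset.union_subset ?_ (Finset.filter_subset _ _)
    rw [mainLoop_eq]
    exact stateBefore_cover_subset_sets a
  · intro e he
    by_cases h : ∃ S ∈ (mainLoop I a T ω).cover, e ∈ I.elemsOf S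
    · obtain ⟨S, hS, h⟩ := h
      exact ⟨S, Finset.mem_union_left _ hS, h⟩
    · push Not at h
      have hne : (I.sets.filter fun S => e ∈ I.elemsOf S).Nonempty := by
        obtain ⟨S, hS, h⟩ := I.coverable e he
        exact ⟨S, Finset.mem_filter.2 ⟨hS, h⟩⟩
      have hmin := Finset.min'_mem _ hne
      rw [Finset.mem_filter] at hmin
      refine ⟨_, Finset.mem_union_right _ (Finset.mem_filter.2 ⟨hmin.1, e,
        Finset.mem_filter.2 ⟨he, h⟩, hmin.2, fun S' hS' he' => ?_⟩), hmin.2⟩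
      exact Finset.min'_le _ _ (Finset.mem_filter.2 ⟨hS', he'⟩)

theorem mem_sparseS {i k S : ℕ} {E : Finset ℕ} : S ∈ sparseS I a T ω i k E ↔
    (S ∈ I.sets ∧ ω (.set i k S) = true) ∧ (2 ^ a / 2 ^ i : ℚ) ≤ estimate I a T ω i S E := by
  simp [sparseS, sampleS]

/-- Membership in `sparseS` reduces to the membership coin: a large current estimate was already
large at the beginning of the phase. -/
theorem mem_addedSets {r j ℓ S : ℕ} : S ∈ addedSets I a T ω r j ℓ ↔
    (S ∈ I.sets ∧ ω (.set (r + 1) (j * T + (ℓ + 1)) S) = true) ∧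
      (2 ^ a / 2 ^ (r + 1) : ℚ) ≤ estimate I a T ω (r + 1) S (iterFree I a T ω r j ℓ) := by
  rw [addedSets, Finset.mem_filter, mem_sparseS]
  constructor
  · rintro ⟨⟨h1, _⟩, h2⟩
    exact ⟨h1, h2⟩
  · rintro ⟨h1, h2⟩
    exact ⟨⟨h1, h2.trans (estimate_mono (iterFree_subset_phaseFree r j ℓ))⟩, h2⟩

theorem sampleB_inter_eq_empty {st : State} {S : ℕ} (hS : S ∈ st.cover) (i : ℕ) :
    sampleB I ω i S ∩ free I st = ∅ := by
  rw [Finset.eq_empty_iff_forall_notMem]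
  intro e he
  simp only [Finset.mem_inter, sampleB, Finset.mem_filter, List.mem_toFinset] at he
  exact (mem_free.1 he.2).1.2 S hS he.1.1

/-- Since thresholds are positive, a set with a large estimate has not been added before. -/
theorem estimate_eq_zero {st : State} {S : ℕ} (hS : S ∈ st.cover) (i : ℕ) :
    estimate I a T ω i S (free I st) = 0 := by
  rw [estimate, sampleB_inter_eq_empty hS]
  simp

/-- When every set is sampled in the last iteration of a stage, no set has a large estimate at the
end of the stage. -/
theorem estimate_lt_of_sampled {r S : ℕ} (hT : 0 < T) (hS : S ∈ I.sets)
    (h : ω (.set (r + 1) (T ^ 2) S) = true) :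
    estimate I a T ω (r + 1) S (phaseFree I a T ω r T) < 2 ^ a / 2 ^ (r + 1) := by
  by_contra! hge
  obtain ⟨n, rfl⟩ : ∃ n, T = n + 1 := ⟨T - 1, by omega⟩
  -- The last iteration of the last phase has index n(n+1) + (n+1) = (n+1)². A set that is added
  -- there has estimate 0 afterwards, against `hge`.
  have h1 : S ∈ addedSets I a (n + 1) ω r n n := by
    rw [mem_addedSets]
    refine ⟨⟨hS, by rw [← h]; congr 2; ring⟩, hge.trans (estimate_mono ?_)⟩
    rw [phaseFree, phaseState_succ]
    exact iterFree_anti (Nat.le_succ n)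
  have h2 : S ∈ (phaseState I a (n + 1) ω r (n + 1)).cover := by
    rw [phaseState_succ, iterState_succ]
    exact Finset.mem_union_right _ h1
  rw [estimate_eq_zero h2] at hge
  have : (0 : ℚ) < 2 ^ a / 2 ^ (r + 1) := by positivity
  linarith

end Run

/-! ### Dependence on the coins -/

section Congruence

variable {I : SetSystem} {a T : ℕ} {ω ω' : Samples}

theorem sampleB_congr {i S : ℕ}
    (h : ∀ e ∈ I.elemsOf S, ω (.elem i S e) = ω' (.elem i S e)) :
    sampleB I ω i S = sampleB I ω' i S := by
  unfold sampleB
  refine Finset.filter_congr fun e he => ?_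
  rw [h e (List.mem_toFinset.1 he)]

theorem estimate_congr {i S : ℕ} (h : ∀ e ∈ I.elemsOf S, ω (.elem i S e) = ω' (.elem i S e))
    (E : Finset ℕ) : estimate I a T ω i S E = estimate I a T ω' i S E := by
  rw [estimate, estimate, sampleB_congr h]

theorem badSets_congr {i : ℕ}
    (h : ∀ S ∈ I.sets, ∀ e ∈ I.elemsOf S, ω (.elem i S e) = ω' (.elem i S e)) (E : Finset ℕ) :
    badSets I a T ω i E = badSets I a T ω' i E := by
  unfold badSets
  exact Finset.filter_congr fun S hS => by rw [sampleB_congr (h S hS)]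

theorem sparseS_congr {i k : ℕ}
    (h : ∀ S ∈ I.sets, ∀ e ∈ I.elemsOf S, ω (.elem i S e) = ω' (.elem i S e))
    (h' : ∀ S ∈ I.sets, ω (.set i k S) = ω' (.set i k S)) (E : Finset ℕ) :
    sparseS I a T ω i k E = sparseS I a T ω' i k E := by
  ext S
  rw [mem_sparseS, mem_sparseS]
  by_cases hS : S ∈ I.sets
  · rw [h' S hS, estimate_congr (h S hS)]
  · simp [hS]

theorem badElts_congr {i j : ℕ} {E : Finset ℕ}
    (h : ∀ k, j * T < k → k ≤ (j + 1) * T →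
      sparseS I a T ω i k E = sparseS I a T ω' i k E) :
    badElts I a T ω i j E = badElts I a T ω' i j E := by
  unfold badElts
  refine Finset.biUnion_congr rfl fun k hk => ?_
  rw [Finset.mem_Icc] at hk
  rw [h k (by omega) hk.2]

/-- The hypothesis on `badElts` is separate because this step reads the membership coins of the
whole phase, including those of iterations after `ℓ`. -/
theorem iterState_congr {r j ℓ : ℕ} (h0 : phaseState I a T ω r j = phaseState I a T ω' r j)
    (hE : ∀ S ∈ I.sets, ∀ e ∈ I.elemsOf S, ω (.elem (r + 1) S e) = ω' (.elem (r + 1) S e))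
    (hS : ∀ k, j * T < k → k ≤ j * T + ℓ → ∀ S ∈ I.sets,
      ω (.set (r + 1) k S) = ω' (.set (r + 1) k S))
    (hbad : badElts I a T ω (r + 1) j (phaseFree I a T ω r j) =
      badElts I a T ω' (r + 1) j (phaseFree I a T ω r j)) :
    iterState I a T ω r j ℓ = iterState I a T ω' r j ℓ := by
  induction ℓ with
  | zero =>
    simp only [iterState, List.range'_zero, List.foldl_nil]
    rw [← h0, hbad, badSets_congr hE]
  | succ ℓ ih =>
    have ih := ih fun k h1 h2 => hS k h1 (by omega)
    have hadd : addedSets I a T ω r j ℓ = addedSets I a T ω' r j ℓ := by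
      ext S
      rw [mem_addedSets, mem_addedSets, iterFree, ih]
      by_cases h : S ∈ I.sets
      · rw [hS _ (by omega) le_rfl S h, estimate_congr (hE S h)]
      · simp [h]
    rw [iterState_succ, iterState_succ, ih, hadd]

theorem phaseState_congr {r j : ℕ} (h0 : stateBefore I a T ω r = stateBefore I a T ω' r)
    (hE : ∀ S ∈ I.sets, ∀ e ∈ I.elemsOf S, ω (.elem (r + 1) S e) = ω' (.elem (r + 1) S e))
    (hS : ∀ k, 0 < k → k ≤ j * T → ∀ S ∈ I.sets,
      ω (.set (r + 1) k S) = ω' (.set (r + 1) k S)) :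
    phaseState I a T ω r j = phaseState I a T ω' r j := by
  induction j with
  | zero => exact h0
  | succ j ih =>
    have hj : (j + 1) * T = j * T + T := by ring
    have ih := ih fun k h1 h2 => hS k h1 (by omega)
    rw [phaseState_succ, phaseState_succ]
    refine iterState_congr ih hE (fun k h1 h2 => hS k (by omega) (by omega)) ?_
    exact badElts_congr fun k h1 h2 => sparseS_congr hE (hS k (by omega) h2) _

theorem stateBefore_congr {r : ℕ}
    (hE : ∀ i, 0 < i → i ≤ r → ∀ S ∈ I.sets, ∀ e ∈ I.elemsOf S,
      ω (.elem i S e) = ω' (.elem i S e))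
    (hS : ∀ i, 0 < i → i ≤ r → ∀ k, 0 < k → k ≤ T ^ 2 → ∀ S ∈ I.sets,
      ω (.set i k S) = ω' (.set i k S)) :
    stateBefore I a T ω r = stateBefore I a T ω' r := by
  induction r with
  | zero => rfl
  | succ r ih =>
    rw [stateBefore_succ, stateBefore_succ]
    refine phaseState_congr (ih (fun i h1 h2 => hE i h1 (by omega))
      fun i h1 h2 => hS i h1 (by omega)) (hE _ (by omega) le_rfl) fun k h1 h2 => ?_
    exact hS _ (by omega) le_rfl k h1 (by rw [sq]; exact h2)

/-- Resampling `B_i(S₀)` does not change the run as long as `S₀` is not added and the estimates at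
the beginnings of the phases are large. -/
theorem iterState_congr_of_notMem {r j ℓ S₀ : ℕ}
    (h0 : phaseState I a T ω r j = phaseState I a T ω' r j)
    (hagree : ∀ c, (∀ e, c ≠ .elem (r + 1) S₀ e) → ω c = ω' c)
    (h1 : S₀ ∉ (iterState I a T ω r j ℓ).cover) (h1' : S₀ ∉ (iterState I a T ω' r j ℓ).cover)
    (h2 : (2 ^ a / 2 ^ (r + 1) : ℚ) ≤ estimate I a T ω (r + 1) S₀ (phaseFree I a T ω r j))
    (h2' : (2 ^ a / 2 ^ (r + 1) : ℚ) ≤ estimate I a T ω' (r + 1) S₀ (phaseFree I a T ω' r j)) :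
    iterState I a T ω r j ℓ = iterState I a T ω' r j ℓ := by
  have hB : ∀ S, S ≠ S₀ → ∀ e ∈ I.elemsOf S,
      ω (.elem (r + 1) S e) = ω' (.elem (r + 1) S e) := fun S hS e _ =>
    hagree _ fun e' h => hS (by injection h)
  have hset : ∀ k S, ω (.set (r + 1) k S) = ω' (.set (r + 1) k S) := fun k S =>
    hagree _ fun e' h => by simp at h
  -- Both outcomes give `S₀` a large estimate at the phase start, so whether it lies in a sparse
  -- family is decided by its membership coin alone.
  have hsparse : ∀ k, sparseS I a T ω (r + 1) k (phaseFree I a T ω r j) =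
      sparseS I a T ω' (r + 1) k (phaseFree I a T ω r j) := by
    intro k
    ext S
    rw [mem_sparseS, mem_sparseS, hset]
    by_cases hS : S = S₀
    · subst hS
      rw [phaseFree, ← h0] at h2'
      simp [h2, h2']
    · rw [estimate_congr (hB S hS)]
  induction ℓ with
  | zero =>
    rw [iterState_zero_cover, Finset.notMem_union] at h1 h1'
    simp only [iterState, List.range'_zero, List.foldl_nil]
    rw [phaseFree, ← h0] at h1'
    have hbadE := badElts_congr (j := j) fun k _ _ => hsparse k
    -- For `S₀` the two families agree because it is in neither; for other sets the samples are the
    -- same. The same reasoning handles each iteration below.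
    have hbadS : badSets I a T ω (r + 1) (phaseFree I a T ω r j) =
        badSets I a T ω' (r + 1) (phaseFree I a T ω r j) := by
      ext S
      by_cases hS : S = S₀
      · subst hS; simp [h1.2, h1'.2]
      · simp only [badSets, Finset.mem_filter, sampleB_congr (hB S hS)]
    rw [← h0, hbadE, hbadS]
  | succ ℓ ih =>
    rw [iterState_succ, Finset.notMem_union] at h1 h1'
    have ih := ih h1.1 h1'.1
    have hadd : addedSets I a T ω r j ℓ = addedSets I a T ω' r j ℓ := by
      ext S
      by_cases hS : S = S₀
      · subst hS; simp [h1.2, h1'.2]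
      · rw [mem_addedSets, mem_addedSets, hset, estimate_congr (hB S hS), iterFree, ih]
    rw [iterState_succ, iterState_succ, ih, hadd]

/-- Earlier stages do not read `B_{r+1}(S₀)`, so the runs agree at the stage start; each phase then
preserves the agreement. -/
theorem phaseState_congr_of_notMem {r j S₀ : ℕ}
    (hagree : ∀ c, (∀ e, c ≠ .elem (r + 1) S₀ e) → ω c = ω' c)
    (h1 : S₀ ∉ (phaseState I a T ω r j).cover) (h1' : S₀ ∉ (phaseState I a T ω' r j).cover)
    (h2 : ∀ m < j, (2 ^ a / 2 ^ (r + 1) : ℚ) ≤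
      estimate I a T ω (r + 1) S₀ (phaseFree I a T ω r m))
    (h2' : ∀ m < j, (2 ^ a / 2 ^ (r + 1) : ℚ) ≤
      estimate I a T ω' (r + 1) S₀ (phaseFree I a T ω' r m)) :
    phaseState I a T ω r j = phaseState I a T ω' r j := by
  induction j with
  | zero =>
    refine stateBefore_congr (fun i _ hi S _ e _ => ?_) fun i _ hi k _ _ S _ => ?_
    · refine hagree _ fun e' h => ?_
      injection h
      omega
    · exact hagree _ fun e' h => by simp at h
  | succ j ih =>
    rw [phaseState_succ] at h1 h1' ⊢
    rw [phaseState_succ]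
    have ih := ih (fun h => h1 (phaseState_cover_subset _ _ _ h))
      (fun h => h1' (phaseState_cover_subset _ _ _ h)) (fun m hm => h2 m (by omega))
      fun m hm => h2' m (by omega)
    exact iterState_congr_of_notMem ih hagree h1 h1' (h2 j (by omega)) (h2' j (by omega))

/-- The elements that share a set with `e`. -/
def elemNeighbors (I : SetSystem) (e : ℕ) : Finset ℕ :=
  (I.setsOf e).toFinset.biUnion fun S => (I.elemsOf S).toFinset

/-- No neighbor of `e` starts to pretend in phase `j` of stage `r + 1`. -/
def NoBadNeighbor (I : SetSystem) (a T : ℕ) (e r j : ℕ) (ω : Samples) : Prop :=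
  ∀ f ∈ elemNeighbors I e, f ∉ badElts I a T ω (r + 1) j (phaseFree I a T ω r j)

/-- Resampling the memberships in `𝒮_{i,k}` of the sets that contain `e`, for the iterations from a
given one on, does not change the run before this iteration, unless it makes a neighbor of `e`
pretend to be covered. -/
theorem iterState_congr_of_noBadNeighbor {r j ℓ e : ℕ} (he : e ∈ I.elts)
    (hagree : ∀ c, (∀ k S, j * T + ℓ < k → e ∈ I.elemsOf S → c ≠ .set (r + 1) k S) → ω c = ω' c)
    (h : NoBadNeighbor I a T e r j ω) (h' : NoBadNeighbor I a T e r j ω') :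
    iterState I a T ω r j ℓ = iterState I a T ω' r j ℓ := by
  have hE : ∀ i S f, ω (.elem i S f) = ω' (.elem i S f) := fun i S f =>
    hagree _ fun k S' _ _ h => by simp at h
  have hS : ∀ i k S, (i = r + 1 → k ≤ j * T + ℓ ∨ e ∉ I.elemsOf S) →
      ω (.set i k S) = ω' (.set i k S) := by
    intro i k S hc
    refine hagree _ fun k' S' hk' hS' h => ?_
    injection h with h1 h2 h3
    subst h2 h3
    rcases hc h1 with hc | hc
    · omega
    · exact hc hS'
  have h0 : phaseState I a T ω r j = phaseState I a T ω' r j := by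
    refine phaseState_congr (stateBefore_congr (fun i _ _ S _ f _ => hE i S f)
      fun i _ hi k _ _ S _ => hS i k S fun h => by omega) (fun S _ f _ => hE _ S f)
      fun k _ hk S _ => hS _ k S fun _ => Or.inl (by omega)
  refine iterState_congr h0 (fun S _ f _ => hE _ S f)
    (fun k _ hk S _ => hS _ k S fun _ => Or.inl hk) ?_
  ext f
  by_cases hf : f ∈ elemNeighbors I e
  · have h1 := h f hf
    have h2 := h' f hf
    rw [phaseFree, ← h0] at h2
    simp only [h1, h2]
  -- An element that is not a neighbor of `e` lies in no set containing `e`, so none of the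
  -- resampled coins enters its count.
  · simp only [badElts, Finset.mem_biUnion, Finset.mem_filter]
    refine exists_congr fun k => and_congr_right fun _ => and_congr_right fun hfE => ?_
    have : (sparseS I a T ω (r + 1) k (phaseFree I a T ω r j)).filter
          (fun S => f ∈ I.elemsOf S) =
        (sparseS I a T ω' (r + 1) k (phaseFree I a T ω r j)).filter
          (fun S => f ∈ I.elemsOf S) := by
      ext S
      rw [Finset.mem_filter, Finset.mem_filter, mem_sparseS, mem_sparseS]
      refine and_congr_left fun hfS => ?_
      rw [estimate_congr fun f' _ => hE _ S f']
      refine and_congr_left fun _ => and_congr_right fun hSI => ?_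
      rw [hS _ k S fun _ => Or.inr fun heS => hf ?_]
      refine Finset.mem_biUnion.2 ⟨S, ?_, List.mem_toFinset.2 hfS⟩
      exact List.mem_toFinset.2 ((I.mem_iff S hSI e he).1 heS)
    rw [this]

end Congruence


/-! ### Expectations over the coins of a set system -/

section Expectation

open Classical

variable (I : SetSystem) (a T : ℕ)

/-- The coins that the algorithm uses on the set system `I`. -/
noncomputable def coins : Finset Coin :=
  ((Finset.Icc 1 a).biUnion fun i => I.sets.biUnion fun S =>
      (I.elemsOf S).toFinset.image (Coin.elem i S)) ∪
    (Finset.Icc 1 a).biUnion fun i => (Finset.Icc 1 (T ^ 2)).biUnion fun k =>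
      I.sets.image (Coin.set i k)

theorem elem_mem_coins {i S e : ℕ} :
    Coin.elem i S e ∈ coins I a T ↔ (1 ≤ i ∧ i ≤ a) ∧ S ∈ I.sets ∧ e ∈ I.elemsOf S := by
  simp [coins]

theorem set_mem_coins {i k S : ℕ} :
    Coin.set i k S ∈ coins I a T ↔ (1 ≤ i ∧ i ≤ a) ∧ (1 ≤ k ∧ k ≤ T ^ 2) ∧ S ∈ I.sets := by
  simp [coins]

/-- The probabilities of the coins as real numbers. -/
noncomputable def coinBias (c : Coin) : ℝ := coinProb a T c

theorem coinBias_mem (c : Coin) : coinBias a T c ∈ unitInterval := coinProb_mem a T c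

/-- The expectation over the coins of `I`. -/
noncomputable def expect (f : Samples → ℝ) : ℝ :=
  avg (coinBias a T) (coins I a T).toList f fun _ => false

/-- The probability of an event that depends on the coins of `I`. -/
noncomputable def prob (P : Samples → Prop) : ℝ := expect I a T fun ω => ind (P ω)

variable {I a T}

theorem expect_mono {f g : Samples → ℝ} (h : ∀ ω, f ω ≤ g ω) :
    expect I a T f ≤ expect I a T g := avg_mono (coinBias_mem a T) h _

theorem expect_const (x : ℝ) : expect I a T (fun _ => x) = x := by
  rw [expect, avg_const]

theorem expect_add (f g : Samples → ℝ) :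
    expect I a T (fun ω => f ω + g ω) = expect I a T f + expect I a T g := by
  simp only [expect, avg_add]

theorem expect_mul_left (x : ℝ) (f : Samples → ℝ) :
    expect I a T (fun ω => x * f ω) = x * expect I a T f := by
  simp only [expect, avg_mul_left]

theorem expect_sum {α : Type*} (F : Finset α) (f : α → Samples → ℝ) :
    expect I a T (fun ω => ∑ x ∈ F, f x ω) = ∑ x ∈ F, expect I a T (f x) := by
  simp only [expect, avg_sum]

theorem expect_avg {A : List Coin} (hA : ∀ c ∈ A, c ∈ coins I a T) (f : Samples → ℝ) :
    expect I a T (avg (coinBias a T) A f) = expect I a T f := by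
  rw [expect, avg_avg_of_subset _ fun c hc => Finset.mem_toList.2 (hA c hc), expect]

theorem prob_nonneg (P : Samples → Prop) : 0 ≤ prob I a T P :=
  avg_nonneg (coinBias_mem a T) (fun _ => ind_nonneg _) _

theorem prob_mono {P Q : Samples → Prop} (h : ∀ ω, P ω → Q ω) : prob I a T P ≤ prob I a T Q :=
  expect_mono fun ω => ind_mono (h ω)

theorem prob_or_le (P Q : Samples → Prop) :
    prob I a T (fun ω => P ω ∨ Q ω) ≤ prob I a T P + prob I a T Q := by
  rw [prob, prob, prob, ← expect_add]
  exact expect_mono fun ω => ind_or_le _ _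

theorem prob_exists_le {α : Type*} (F : Finset α) (P : α → Samples → Prop) :
    prob I a T (fun ω => ∃ x ∈ F, P x ω) ≤ ∑ x ∈ F, prob I a T (P x) := by
  simp only [prob]
  rw [← expect_sum]
  exact expect_mono fun ω => ind_exists_le _ _

/-- The entry point for deferred decisions: in `h` the outcome `ω` already satisfies the event, so
the run at `ω` can serve as the frozen run of the fiber. -/
theorem prob_le_of_fiber {A : List Coin} (hA : ∀ c ∈ A, c ∈ coins I a T) {P : Samples → Prop}
    {δ : ℝ} (hδ : 0 ≤ δ)
    (h : ∀ ω, P ω → avg (coinBias a T) A (fun ω' => ind (P ω')) ω ≤ δ) : prob I a T P ≤ δ :=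
  avg_ind_le_of_fiber (coinBias_mem a T) (fun c hc => Finset.mem_toList.2 (hA c hc)) hδ h _

variable (I a T) in
/-- The coins with probability `1` show `true`. -/
def Typical (ω : Samples) : Prop := ∀ c ∈ coins I a T, coinProb a T c = 1 → ω c = true

/-- Exact estimates for p_i = 1 and the sampling of all sets at rate 1 hold only almost surely.
Excluding a null set allows the run to be argued about pointwise. -/
theorem prob_not_typical : prob I a T (fun ω => ¬Typical I a T ω) ≤ 0 := by
  have h1 : ∀ ω, ¬Typical I a T ω → ∃ c ∈ coins I a T, coinProb a T c = 1 ∧ ω c = false := by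
    intro ω h
    unfold Typical at h
    push Not at h
    obtain ⟨c, h1, h2, h3⟩ := h
    exact ⟨c, h1, h2, by simpa using h3⟩
  refine (prob_mono h1).trans ((prob_exists_le _ _).trans (Finset.sum_nonpos fun c hc => ?_))
  refine prob_le_of_fiber (A := [c]) (by simpa using hc) le_rfl fun ω hω => ?_
  simp [avg_cons, coinAvg, coinBias, hω.1, ind]

theorem prob_le_of_typical {P Q : Samples → Prop} (h : ∀ ω, Typical I a T ω → P ω → Q ω) :
    prob I a T P ≤ prob I a T Q := by
  have h1 : prob I a T P ≤ prob I a T (fun ω => Q ω ∨ ¬Typical I a T ω) :=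
    prob_mono fun ω hP => by
      by_cases ht : Typical I a T ω
      · exact Or.inl (h ω ht hP)
      · exact Or.inr ht
  linarith [prob_or_le (I := I) (a := a) (T := T) Q fun ω => ¬Typical I a T ω,
    prob_not_typical (I := I) (a := a) (T := T)]

theorem prob_eq_zero_of_typical {P : Samples → Prop} (h : ∀ ω, Typical I a T ω → ¬P ω) :
    prob I a T P ≤ 0 := by
  refine (prob_le_of_typical (Q := fun _ => False) fun ω h1 h2 => h ω h1 h2).trans ?_
  rw [prob]
  simp only [ind, if_false]
  rw [expect_const]

end Expectation

/-! ### Concentration of the estimates -/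

section Concentration

variable {I : SetSystem} {a T : ℕ}

/-- The coins of `B_i(S)`. -/
def elemCoins (I : SetSystem) (i S : ℕ) : List Coin := (I.elemsOf S).map (Coin.elem i S)

/-- The coins for the memberships in `𝒮_{i,k}` of the sets that contain `e`. -/
def setCoins (I : SetSystem) (i k e : ℕ) : List Coin := (I.setsOf e).map (Coin.set i k)

theorem elemCoins_mem_coins {r S : ℕ} (hr : r < a) (hS : S ∈ I.sets) :
    ∀ c ∈ elemCoins I (r + 1) S, c ∈ coins I a T := by
  intro c hc
  obtain ⟨e, he, rfl⟩ := List.mem_map.1 hc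
  rw [elem_mem_coins]
  exact ⟨⟨by omega, by omega⟩, hS, he⟩

theorem setCoins_mem_coins {r k e : ℕ} (hr : r < a) (hk : 0 < k) (hk' : k ≤ T ^ 2)
    (he : e ∈ I.elts) : ∀ c ∈ setCoins I (r + 1) k e, c ∈ coins I a T := by
  intro c hc
  obtain ⟨S, hS, rfl⟩ := List.mem_map.1 hc
  rw [set_mem_coins]
  exact ⟨⟨by omega, by omega⟩, ⟨hk, hk'⟩, I.setsOf_subset e he S hS⟩

theorem agree_of_elemCoins {ω ω' : Samples} {i S : ℕ}
    (h : ∀ c, c ∉ elemCoins I i S → ω' c = ω c) :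
    ∀ c, (∀ e, c ≠ Coin.elem i S e) → ω c = ω' c := by
  intro c hc
  refine (h c fun hmem => ?_).symm
  obtain ⟨e, _, rfl⟩ := List.mem_map.1 hmem
  exact hc e rfl

/-- The part of the set `S` that lies in `E`. -/
abbrev part (I : SetSystem) (S : ℕ) (E : Finset ℕ) : Finset ℕ := (I.elemsOf S).toFinset ∩ E

theorem sampleB_inter (ω : Samples) (i S : ℕ) (E : Finset ℕ) :
    sampleB I ω i S ∩ E = (part I S E).filter fun e => ω (.elem i S e) = true := by
  ext e
  simp only [sampleB, Finset.mem_inter, Finset.mem_filter]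
  tauto

theorem elem_injOn (i S : ℕ) (F : Set ℕ) : Set.InjOn (Coin.elem i S) F := by
  intro x _ y _ h
  injection h

theorem set_injOn (i k : ℕ) (F : Set ℕ) : Set.InjOn (Coin.set i k) F := by
  intro x _ y _ h
  injection h

theorem part_mem_elemCoins {i S : ℕ} {E : Finset ℕ} :
    ∀ e ∈ part I S E, Coin.elem i S e ∈ elemCoins I i S := by
  intro e he
  exact List.mem_map.2 ⟨e, List.mem_toFinset.1 (Finset.mem_inter.1 he).1, rfl⟩

theorem logFive_pos (ha : 0 < a) (hT : 0 < T) : 0 < logFive a T := by unfold logFive; positivity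

theorem logTen_eq (a T : ℕ) : logTen a T = logFive a T ^ 2 := by unfold logTen logFive; ring

theorem elemProb_pos (ha : 0 < a) (hT : 0 < T) (i : ℕ) : 0 < elemProb a T i := by
  have := logFive_pos ha hT
  exact lt_min zero_lt_one (by positivity)

/-- Truncating the probability at 1 only lowers the product, so the inequality needs no case
distinction. -/
theorem threshold_mul_elemProb_le (a T i : ℕ) :
    (2 ^ a / 2 ^ i : ℚ) * elemProb a T i ≤ logFive a T := by
  calc (2 ^ a / 2 ^ i : ℚ) * elemProb a T i
      ≤ (2 ^ a / 2 ^ i : ℚ) * (logFive a T * 2 ^ i / 2 ^ a) :=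
        mul_le_mul_of_nonneg_left (min_le_right _ _) (by positivity)
    _ = logFive a T := by field_simp

theorem threshold_mul_elemProb {i : ℕ} (h : elemProb a T i ≠ 1) :
    (2 ^ a / 2 ^ i : ℚ) * elemProb a T i = logFive a T := by
  have : elemProb a T i = logFive a T * 2 ^ i / 2 ^ a := by
    unfold elemProb at h ⊢
    rcases min_choice (1 : ℚ) (logFive a T * 2 ^ i / 2 ^ a) with h' | h'
    · exact absurd h' h
    · exact h'
  rw [this]
  field_simp

/-- When p_i is not truncated, p_i·θ is exactly the integer `logFive a T`, so the test on the
estimate becomes a test on the number of heads. -/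
theorem threshold_le_estimate_iff (ha : 0 < a) (hT : 0 < T) {i : ℕ} (h : elemProb a T i ≠ 1)
    (ω : Samples) (S : ℕ) (E : Finset ℕ) :
    (2 ^ a / 2 ^ i : ℚ) ≤ estimate I a T ω i S E ↔
      logFive a T ≤ ((part I S E).filter fun e => ω (.elem i S e) = true).card := by
  rw [estimate, le_div_iff₀ (elemProb_pos ha hT i), threshold_mul_elemProb h, sampleB_inter]
  norm_cast

theorem estimate_of_typical {r S : ℕ} (hr : r < a) (hS : S ∈ I.sets)
    (h : elemProb a T (r + 1) = 1) {ω : Samples} (hω : Typical I a T ω) (E : Finset ℕ) :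
    estimate I a T ω (r + 1) S E = (part I S E).card := by
  rw [estimate, h, div_one, sampleB_inter, Finset.filter_true_of_mem]
  intro e he
  refine hω _ (elemCoins_mem_coins hr hS _ (part_mem_elemCoins e he)) ?_
  exact h

theorem sampled_of_typical {r S : ℕ} (hr : r < a) (hT : 0 < T) (hS : S ∈ I.sets) {ω : Samples}
    (hω : Typical I a T ω) : ω (.set (r + 1) (T ^ 2) S) = true := by
  refine hω _ ((set_mem_coins I a T).2 ⟨⟨by omega, by omega⟩, ⟨?_, le_rfl⟩, hS⟩) ?_
  · exact Nat.one_le_iff_ne_zero.2 (by positivity)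
  · simp [coinProb, setProb]

/-- Tail bound for the estimate of a fixed set of elements, upper tail. -/
theorem avg_le_card_part (ω : Samples) (r S b : ℕ) (E : Finset ℕ) :
    avg (coinBias a T) (elemCoins I (r + 1) S) (fun ω' => ind (b ≤
      ((part I S E).filter fun e => ω' (.elem (r + 1) S e) = true).card)) ω ≤
      (1 / 2) ^ b * Real.exp ((part I S E).card * (elemProb a T (r + 1) : ℝ)) :=
  avg_ind_le_count (coinBias_mem a T) _ _ _ (elem_injOn _ _ _) part_mem_elemCoins _
    (fun _ _ => rfl) b ω

/-- Tail bound for the estimate of a fixed set of elements, lower tail. -/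
theorem avg_card_part_lt (ω : Samples) (r S b : ℕ) (E : Finset ℕ) :
    avg (coinBias a T) (elemCoins I (r + 1) S) (fun ω' => ind (
      ((part I S E).filter fun e => ω' (.elem (r + 1) S e) = true).card < b)) ω ≤
      2 ^ b * Real.exp (-((part I S E).card * (elemProb a T (r + 1) : ℝ) / 2)) :=
  avg_ind_count_lt (coinBias_mem a T) _ _ _ (elem_injOn _ _ _) part_mem_elemCoins _
    (fun _ _ => rfl) b ω

/-- The true rate is 1 - log 2 > 1/8. The value 1/8 is chosen as a common rate for all tail bounds.
-/
theorem two_pow_mul_exp_neg_le (D : ℕ) : (2 : ℝ) ^ D * Real.exp (-D) ≤ Real.exp (-(D / 8)) := by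
  rw [← Real.exp_log (show (0 : ℝ) < 2 by norm_num), ← Real.exp_nat_mul, ← Real.exp_add]
  refine Real.exp_le_exp.2 ?_
  have := Real.log_two_lt_d9
  have hD : (0 : ℝ) ≤ D := by positivity
  nlinarith

/-- Here the true rate is log 2 - 1/2, about 0.19. -/
theorem half_pow_mul_exp_half_le (D : ℕ) :
    (1 / 2 : ℝ) ^ D * Real.exp (D / 2) ≤ Real.exp (-(D / 8)) := by
  rw [one_div, ← Real.exp_log (show (0 : ℝ) < 2 by norm_num), ← Real.exp_neg, ← Real.exp_nat_mul,
    ← Real.exp_add]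
  refine Real.exp_le_exp.2 ?_
  have := Real.log_two_gt_d9
  have hD : (0 : ℝ) ≤ D := by positivity
  rw [Real.exp_log (by norm_num)]
  nlinarith

/-- The quadratic (4 + 1/8)D - D² log 2 has maximum about 6.2, which is below 7. -/
theorem half_pow_sq_mul_exp_le (D : ℕ) :
    (1 / 2 : ℝ) ^ (D ^ 2) * Real.exp (4 * D) ≤ Real.exp 7 * Real.exp (-(D / 8)) := by
  rw [one_div, ← Real.exp_log (show (0 : ℝ) < 2 by norm_num), ← Real.exp_neg, ← Real.exp_nat_mul,
    ← Real.exp_add, ← Real.exp_add]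
  refine Real.exp_le_exp.2 ?_
  have := Real.log_two_gt_d9
  have hD : (0 : ℝ) ≤ (D : ℝ) ^ 2 := by positivity
  push_cast
  nlinarith [sq_nonneg ((D : ℝ) - 3)]

/-- At the end of stage `r + 1`, with high probability every set has few free elements. -/
theorem prob_large_part_le (ha : 0 < a) (hT : 0 < T) {r S : ℕ} (hr : r < a) (hS : S ∈ I.sets) :
    prob I a T (fun ω => 2 * (2 ^ a / 2 ^ (r + 1) : ℚ) ≤ (part I S (phaseFree I a T ω r T)).card) ≤
      (T + 1) * Real.exp (-(logFive a T / 8)) := by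
  have hthr : (0 : ℚ) < 2 ^ a / 2 ^ (r + 1) := by positivity
  by_cases h1 : elemProb a T (r + 1) = 1
  -- For p = 1 the estimate is almost surely the true count, which is below the threshold at the end
  -- of the stage.
  · refine (prob_eq_zero_of_typical fun ω hω h => ?_).trans (by positivity)
    have h2 := estimate_lt_of_sampled (a := a) hT hS (sampled_of_typical hr hT hS hω)
    rw [estimate_of_typical hr hS h1 hω] at h2
    linarith
  -- `U m`: the phase boundary `m` is the first with a small estimate, although the true count is at
  -- least twice the threshold. The clauses about earlier boundaries make the run up to `m`
  -- independent of the sample of `S`.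
  · let U : ℕ → Samples → Prop := fun m ω =>
      S ∉ (phaseState I a T ω r m).cover ∧
      (∀ j < m, (2 ^ a / 2 ^ (r + 1) : ℚ) ≤
        estimate I a T ω (r + 1) S (phaseFree I a T ω r j)) ∧
      2 * (2 ^ a / 2 ^ (r + 1) : ℚ) ≤ (part I S (phaseFree I a T ω r m)).card ∧
      estimate I a T ω (r + 1) S (phaseFree I a T ω r m) < 2 ^ a / 2 ^ (r + 1)
    have hU : ∀ m, prob I a T (U m) ≤ Real.exp (-(logFive a T / 8)) := by
      intro m
      refine prob_le_of_fiber (elemCoins_mem_coins hr hS) (by positivity) fun ω hω => ?_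
      calc _ ≤ avg (coinBias a T) (elemCoins I (r + 1) S) (fun ω' => ind (
          ((part I S (phaseFree I a T ω r m)).filter
            fun e => ω' (.elem (r + 1) S e) = true).card < logFive a T)) ω := by
            -- All outcomes of the event in this fiber share the run of `ω`, so the event becomes a
            -- lower deviation for fresh coins on a fixed set of mean at least twice `logFive a T`.
            refine avg_mono_fiber (coinBias_mem a T) fun ω' hag => ind_mono fun hω' => ?_
            have heq := phaseState_congr_of_notMem (agree_of_elemCoins hag) hω.1 hω'.1 hω.2.1
              hω'.2.1
            have h3 := hω'.2.2.2
            rw [← not_le, threshold_le_estimate_iff ha hT h1, not_le] at h3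
            rwa [phaseFree, heq]
        _ ≤ _ := avg_card_part_lt ω r S _ _
        _ ≤ 2 ^ logFive a T * Real.exp (-(logFive a T : ℝ)) := by
            refine mul_le_mul_of_nonneg_left (Real.exp_le_exp.2 (neg_le_neg ?_)) (by positivity)
            have h4 := mul_le_mul_of_nonneg_right hω.2.2.1 (elemProb_nonneg a T (r + 1))
            rw [mul_assoc, threshold_mul_elemProb h1] at h4
            have h5 : (2 * logFive a T : ℝ) ≤
              (part I S (phaseFree I a T ω r m)).card * (elemProb a T (r + 1) : ℝ) := by
              exact_mod_cast h4
            linarith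
        _ ≤ _ := two_pow_mul_exp_neg_le _
    calc _ ≤ prob I a T (fun ω => ∃ m ∈ Finset.range (T + 1), U m ω) := by
          refine prob_le_of_typical fun ω hω h => ?_
          have h2 := estimate_lt_of_sampled (a := a) hT hS (sampled_of_typical hr hT hS hω)
          -- The estimate is small at the end of the stage, so a first boundary with a small
          -- estimate exists. There `S` is not yet in the cover, since it still has free elements.
          have hex : ∃ m, estimate I a T ω (r + 1) S (phaseFree I a T ω r m) <
            2 ^ a / 2 ^ (r + 1) := ⟨T, h2⟩
          have hle : Nat.find hex ≤ T := Nat.find_min' hex h2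
          have hcard : ∀ m ≤ T, 2 * (2 ^ a / 2 ^ (r + 1) : ℚ) ≤
              (part I S (phaseFree I a T ω r m)).card := fun m hm => h.trans (by
            exact_mod_cast Finset.card_le_card
              (Finset.inter_subset_inter_left (phaseFree_anti hm)))
          refine ⟨Nat.find hex, Finset.mem_range.2 (by omega), fun hmem => ?_, fun j hj => ?_,
            hcard _ hle, Nat.find_spec hex⟩
          · have h3 := hcard _ hle
            have h4 : part I S (phaseFree I a T ω r (Nat.find hex)) = ∅ := by
              rw [Finset.eq_empty_iff_forall_notMem]
              intro e he
              rw [Finset.mem_inter, List.mem_toFinset] at he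
              exact (mem_free.1 he.2).1.2 S hmem he.1
            rw [h4, Finset.card_empty] at h3
            norm_num at h3
            linarith
          · exact not_lt.1 (Nat.find_min hex hj)
      _ ≤ ∑ m ∈ Finset.range (T + 1), prob I a T (U m) := prob_exists_le _ _
      _ ≤ ∑ m ∈ Finset.range (T + 1), Real.exp (-(logFive a T / 8)) :=
          Finset.sum_le_sum fun m _ => hU m
      _ = _ := by simp

/-- The factor 4 is twice the factor 2 at the end of the previous stage, whose threshold was double.
For the first stage the bound is the trivial 2^a ≤ 4·2^(a-1). -/
theorem prob_large_part_stateBefore_le (ha : 0 < a) (hT : 0 < T)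
    {r S : ℕ} (hlen : (I.elemsOf S).length ≤ 2 ^ a) (hr : r < a) (hS : S ∈ I.sets) :
    prob I a T (fun ω => 4 * (2 ^ a / 2 ^ (r + 1) : ℚ) <
        (part I S (free I (stateBefore I a T ω r))).card) ≤
      (T + 1) * Real.exp (-(logFive a T / 8)) := by
  cases r with
  | zero =>
    refine (prob_eq_zero_of_typical fun ω _ h => ?_).trans (by positivity)
    have h1 : (part I S (free I (stateBefore I a T ω 0))).card ≤ 2 ^ a :=
      (Finset.card_le_card Finset.inter_subset_left).trans
        ((List.toFinset_card_le _).trans hlen)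
    have h2 : ((part I S (free I (stateBefore I a T ω 0))).card : ℚ) ≤ 2 ^ a := by
      exact_mod_cast h1
    have h3 : (0 : ℚ) < 2 ^ a := by positivity
    rw [zero_add, pow_one] at h
    linarith
  | succ r =>
    refine le_trans (prob_mono fun ω h => ?_)
      (prob_large_part_le (r := r) ha hT (by omega) hS)
    rw [stateBefore_succ] at h
    refine le_trans (le_of_eq ?_) h.le
    rw [pow_succ 2 (r + 1)]
    field_simp
    norm_num

/-- With high probability, no given set is bad. -/
theorem prob_bad_le (ha : 0 < a) (hT : 0 < T)
    {r S : ℕ} (hlen : (I.elemsOf S).length ≤ 2 ^ a) (hr : r < a) (hS : S ∈ I.sets) :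
    prob I a T (fun ω => logTen a T ≤
        (sampleB I ω (r + 1) S ∩ free I (stateBefore I a T ω r)).card) ≤
      (Real.exp 7 + (T + 1)) * Real.exp (-(logFive a T / 8)) := by
  let P : Samples → Prop := fun ω => logTen a T ≤
    (sampleB I ω (r + 1) S ∩ free I (stateBefore I a T ω r)).card ∧
    ((part I S (free I (stateBefore I a T ω r))).card : ℚ) ≤ 4 * (2 ^ a / 2 ^ (r + 1) : ℚ)
  have hP : prob I a T P ≤ Real.exp 7 * Real.exp (-(logFive a T / 8)) := by
    refine prob_le_of_fiber (elemCoins_mem_coins hr hS) (by positivity) fun ω hω => ?_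
    calc _ ≤ avg (coinBias a T) (elemCoins I (r + 1) S) (fun ω' => ind (logTen a T ≤
        ((part I S (free I (stateBefore I a T ω r))).filter
          fun e => ω' (.elem (r + 1) S e) = true).card)) ω := by
          refine avg_mono_fiber (coinBias_mem a T) fun ω' hag => ind_mono fun hω' => ?_
          have hag := agree_of_elemCoins hag
          -- The sample `B_{r+1}(S)` is not read in the first `r` stages, so here it is fresh
          -- without further conditions.
          have heq : stateBefore I a T ω r = stateBefore I a T ω' r := by
            refine stateBefore_congr (fun i _ hi S _ e _ => hag _ fun e' h => ?_)
              fun i _ hi k _ _ S _ => hag _ fun e' h => by simp at h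
            injection h
            omega
          have h3 := hω'.1
          rwa [sampleB_inter, ← heq] at h3
      _ ≤ _ := avg_le_card_part ω r S _ _
      -- The mean is at most four times `logFive a T`, while a bad set needs its square.
      _ ≤ (1 / 2) ^ (logFive a T ^ 2) * Real.exp (4 * logFive a T) := by
          rw [logTen_eq]
          refine mul_le_mul_of_nonneg_left (Real.exp_le_exp.2 ?_) (by positivity)
          have h4 := mul_le_mul_of_nonneg_right hω.2 (elemProb_nonneg a T (r + 1))
          have h5 := h4.trans (le_of_eq (mul_assoc _ _ _))
          have h6 := h5.trans (mul_le_mul_of_nonneg_left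
            (threshold_mul_elemProb_le a T (r + 1)) (by norm_num))
          exact_mod_cast h6
      _ ≤ _ := half_pow_sq_mul_exp_le _
  calc _ ≤ prob I a T (fun ω => P ω ∨ 4 * (2 ^ a / 2 ^ (r + 1) : ℚ) <
        (part I S (free I (stateBefore I a T ω r))).card) :=
        prob_mono fun ω h => by
          by_cases h' : 4 * (2 ^ a / 2 ^ (r + 1) : ℚ) <
            (part I S (free I (stateBefore I a T ω r))).card
          · exact Or.inr h'
          · exact Or.inl ⟨h, not_lt.1 h'⟩
    _ ≤ _ := prob_or_le _ _
    _ ≤ _ := by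
        have := prob_large_part_stateBefore_le ha hT hlen hr hS
        linarith

/-- With high probability, a given set that is added has many free elements. -/
theorem prob_added_small_le (ha : 0 < a) (hT : 0 < T) {r S : ℕ} (hr : r < a) (hS : S ∈ I.sets)
    (j ℓ : ℕ) :
    prob I a T (fun ω => S ∈ addedSets I a T ω r j ℓ ∧
        2 * ((part I S (iterFree I a T ω r j ℓ)).card : ℚ) < 2 ^ a / 2 ^ (r + 1)) ≤
      Real.exp (-(logFive a T / 8)) := by
  have hthr : (0 : ℚ) < 2 ^ a / 2 ^ (r + 1) := by positivity
  by_cases h1 : elemProb a T (r + 1) = 1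
  · refine (prob_eq_zero_of_typical fun ω hω h => ?_).trans (by positivity)
    have h2 := (mem_addedSets.1 h.1).2
    rw [estimate_of_typical hr hS h1 hω] at h2
    linarith [h.2]
  · refine prob_le_of_fiber (elemCoins_mem_coins hr hS) (by positivity) fun ω hω => ?_
    -- A set that is being added has not been added before and had large estimates at all earlier
    -- phase starts, which is what freezes the run.
    have key : ∀ ω, S ∈ addedSets I a T ω r j ℓ → S ∉ (iterState I a T ω r j ℓ).cover ∧
        ∀ m ≤ j, (2 ^ a / 2 ^ (r + 1) : ℚ) ≤
          estimate I a T ω (r + 1) S (phaseFree I a T ω r m) := by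
      intro ω h
      have h2 := (mem_addedSets.1 h).2
      refine ⟨fun hmem => ?_, fun m hm => h2.trans (estimate_mono ?_)⟩
      · rw [estimate_eq_zero hmem] at h2
        linarith
      · exact (iterFree_subset_phaseFree r j ℓ).trans (phaseFree_anti hm)
    calc _ ≤ avg (coinBias a T) (elemCoins I (r + 1) S) (fun ω' => ind (logFive a T ≤
        ((part I S (iterFree I a T ω r j ℓ)).filter
          fun e => ω' (.elem (r + 1) S e) = true).card)) ω := by
          refine avg_mono_fiber (coinBias_mem a T) fun ω' hag => ind_mono fun hω' => ?_
          have hag := agree_of_elemCoins hag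
          have k1 := key ω hω.1
          have k2 := key ω' hω'.1
          have heq := phaseState_congr_of_notMem hag
            (fun h => k1.1 (phaseState_cover_subset _ _ _ h))
            (fun h => k2.1 (phaseState_cover_subset _ _ _ h)) (fun m hm => k1.2 m hm.le)
            fun m hm => k2.2 m hm.le
          have heq' := iterState_congr_of_notMem heq hag k1.1 k2.1 (k1.2 j le_rfl) (k2.2 j le_rfl)
          have h3 := (mem_addedSets.1 hω'.1).2
          rw [threshold_le_estimate_iff ha hT h1] at h3
          rwa [iterFree, heq']
      _ ≤ _ := avg_le_card_part ω r S _ _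
      _ ≤ (1 / 2) ^ logFive a T * Real.exp (logFive a T / 2) := by
          refine mul_le_mul_of_nonneg_left (Real.exp_le_exp.2 ?_) (by positivity)
          have h4 := mul_le_mul_of_nonneg_right hω.2.le (elemProb_nonneg a T (r + 1))
          rw [mul_assoc, threshold_mul_elemProb h1] at h4
          have h5 : (2 * ((part I S (iterFree I a T ω r j ℓ)).card *
            (elemProb a T (r + 1) : ℝ)) : ℝ) ≤ logFive a T := by exact_mod_cast h4
          linarith
      _ ≤ _ := half_pow_mul_exp_half_le _

end Concentration


/-! ### Pretending elements -/

section Pretending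

variable {I : SetSystem} {a T : ℕ}

theorem setProb_eq {k : ℕ} (hk : k ≤ T ^ 2) : setProb T k = 2 ^ k / 2 ^ (T ^ 2) := by
  refine min_eq_right ?_
  rw [div_le_one (by positivity)]
  exact pow_le_pow_right₀ (by norm_num) hk

theorem setProb_le (T k : ℕ) : setProb T k ≤ 2 ^ k / 2 ^ (T ^ 2) := min_le_right _ _

theorem setProb_le_one (T k : ℕ) : setProb T k ≤ 1 := min_le_left _ _

/-- The sets that contain `e` and whose estimated number of elements in `E` is large. -/
def heavySets (I : SetSystem) (a T : ℕ) (ω : Samples) (i e : ℕ) (E : Finset ℕ) : Finset ℕ :=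
  I.sets.filter fun S => e ∈ I.elemsOf S ∧ (2 ^ a / 2 ^ i : ℚ) ≤ estimate I a T ω i S E

theorem heavySets_mono {ω : Samples} {i e : ℕ} {E E' : Finset ℕ} (h : E ⊆ E') :
    heavySets I a T ω i e E ⊆ heavySets I a T ω i e E' := by
  intro S hS
  simp only [heavySets, Finset.mem_filter] at hS ⊢
  exact ⟨hS.1, hS.2.1, hS.2.2.trans (estimate_mono h)⟩

theorem heavySets_congr {ω ω' : Samples} {i e : ℕ} (E : Finset ℕ)
    (h : ∀ S f, ω (.elem i S f) = ω' (.elem i S f)) :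
    heavySets I a T ω i e E = heavySets I a T ω' i e E := by
  unfold heavySets
  exact Finset.filter_congr fun S _ => by rw [estimate_congr fun f _ => h S f]

theorem heavySets_mem_setCoins {ω : Samples} {i e k : ℕ} {E : Finset ℕ} (he : e ∈ I.elts) :
    ∀ S ∈ heavySets I a T ω i e E, Coin.set i k S ∈ setCoins I i k e := by
  intro S hS
  simp only [heavySets, Finset.mem_filter] at hS
  exact List.mem_map.2 ⟨S, (I.mem_iff S hS.1 e he).1 hS.2.1, rfl⟩

theorem card_sets_containing_le {t : ℕ} {e : ℕ} (ht : (I.setsOf e).length ≤ t) (he : e ∈ I.elts) :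
    (I.sets.filter fun S => e ∈ I.elemsOf S).card ≤ t := by
  refine le_trans (Finset.card_le_card (t := (I.setsOf e).toFinset) fun S hS => ?_)
    ((List.toFinset_card_le _).trans ht)
  rw [Finset.mem_filter] at hS
  exact List.mem_toFinset.2 ((I.mem_iff S hS.1 e he).1 hS.2)

theorem card_heavySets_le {ω : Samples} {i e t : ℕ} {E : Finset ℕ}
    (ht : (I.setsOf e).length ≤ t) (he : e ∈ I.elts) :
    (heavySets I a T ω i e E).card ≤ t := by
  refine le_trans (Finset.card_le_card fun S hS => ?_) (card_sets_containing_le ht he)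
  simp only [heavySets, Finset.mem_filter] at hS ⊢
  exact ⟨hS.1, hS.2.1⟩

theorem card_elemNeighbors_le {s t : ℕ} (hb : I.Bounded s t) {e : ℕ} (he : e ∈ I.elts) :
    (elemNeighbors I e).card ≤ s * t := by
  calc _ ≤ (I.setsOf e).toFinset.card * s := by
        refine Finset.card_biUnion_le_card_mul _ _ _ fun S hS => ?_
        exact (List.toFinset_card_le _).trans
          (hb.1 S (I.setsOf_subset e he S (List.mem_toFinset.1 hS)))
    _ ≤ t * s := Nat.mul_le_mul_right _ ((List.toFinset_card_le _).trans (hb.2 e he))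
    _ = _ := Nat.mul_comm _ _

theorem elemNeighbors_subset {e : ℕ} (he : e ∈ I.elts) : elemNeighbors I e ⊆ I.elts := by
  intro f hf
  obtain ⟨S, hS, hf⟩ := Finset.mem_biUnion.1 hf
  exact I.elemsOf_subset S (I.setsOf_subset e he S (List.mem_toFinset.1 hS)) f
    (List.mem_toFinset.1 hf)

/-- The probability that `e` starts to pretend in phase `j` of stage `r + 1`. -/
noncomputable def pretendProb (I : SetSystem) (a T r j e : ℕ) : ℝ :=
  prob I a T fun ω => e ∈ badElts I a T ω (r + 1) j (phaseFree I a T ω r j)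

theorem prob_not_noBadNeighbor_le {r j e : ℕ} :
    prob I a T (fun ω => ¬NoBadNeighbor I a T e r j ω) ≤
      ∑ f ∈ elemNeighbors I e, pretendProb I a T r j f := by
  refine le_trans (prob_mono fun ω h => ?_) (prob_exists_le _ _)
  unfold NoBadNeighbor at h
  push Not at h
  exact h

/-- Sampling the heavy sets does not give many more sets than expected. -/
theorem prob_bad_at_le {r j k e : ℕ} (hr : r < a) (he : e ∈ I.elts) (hk : j * T < k)
    (hk' : k ≤ T ^ 2) (b : ℕ) (y : ℝ) :
    prob I a T (fun ω =>
        ((heavySets I a T ω (r + 1) e (phaseFree I a T ω r j)).card : ℝ) * (setProb T k : ℝ) ≤ y ∧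
        b ≤ ((sparseS I a T ω (r + 1) k (phaseFree I a T ω r j)).filter
          fun S => e ∈ I.elemsOf S).card) ≤ (1 / 2) ^ b * Real.exp y := by
  refine prob_le_of_fiber (setCoins_mem_coins hr (by omega) hk' he) (by positivity) fun ω hω => ?_
  calc _ ≤ avg (coinBias a T) (setCoins I (r + 1) k e) (fun ω' => ind (b ≤
      ((heavySets I a T ω (r + 1) e (phaseFree I a T ω r j)).filter
        fun S => ω' (.set (r + 1) k S) = true).card)) ω := by
        refine avg_mono_fiber (coinBias_mem a T) fun ω' hag => ind_mono fun hω' => ?_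
        have hE : ∀ i S f, ω (.elem i S f) = ω' (.elem i S f) := fun i S f =>
          (hag _ (by simp [setCoins])).symm
        have hS : ∀ i k' S, i ≠ r + 1 ∨ k' ≠ k → ω (.set i k' S) = ω' (.set i k' S) := by
          intro i k' S h
          refine (hag _ fun hmem => ?_).symm
          obtain ⟨S', _, h'⟩ := List.mem_map.1 hmem
          injection h'
          omega
        -- The membership coins of an iteration of phase `j` are not read before this phase starts,
        -- so the heavy sets are fixed on the fiber.
        have heq : phaseState I a T ω r j = phaseState I a T ω' r j :=
          phaseState_congr (stateBefore_congr (fun i _ _ S _ f _ => hE i S f)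
            fun i _ hi k' _ _ S _ => hS i k' S (Or.inl (by omega))) (fun S _ f _ => hE _ S f)
            fun k' _ hk' S _ => hS _ k' S (Or.inr (by omega))
        refine hω'.2.trans (Finset.card_le_card fun S hS => ?_)
        simp only [Finset.mem_filter, mem_sparseS, heavySets] at hS ⊢
        rw [phaseFree, heq, estimate_congr fun f _ => hE _ S f]
        tauto
    _ ≤ _ := avg_ind_le_count (coinBias_mem a T) _ _ _ (set_injOn _ _ _)
        (heavySets_mem_setCoins he) (setProb T k : ℝ) (fun _ _ => rfl) b ω
    _ ≤ _ := mul_le_mul_of_nonneg_left (Real.exp_le_exp.2 hω.1) (by positivity)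

theorem one_sub_pow_le_exp {q : ℝ} (hq : q ≤ 1) (d : ℕ) :
    (1 - q) ^ d ≤ Real.exp (-(d * q)) := by
  calc (1 - q) ^ d ≤ Real.exp (-q) ^ d :=
        pow_le_pow_left₀ (by linarith) (by linarith [Real.add_one_le_exp (-q)]) d
    _ = _ := by rw [← Real.exp_nat_mul]; congr 1; ring

/-- The heavy sets are those of the fixed outcome `ω₁`, so their coins are fresh and independent. -/
theorem avg_prod_false {ω₁ : Samples} {i k e : ℕ} {E : Finset ℕ} (he : e ∈ I.elts)
    {A : List Coin} (hA : ∀ c ∈ setCoins I i k e, c ∈ A) (ω : Samples) :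
    avg (coinBias a T) A
      (fun ω' => ∏ S ∈ heavySets I a T ω₁ i e E, ind (ω' (.set i k S) = false)) ω =
      (1 - (setProb T k : ℝ)) ^ (heavySets I a T ω₁ i e E).card := by
  rw [avg_prod A _ (Coin.set i k) (set_injOn _ _ _)
    (fun S hS => hA _ (heavySets_mem_setCoins he S hS)) fun _ b => ind (b = false)]
  simp [ind, coinBias, coinProb]

/-- No heavy set that contains an element that survives an iteration is sampled in it. -/
theorem set_eq_false_of_mem_iterFree {ω : Samples} {r j ℓ e : ℕ}
    (h : e ∈ iterFree I a T ω r j (ℓ + 1)) :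
    ∀ S ∈ heavySets I a T ω (r + 1) e (iterFree I a T ω r j ℓ),
      ω (.set (r + 1) (j * T + (ℓ + 1)) S) = false := by
  intro S hS
  simp only [heavySets, Finset.mem_filter] at hS
  by_contra hne
  rw [Bool.not_eq_false] at hne
  have h1 : S ∈ addedSets I a T ω r j ℓ := mem_addedSets.2 ⟨⟨hS.1, hne⟩, hS.2.2⟩
  refine (mem_free.1 h).1.2 S ?_ hS.2.1
  rw [iterState_succ]
  exact Finset.mem_union_right _ h1

/-- An element that survives a phase does not lie in many heavy sets, unless one of its neighbors
pretended in this phase. -/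
theorem prob_many_heavySets_le (hT : 0 < T) {r j e : ℕ} (hr : r < a) (hj : j < T)
    (he : e ∈ I.elts) (y : ℝ) :
    prob I a T (fun ω => e ∈ phaseFree I a T ω r (j + 1) ∧
      y ≤ ((heavySets I a T ω (r + 1) e (phaseFree I a T ω r (j + 1))).card : ℝ) *
        (setProb T ((j + 1) * T) : ℝ)) ≤
      Real.exp (-y) + ∑ f ∈ elemNeighbors I e, pretendProb I a T r j f := by
  -- The coins to be resampled are those of the last iteration of phase `j`, the step from `n` to `n
  -- + 1`.
  obtain ⟨n, rfl⟩ : ∃ n, T = n + 1 := ⟨T - 1, by omega⟩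
  let P : Samples → Prop := fun ω => (e ∈ phaseFree I a (n + 1) ω r (j + 1) ∧
      y ≤ ((heavySets I a (n + 1) ω (r + 1) e (phaseFree I a (n + 1) ω r (j + 1))).card : ℝ) *
        (setProb (n + 1) ((j + 1) * (n + 1)) : ℝ)) ∧ NoBadNeighbor I a (n + 1) e r j ω
  have hP : prob I a (n + 1) P ≤ Real.exp (-y) := by
    have hk : (j + 1) * (n + 1) = j * (n + 1) + (n + 1) := by ring
    refine prob_le_of_fiber (setCoins_mem_coins (k := (j + 1) * (n + 1)) hr (by positivity)
      (by nlinarith) he) (by positivity) fun ω hω => ?_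
    set H := heavySets I a (n + 1) ω (r + 1) e (iterFree I a (n + 1) ω r j n) with hH
    have hsub : phaseFree I a (n + 1) ω r (j + 1) ⊆ iterFree I a (n + 1) ω r j n := by
      rw [phaseFree, phaseState_succ]
      exact iterFree_anti (Nat.le_succ n)
    calc _ ≤ avg (coinBias a (n + 1)) (setCoins I (r + 1) ((j + 1) * (n + 1)) e) (fun ω' =>
          ∏ S ∈ H, ind (ω' (.set (r + 1) ((j + 1) * (n + 1)) S) = false)) ω := by
          refine avg_mono_fiber (coinBias_mem a (n + 1)) fun ω' hag =>
            ind_le_of_imp (Finset.prod_nonneg fun _ _ => ind_nonneg _) fun hω' => ?_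
          have hag' : ∀ c, (∀ k S, j * (n + 1) + n < k → e ∈ I.elemsOf S →
              c ≠ .set (r + 1) k S) → ω c = ω' c := by
            intro c hc
            refine (hag _ fun hmem => ?_).symm
            obtain ⟨S, hS, rfl⟩ := List.mem_map.1 hmem
            exact hc _ S (by omega)
              ((I.mem_iff S (I.setsOf_subset e he S hS) e he).2 hS) rfl
          -- Without pretending neighbors in either outcome, the run before the last iteration is
          -- frozen. Survival of `e` then forces all coins of the frozen heavy sets to be `false`.
          have heq := iterState_congr_of_noBadNeighbor he hag' hω.2 hω'.2
          have hE : ∀ S f, ω (.elem (r + 1) S f) = ω' (.elem (r + 1) S f) := fun S f =>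
            hag' _ fun k S' _ _ h => by simp at h
          have h1 := hω'.1.1
          rw [phaseFree, phaseState_succ] at h1
          have h2 := set_eq_false_of_mem_iterFree h1
          rw [iterFree, ← heq, ← heavySets_congr _ hE] at h2
          rw [Finset.prod_eq_one fun S hS => ind_of ?_]
          rw [hk]
          exact h2 S hS
      _ = (1 - (setProb (n + 1) ((j + 1) * (n + 1)) : ℝ)) ^ H.card :=
          avg_prod_false he (fun _ h => h) ω
      _ ≤ Real.exp (-(H.card * (setProb (n + 1) ((j + 1) * (n + 1)) : ℝ))) :=
          one_sub_pow_le_exp (by exact_mod_cast setProb_le_one _ _) _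
      _ ≤ _ := by
          -- Sets that are heavy at the end of the phase were heavy before its last iteration.
          refine Real.exp_le_exp.2 (neg_le_neg (hω.1.2.trans ?_))
          refine mul_le_mul_of_nonneg_right ?_ (by exact_mod_cast setProb_nonneg _ _)
          exact_mod_cast Finset.card_le_card (heavySets_mono hsub)
  calc _ ≤ prob I a (n + 1) (fun ω => P ω ∨ ¬NoBadNeighbor I a (n + 1) e r j ω) :=
        prob_mono fun ω h => by
          by_cases h' : NoBadNeighbor I a (n + 1) e r j ω
          · exact Or.inl ⟨h, h'⟩
          · exact Or.inr h'
    _ ≤ _ := prob_or_le _ _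
    _ ≤ _ := add_le_add hP prob_not_noBadNeighbor_le

theorem mem_badElts {ω : Samples} {i j e : ℕ} {E : Finset ℕ} :
    e ∈ badElts I a T ω i j E ↔ e ∈ E ∧ ∃ k ∈ Finset.Icc (j * T + 1) ((j + 1) * T),
      logTen a T * 2 ^ T ≤ ((sparseS I a T ω i k E).filter fun S => e ∈ I.elemsOf S).card := by
  simp only [badElts, Finset.mem_biUnion, Finset.mem_filter]
  constructor
  · rintro ⟨k, h1, h2, h3⟩; exact ⟨h2, k, h1, h3⟩
  · rintro ⟨h2, k, h1, h3⟩; exact ⟨k, h1, h2, h3⟩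

/-- The rate doubles with each iteration, so over one phase it grows by at most 2^T. This is the
source of the factor 2^T in the definition of bad elements. -/
theorem setProb_mul_le {j k : ℕ} (hjT : j * T ≤ T ^ 2) (hk : k ≤ (j + 1) * T) :
    (setProb T k : ℝ) ≤ 2 ^ T * (setProb T (j * T) : ℝ) := by
  rw [setProb_eq hjT]
  have h1 : (setProb T k : ℝ) ≤ 2 ^ k / 2 ^ (T ^ 2) := by
    have := (Rat.cast_le (K := ℝ)).2 (setProb_le T k)
    push_cast at this
    exact this
  have h2 : (2 : ℝ) ^ k ≤ 2 ^ T * 2 ^ (j * T) := by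
    rw [← pow_add]
    exact pow_le_pow_right₀ (by norm_num) (by linarith)
  refine h1.trans ?_
  push_cast
  rw [← mul_div_assoc]
  exact div_le_div_of_nonneg_right h2 (by positivity)

/-- The first phase has no preceding iteration to appeal to, but its rates are at most 2^T/t. Among
at most t sets the expected number sampled is thus at most 2^T. -/
theorem pretendProb_zero_le (hT : 0 < T) (hb : I.Bounded (2 ^ a) (2 ^ (T ^ 2)))
    {r e : ℕ} (hr : r < a) (he : e ∈ I.elts) :
    pretendProb I a T r 0 e ≤ T * ((1 / 2) ^ (logTen a T * 2 ^ T) * Real.exp (2 ^ T)) := by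
  calc _ ≤ prob I a T (fun ω => ∃ k ∈ Finset.Icc 1 T,
        ((heavySets I a T ω (r + 1) e (phaseFree I a T ω r 0)).card : ℝ) * (setProb T k : ℝ) ≤
          2 ^ T ∧
        logTen a T * 2 ^ T ≤ ((sparseS I a T ω (r + 1) k (phaseFree I a T ω r 0)).filter
          fun S => e ∈ I.elemsOf S).card) := by
        refine prob_mono fun ω h => ?_
        obtain ⟨_, k, hk, h⟩ := mem_badElts.1 h
        rw [zero_mul, zero_add, one_mul] at hk
        refine ⟨k, hk, ?_, h⟩
        rw [Finset.mem_Icc] at hk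
        have h1 := setProb_mul_le (T := T) (j := 0) (k := k) (by nlinarith) (by linarith)
        rw [zero_mul, setProb_eq (k := 0) (Nat.zero_le _)] at h1
        have h2 : ((heavySets I a T ω (r + 1) e (phaseFree I a T ω r 0)).card : ℝ) ≤
            2 ^ (T ^ 2) := by
          exact_mod_cast card_heavySets_le (hb.2 e he) he
        calc _ ≤ (2 : ℝ) ^ (T ^ 2) * (2 ^ T * ((2 ^ 0 / 2 ^ (T ^ 2) : ℚ) : ℝ)) :=
              mul_le_mul h2 h1 (by exact_mod_cast setProb_nonneg T k) (by positivity)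
          _ = _ := by push_cast; field_simp
    _ ≤ ∑ k ∈ Finset.Icc 1 T, (1 / 2) ^ (logTen a T * 2 ^ T) * Real.exp (2 ^ T) := by
        refine (prob_exists_le _ _).trans (Finset.sum_le_sum fun k hk => ?_)
        rw [Finset.mem_Icc] at hk
        exact prob_bad_at_le hr he (by omega) (by nlinarith) _ _
    _ = _ := by simp

/-- Split according to the number of heavy sets times the rate in the last iteration of the previous
phase. If this is below N/2, each of the `T` iterations expects at most half the pretending bound;
otherwise `e` has survived against the odds. -/
theorem pretendProb_succ_le (hT : 0 < T) {r j e : ℕ} (hr : r < a) (hj : j + 1 < T)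
    (he : e ∈ I.elts) :
    pretendProb I a T r (j + 1) e ≤
      T * ((1 / 2) ^ (logTen a T * 2 ^ T) * Real.exp ((logTen a T * 2 ^ T : ℕ) / 2)) +
        (Real.exp (-(logTen a T / 2)) + ∑ f ∈ elemNeighbors I e, pretendProb I a T r j f) := by
  have hjT : (j + 1) * T ≤ T ^ 2 := by nlinarith
  have hjT' : (j + 1 + 1) * T ≤ T ^ 2 := by nlinarith
  calc _ ≤ prob I a T (fun ω => (∃ k ∈ Finset.Icc ((j + 1) * T + 1) ((j + 1 + 1) * T),
        ((heavySets I a T ω (r + 1) e (phaseFree I a T ω r (j + 1))).card : ℝ) *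
          (setProb T k : ℝ) ≤ (logTen a T * 2 ^ T : ℕ) / 2 ∧
        logTen a T * 2 ^ T ≤ ((sparseS I a T ω (r + 1) k (phaseFree I a T ω r (j + 1))).filter
          fun S => e ∈ I.elemsOf S).card) ∨ (e ∈ phaseFree I a T ω r (j + 1) ∧
          (logTen a T / 2 : ℝ) ≤
            ((heavySets I a T ω (r + 1) e (phaseFree I a T ω r (j + 1))).card : ℝ) *
            (setProb T ((j + 1) * T) : ℝ))) := by
        refine prob_mono fun ω h => ?_
        obtain ⟨hE, k, hk, h⟩ := mem_badElts.1 h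
        rw [or_iff_not_imp_right]
        intro hn
        refine ⟨k, hk, ?_, h⟩
        rw [Finset.mem_Icc] at hk
        have h0 := not_le.1 fun h' => hn ⟨hE, h'⟩
        have h1 := setProb_mul_le hjT hk.2
        calc _ ≤ ((heavySets I a T ω (r + 1) e (phaseFree I a T ω r (j + 1))).card : ℝ) *
              (2 ^ T * (setProb T ((j + 1) * T) : ℝ)) :=
              mul_le_mul_of_nonneg_left h1 (by positivity)
          _ = 2 ^ T * (((heavySets I a T ω (r + 1) e (phaseFree I a T ω r (j + 1))).card : ℝ) *
              (setProb T ((j + 1) * T) : ℝ)) := by ring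
          _ ≤ 2 ^ T * (logTen a T / 2) := mul_le_mul_of_nonneg_left h0.le (by positivity)
          _ = _ := by push_cast; ring
    _ ≤ _ := prob_or_le _ _
    _ ≤ _ := by
        refine add_le_add ?_ (prob_many_heavySets_le hT hr (by omega) he _)
        refine (prob_exists_le _ _).trans ?_
        calc _ ≤ ∑ k ∈ Finset.Icc ((j + 1) * T + 1) ((j + 1 + 1) * T),
              (1 / 2) ^ (logTen a T * 2 ^ T) * Real.exp ((logTen a T * 2 ^ T : ℕ) / 2) :=
              Finset.sum_le_sum fun k hk => by
                rw [Finset.mem_Icc] at hk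
                exact prob_bad_at_le hr he (by omega) (hk.2.trans hjT') _ _
          _ = _ := by
              have : (j + 1 + 1) * T + 1 - ((j + 1) * T + 1) = T := by
                have : (j + 1 + 1) * T = (j + 1) * T + T := by ring
                omega
              simp [this]

theorem logFive_le_logTen (a T : ℕ) : logFive a T ≤ logTen a T := by
  rw [logTen_eq]
  exact Nat.le_self_pow (by norm_num) _

/-- For N ≥ 2 the exponent 2^T(1 - N log 2) is negative with room to spare. N = 1 forces T = 1, and
then the factor exp 2 pays for exp(2^T). -/
theorem half_pow_mul_exp_two_pow_le (ha : 0 < a) (hT : 0 < T) :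
    (1 / 2 : ℝ) ^ (logTen a T * 2 ^ T) * Real.exp (2 ^ T) ≤
      Real.exp 2 * Real.exp (-(logFive a T / 8)) := by
  have hlog := Real.log_two_gt_d9
  have hD : (logFive a T : ℝ) ≤ logTen a T := by exact_mod_cast logFive_le_logTen a T
  have h2 : (1 : ℝ) ≤ 2 ^ T := one_le_pow₀ (by norm_num)
  have h1 : (1 / 2 : ℝ) ^ (logTen a T * 2 ^ T) =
      Real.exp (-(logTen a T * 2 ^ T * Real.log 2)) := by
    rw [one_div, ← Real.exp_log (show (0 : ℝ) < 2 by norm_num), ← Real.exp_neg,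
      ← Real.exp_nat_mul, Real.exp_log (by norm_num)]
    push_cast
    congr 1; ring
  rw [h1, ← Real.exp_add, ← Real.exp_add]
  refine Real.exp_le_exp.2 ?_
  by_cases hN : 2 ≤ logTen a T
  · have hN' : (2 : ℝ) ≤ logTen a T := by exact_mod_cast hN
    nlinarith [mul_nonneg (sub_nonneg.2 hN') (sub_nonneg.2 h2),
      mul_nonneg (mul_nonneg (by positivity : (0 : ℝ) ≤ logTen a T)
        (by positivity : (0 : ℝ) ≤ 2 ^ T)) (sub_nonneg.2 hlog.le)]
  · have hT1 : T = 1 := by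
      by_contra hne
      apply hN
      have h3 : 2 ≤ T ^ 2 := by nlinarith [show 2 ≤ T by omega]
      have h4 : 2 ≤ (T ^ 2) ^ 10 := h3.trans (Nat.le_self_pow (by norm_num) _)
      have h5 : 1 ≤ a ^ 10 := Nat.one_le_iff_ne_zero.2 (by positivity)
      unfold logTen
      nlinarith
    have hN1 : (1 : ℝ) ≤ logTen a T := by
      have : 0 < logTen a T := by unfold logTen; positivity
      exact_mod_cast this
    rw [hT1] at hD hN1 ⊢
    nlinarith

/-- Pretending is very unlikely. -/
theorem pretendProb_le (ha : 0 < a) (hT : 0 < T) (hb : I.Bounded (2 ^ a) (2 ^ (T ^ 2)))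
    {r : ℕ} (hr : r < a) : ∀ j < T, ∀ e ∈ I.elts, pretendProb I a T r j e ≤
      10 * T * Real.exp (-(logFive a T / 8)) * ((2 : ℝ) ^ a * 2 ^ (T ^ 2) + 1) ^ j := by
  have hT1 : (1 : ℝ) ≤ T := by exact_mod_cast hT
  have hδ : 0 < Real.exp (-((logFive a T : ℝ) / 8)) := Real.exp_pos _
  intro j
  induction j with
  | zero =>
    intro _ e he
    rw [pow_zero, mul_one]
    refine (pretendProb_zero_le hT hb hr he).trans ?_
    have h1 := half_pow_mul_exp_two_pow_le ha hT
    have h2 : Real.exp 2 ≤ 10 := by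
      have h3 := Real.exp_one_lt_d9
      have h4 : Real.exp 2 = Real.exp 1 * Real.exp 1 := by rw [← Real.exp_add]; norm_num
      rw [h4]
      nlinarith [Real.exp_pos 1]
    calc _ ≤ (T : ℝ) * (10 * Real.exp (-(logFive a T / 8))) :=
          mul_le_mul_of_nonneg_left (h1.trans (mul_le_mul_of_nonneg_right h2 hδ.le))
            (by positivity)
      _ = _ := by ring
  | succ j ih =>
    intro hj e he
    set β : ℝ := 10 * T * Real.exp (-(logFive a T / 8)) with hβ
    set M : ℝ := (2 : ℝ) ^ a * 2 ^ (T ^ 2) with hM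
    have hM0 : 0 ≤ M := by positivity
    have hβ0 : 0 ≤ β := by positivity
    have hDN : (logFive a T : ℝ) ≤ logTen a T := by exact_mod_cast logFive_le_logTen a T
    have h1 : (1 / 2 : ℝ) ^ (logTen a T * 2 ^ T) * Real.exp ((logTen a T * 2 ^ T : ℕ) / 2) ≤
        Real.exp (-(logFive a T / 8)) := by
      refine (half_pow_mul_exp_half_le _).trans (Real.exp_le_exp.2 ?_)
      have h2 : (1 : ℝ) ≤ 2 ^ T := one_le_pow₀ (by norm_num)
      push_cast
      nlinarith [mul_nonneg (by positivity : (0 : ℝ) ≤ logTen a T) (sub_nonneg.2 h2)]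
    have h2 : Real.exp (-((logTen a T : ℝ) / 2)) ≤ Real.exp (-(logFive a T / 8)) :=
      Real.exp_le_exp.2 (by linarith [(by positivity : (0 : ℝ) ≤ logTen a T)])
    have h3 : ∑ f ∈ elemNeighbors I e, pretendProb I a T r j f ≤ M * (β * (M + 1) ^ j) := by
      calc _ ≤ ∑ f ∈ elemNeighbors I e, β * (M + 1) ^ j :=
            Finset.sum_le_sum fun f hf => ih (by omega) f (elemNeighbors_subset he hf)
        _ = (elemNeighbors I e).card * (β * (M + 1) ^ j) := by simp
        _ ≤ _ := by
            refine mul_le_mul_of_nonneg_right ?_ (by positivity)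
            rw [hM]
            exact_mod_cast card_elemNeighbors_le hb he
    have h4 : (1 : ℝ) ≤ (M + 1) ^ j := one_le_pow₀ (by linarith)
    refine (pretendProb_succ_le hT hr hj he).trans ?_
    have h5 := mul_le_mul_of_nonneg_left h1 (by positivity : (0 : ℝ) ≤ T)
    -- The constant 10 in β covers exp 2 in phase 0 as well as the inhomogeneous part (T +
    -- 1)·exp(-D/8) here.
    have h6 : T * Real.exp (-((logFive a T : ℝ) / 8)) + Real.exp (-((logFive a T : ℝ) / 8)) ≤
        β := by rw [hβ]; nlinarith
    have h7 : β ≤ β * (M + 1) ^ j := le_mul_of_one_le_right hβ0 h4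
    -- The recursion x ↦ β + Mx is closed by β + Mβ(M+1)^j ≤ β(M+1)^(j+1).
    rw [pow_succ]
    nlinarith

end Pretending


/-! ### The number of sets that cover an element -/

section Multiplicity

variable {I : SetSystem} {a T : ℕ}

/-- The elements that are free before iteration `κ + 1` of stage `r + 1`. -/
abbrev preFree (I : SetSystem) (a T : ℕ) (ω : Samples) (r κ : ℕ) : Finset ℕ :=
  iterFree I a T ω r (κ / T) (κ % T)

/-- The number of sets containing `e` that are added in iteration `ℓ + 1` of phase `j` of stage
`r + 1`. -/
def multiplicity (I : SetSystem) (a T : ℕ) (ω : Samples) (r j ℓ e : ℕ) : ℕ :=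
  ((addedSets I a T ω r j ℓ).filter fun S => e ∈ I.elemsOf S).card

/-- Within a phase the two sets agree. At a phase boundary the left side may be smaller, because the
first two steps of the next phase intervene. -/
theorem preFree_succ_subset (hT : 0 < T) (ω : Samples) (r κ : ℕ) :
    preFree I a T ω r (κ + 1) ⊆ iterFree I a T ω r (κ / T) (κ % T + 1) := by
  have h1 := Nat.mod_lt κ hT
  have h2 := Nat.div_add_mod' κ T
  by_cases h : κ % T + 1 < T
  · have h3 : (κ + 1) / T = κ / T := by
      rw [Nat.div_eq_iff hT]
      constructor
      · omega
      · omega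
    have h4 : (κ + 1) % T = κ % T + 1 := by
      have := Nat.div_add_mod' (κ + 1) T
      rw [h3] at this
      omega
    rw [preFree, h3, h4]
  · have h5 : κ + 1 = (κ / T + 1) * T := by
      have : (κ / T + 1) * T = κ / T * T + T := by ring
      omega
    have h3 : (κ + 1) / T = κ / T + 1 := by rw [h5, Nat.mul_div_cancel _ hT]
    have h4 : (κ + 1) % T = 0 := by rw [h5, Nat.mul_mod_left]
    rw [preFree, h3, h4]
    refine (iterFree_subset_phaseFree _ _ _).trans ?_
    rw [phaseFree, phaseState_succ, show κ % T + 1 = T by omega]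

/-- Independence of a coin from a function that ignores it. -/
theorem avg_ind_true_mul {A : List Coin} {c : Coin} (hc : c ∈ A) {g : Samples → ℝ}
    (hg : ∀ ω ω' : Samples, (∀ d, d ≠ c → ω d = ω' d) → g ω = g ω') :
    avg (coinBias a T) A (fun ω => ind (ω c = true) * g ω) =
      fun ω => coinBias a T c * avg (coinBias a T) A g ω := by
  classical
  rw [← avg_mul_left, ← avg_coinAvg_of_mem _ hc]
  congr 1
  funext ω
  simp only [coinAvg, Function.update_self, ind, if_true, Bool.false_eq_true, if_false]
  rw [hg (Function.update ω c true) ω fun d hd => Function.update_of_ne hd _ _]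
  ring

/-- By Bernoulli, (1 + dq)(1 - q)^d ≤ (1 + q)^d (1 - q)^d = (1 - q²)^d ≤ 1. This inequality bounds
the number of charges per element. -/
theorem mul_one_sub_pow_le {q : ℝ} (h0 : 0 ≤ q) (h1 : q ≤ 1) (d : ℕ) :
    d * q * (1 - q) ^ d ≤ 1 - (1 - q) ^ d := by
  have h2 : 1 + d * q ≤ (1 + q) ^ d := one_add_mul_le_pow (by linarith) d
  have h3 : (1 - q) ^ d * (1 + q) ^ d ≤ 1 := by
    rw [← mul_pow]
    exact pow_le_one₀ (by nlinarith) (by nlinarith)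
  have h4 : 0 ≤ (1 - q) ^ d := pow_nonneg (by linarith) d
  nlinarith [mul_le_mul_of_nonneg_left h2 h4]

theorem multiplicity_le {ω : Samples} {r j ℓ e t : ℕ} (ht : (I.setsOf e).length ≤ t)
    (he : e ∈ I.elts) : multiplicity I a T ω r j ℓ e ≤ t :=
  (Finset.card_le_card (Finset.filter_subset_filter _ (addedSets_subset r j ℓ))).trans
    (card_sets_containing_le ht he)

/-- The expected number of sets that cover `e` in an iteration is at most twice the probability
that `e` is covered in the previous iteration, up to a negligible term. -/
theorem expect_multiplicity_succ_le (hT : 0 < T) (hb : I.Bounded (2 ^ a) (2 ^ (T ^ 2)))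
    {r κ e : ℕ} (hr : r < a) (hκ : κ + 1 < T ^ 2) (he : e ∈ I.elts) :
    expect I a T (fun ω => ind (e ∈ preFree I a T ω r (κ + 1)) *
        (multiplicity I a T ω r ((κ + 1) / T) ((κ + 1) % T) e : ℝ)) ≤
      2 * prob I a T (fun ω => e ∈ preFree I a T ω r κ ∧
        e ∉ iterFree I a T ω r (κ / T) (κ % T + 1)) +
      (2 ^ (T ^ 2) + 2) * prob I a T (fun ω => ¬NoBadNeighbor I a T e r (κ / T) ω) := by
  set NB : Samples → Prop := NoBadNeighbor I a T e r (κ / T) with hNB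
  set cov : Samples → Prop := fun ω => e ∈ preFree I a T ω r κ ∧
        e ∉ iterFree I a T ω r (κ / T) (κ % T + 1) with hcov
  set f : Samples → ℝ := fun ω => ind (e ∈ preFree I a T ω r (κ + 1)) *
        (multiplicity I a T ω r ((κ + 1) / T) ((κ + 1) % T) e : ℝ) with hf
  -- Two consecutive iterations are resampled together: the first decides whether `e` survives, the
  -- second how many sets then cover it.
  set A : List Coin := setCoins I (r + 1) (κ + 1) e ++ setCoins I (r + 1) (κ + 2) e with hAdef
  have hA1 : ∀ c ∈ setCoins I (r + 1) (κ + 1) e, c ∈ A := fun c hc =>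
    List.mem_append_left _ hc
  have hA2 : ∀ c ∈ setCoins I (r + 1) (κ + 2) e, c ∈ A := fun c hc =>
    List.mem_append_right _ hc
  have hA : ∀ c ∈ A, c ∈ coins I a T := by
    intro c hc
    rcases List.mem_append.1 hc with hc | hc
    · exact setCoins_mem_coins hr (by omega) (by omega) he c hc
    · exact setCoins_mem_coins hr (by omega) (by omega) he c hc
  have hfle : ∀ ω, f ω ≤ 2 ^ (T ^ 2) := by
    intro ω
    have h1 : (multiplicity I a T ω r ((κ + 1) / T) ((κ + 1) % T) e : ℝ) ≤ 2 ^ (T ^ 2) := by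
      exact_mod_cast multiplicity_le (hb.2 e he) he
    calc f ω ≤ 1 * _ := mul_le_mul_of_nonneg_right (ind_le_one _) (Nat.cast_nonneg _)
      _ ≤ _ := by rwa [one_mul]
  have hp := coinBias_mem a T
  -- The comparison holds on every fiber; the tower property gives the claim for expectations.
  suffices h : ∀ ω, avg (coinBias a T) A f ω ≤ 2 * avg (coinBias a T) A (fun ω => ind (cov ω)) ω +
      (2 ^ (T ^ 2) + 2) * avg (coinBias a T) A (fun ω => ind (¬NB ω)) ω by
    have := expect_mono (I := I) (a := a) (T := T) h
    rw [expect_add, expect_mul_left, expect_mul_left, expect_avg hA, expect_avg hA,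
      expect_avg hA] at this
    exact this
  intro ω₀
  by_cases hex : ∃ ω, (∀ c, c ∉ A → ω c = ω₀ c) ∧ NB ω
  swap
  -- Some neighbor pretends everywhere on this fiber, so the trivial bound t on the count suffices.
  · have h1 : avg (coinBias a T) A f ω₀ ≤
        avg (coinBias a T) A (fun ω => (2 ^ (T ^ 2) + 2) * ind (¬NB ω)) ω₀ := by
      refine avg_mono_fiber hp fun ω hω => (hfle ω).trans ?_
      rw [ind_of fun h => hex ⟨ω, hω, h⟩]
      linarith
    rw [avg_mul_left] at h1
    have h2 : 0 ≤ avg (coinBias a T) A (fun ω => ind (cov ω)) ω₀ :=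
      avg_nonneg hp (fun _ => ind_nonneg _) _
    linarith
  obtain ⟨ω, hω₀, hω⟩ := hex
  rw [avg_congr_base hω₀, avg_congr_base (f := fun ω => ind (cov ω)) hω₀,
    avg_congr_base (f := fun ω => ind (¬NB ω)) hω₀]
  clear hω₀ ω₀
  set E := preFree I a T ω r κ with hE
  set H := heavySets I a T ω (r + 1) e E with hH
  have hidx : κ / T * T + κ % T = κ := Nat.div_add_mod' κ T
  have hidx' : (κ + 1) / T * T + (κ + 1) % T = κ + 1 := Nat.div_add_mod' (κ + 1) T
  -- `Q` indicates that the first of the two iterations samples none of the frozen heavy sets; `e`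
  -- can survive this iteration only if `Q` is 1.
  set Q : Samples → ℝ := fun ω' => ∏ S ∈ H, ind (ω' (.set (r + 1) (κ + 1) S) = false) with hQ
  have hQ0 : ∀ ω', 0 ≤ Q ω' := fun ω' => Finset.prod_nonneg fun _ _ => ind_nonneg _
  have hfiber : ∀ ω', (∀ c, c ∉ A → ω' c = ω c) →
      (∀ S g, ω (.elem (r + 1) S g) = ω' (.elem (r + 1) S g)) ∧ (NB ω' →
        iterState I a T ω r (κ / T) (κ % T) = iterState I a T ω' r (κ / T) (κ % T)) := by
    intro ω' hag
    have hag' : ∀ c, (∀ k S, κ / T * T + κ % T < k → e ∈ I.elemsOf S →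
        c ≠ .set (r + 1) k S) → ω c = ω' c := by
      intro c hc
      refine (hag _ fun hmem => ?_).symm
      rcases List.mem_append.1 hmem with hmem | hmem
      · obtain ⟨S, hS, rfl⟩ := List.mem_map.1 hmem
        exact hc _ S (by omega) ((I.mem_iff S (I.setsOf_subset e he S hS) e he).2 hS) rfl
      · obtain ⟨S, hS, rfl⟩ := List.mem_map.1 hmem
        exact hc _ S (by omega) ((I.mem_iff S (I.setsOf_subset e he S hS) e he).2 hS) rfl
    exact ⟨fun S g => hag' _ fun k S' _ _ h => by simp at h,
      fun h => iterState_congr_of_noBadNeighbor he hag' hω h⟩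
  -- the count is bounded by the number of sampled heavy sets
  have hf1 : ∀ ω', (∀ c, c ∉ A → ω' c = ω c) → f ω' ≤
      (∑ S ∈ H, ind (e ∈ E) * (ind (ω' (.set (r + 1) (κ + 2) S) = true) * Q ω')) +
        2 ^ (T ^ 2) * ind (¬NB ω') := by
    intro ω' hag
    have hsum0 : 0 ≤ ∑ S ∈ H, ind (e ∈ E) * (ind (ω' (.set (r + 1) (κ + 2) S) = true) * Q ω') :=
      Finset.sum_nonneg fun _ _ => mul_nonneg (ind_nonneg _) (mul_nonneg (ind_nonneg _) (hQ0 _))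
    by_cases hnb : NB ω'
    swap
    · rw [ind_of hnb]
      linarith [hfle ω']
    obtain ⟨hel, hst⟩ := hfiber ω' hag
    have hst := hst hnb
    rw [ind_of_not (not_not.2 hnb), mul_zero, add_zero]
    by_cases hmem : e ∈ preFree I a T ω' r (κ + 1)
    swap
    · simp only [hf]
      rw [ind_of_not hmem, zero_mul]
      exact hsum0
    have h1 := preFree_succ_subset hT ω' r κ hmem
    have h2 := set_eq_false_of_mem_iterFree h1
    rw [iterFree, ← hst, ← heavySets_congr _ hel, ← add_assoc, hidx] at h2
    have h3 : Q ω' = 1 := Finset.prod_eq_one fun S hS => ind_of (h2 S hS)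
    have h4 : e ∈ E := by
      have := iterFree_anti (Nat.le_succ _) h1
      rwa [iterFree, ← hst] at this
    simp only [hf]
    rw [ind_of hmem, one_mul, h3, ind_of h4]
    simp only [one_mul, mul_one]
    rw [← card_filter_eq_sum_ind]
    norm_cast
    refine Finset.card_le_card fun S hS => ?_
    rw [Finset.mem_filter, mem_addedSets, ← add_assoc, hidx'] at hS
    simp only [hH, heavySets, Finset.mem_filter]
    refine ⟨⟨hS.1.1.1, hS.2, ?_⟩, hS.1.1.2⟩
    rw [estimate_congr fun g _ => hel S g]
    refine hS.1.2.trans (estimate_mono ?_)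
    rw [show E = preFree I a T ω' r κ from congrArg (free I) hst]
    exact (preFree_succ_subset hT ω' r κ).trans (iterFree_anti (Nat.le_succ _))
  -- `e` is covered when a heavy set is sampled
  have hg1 : ∀ ω', (∀ c, c ∉ A → ω' c = ω c) →
      ind (e ∈ E) * (1 + -1 * Q ω') ≤ ind (cov ω') + ind (¬NB ω') := by
    intro ω' hag
    have hle : ind (e ∈ E) * (1 + -1 * Q ω') ≤ 1 * 1 := by
      by_cases h : e ∈ E
      · rw [ind_of h]
        linarith [hQ0 ω']
      · rw [ind_of_not h]
        norm_num
    by_cases hnb : NB ω'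
    swap
    · rw [ind_of hnb]
      linarith [ind_nonneg (cov ω')]
    obtain ⟨hel, hst⟩ := hfiber ω' hag
    have hst := hst hnb
    rw [ind_of_not (not_not.2 hnb), add_zero]
    by_cases h : e ∈ E
    swap
    · rw [ind_of_not h, zero_mul]
      exact ind_nonneg _
    by_cases hc : cov ω'
    · rw [ind_of hc]
      linarith
    have h1 : e ∈ iterFree I a T ω' r (κ / T) (κ % T + 1) := by
      by_contra h1
      refine hc ⟨?_, h1⟩
      rwa [hE, preFree, iterFree, hst] at h
    have h2 := set_eq_false_of_mem_iterFree h1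
    rw [iterFree, ← hst, ← heavySets_congr _ hel, ← add_assoc, hidx] at h2
    have h3 : Q ω' = 1 := Finset.prod_eq_one fun S hS => ind_of (h2 S hS)
    rw [h3, ind_of_not hc]
    norm_num
  set q : ℝ := (setProb T (κ + 1) : ℝ) with hq
  -- The rate exactly doubles, also across a phase boundary, because no truncation occurs up to
  -- index T².
  have hq2 : (setProb T (κ + 2) : ℝ) = 2 * q := by
    rw [hq, setProb_eq (by omega), setProb_eq (by omega)]
    push_cast
    ring
  have hq0 : 0 ≤ q := by rw [hq]; exact_mod_cast setProb_nonneg _ _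
  have hq1 : q ≤ 1 := by rw [hq]; exact_mod_cast setProb_le_one _ _
  have hQavg : avg (coinBias a T) A Q ω = (1 - q) ^ H.card := avg_prod_false he hA1 ω
  have hfavg := avg_mono_fiber hp hf1
  have hgavg := avg_mono_fiber hp hg1
  rw [avg_add, avg_sum, avg_mul_left] at hfavg
  simp only [avg_mul_left, avg_add, avg_const] at hgavg
  rw [hQavg] at hgavg
  have hterm : ∀ S ∈ H, avg (coinBias a T) A (fun ω' => ind (e ∈ E) *
      (ind (ω' (.set (r + 1) (κ + 2) S) = true) * Q ω')) ω =
      ind (e ∈ E) * (2 * q * (1 - q) ^ H.card) := by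
    intro S hS
    rw [avg_mul_left, avg_ind_true_mul (hA2 _ (heavySets_mem_setCoins he S hS))]
    · simp only
      rw [hQavg]
      rw [← hq2]; rfl
    · intro ω₁ ω₂ h
      refine Finset.prod_congr rfl fun S' _ => ?_
      rw [h _ (by simp)]
  simp only at hfavg
  rw [Finset.sum_congr rfl hterm, Finset.sum_const, nsmul_eq_mul] at hfavg
  -- Twice this inequality, with `hgavg`, turns the main term of `hfavg` into the probability of
  -- being covered. The error coefficient is t from the trivial bound plus 2 from doubling the error
  -- in `hgavg`.
  have hkey := mul_le_mul_of_nonneg_left (mul_one_sub_pow_le hq0 hq1 H.card) (ind_nonneg (e ∈ E))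
  have hn0 : 0 ≤ avg (coinBias a T) A (fun ω => ind (¬NB ω)) ω :=
    avg_nonneg hp (fun _ => ind_nonneg _) _
  nlinarith

/-- The expected number of sets that cover `e` in the first iteration of a stage. -/
theorem expect_multiplicity_zero_le (hT : 0 < T) (hb : I.Bounded (2 ^ a) (2 ^ (T ^ 2)))
    {r e : ℕ} (hr : r < a) (he : e ∈ I.elts) :
    expect I a T (fun ω => ind (e ∈ preFree I a T ω r 0) *
        (multiplicity I a T ω r (0 / T) (0 % T) e : ℝ)) ≤
      2 * prob I a T (fun ω => e ∈ free I (stateBefore I a T ω r)) := by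
  rw [Nat.zero_div, Nat.zero_mod]
  have hp := coinBias_mem a T
  set A := setCoins I (r + 1) 1 e with hAdef
  have hA : ∀ c ∈ A, c ∈ coins I a T :=
    setCoins_mem_coins hr (by omega) (Nat.one_le_iff_ne_zero.2 (by positivity)) he
  rw [prob, ← expect_mul_left, ← expect_avg hA, ← expect_avg hA (fun ω => 2 * _)]
  refine expect_mono fun ω => ?_
  set H := I.sets.filter fun S => e ∈ I.elemsOf S with hH
  have heq : ∀ ω', (∀ c, c ∉ A → ω' c = ω c) →
      stateBefore I a T ω r = stateBefore I a T ω' r := by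
    intro ω' hag
    refine stateBefore_congr (fun i _ hi S _ g _ => (hag _ (by simp [hAdef, setCoins])).symm)
      fun i _ hi k _ _ S _ => (hag _ fun hmem => ?_).symm
    obtain ⟨S', _, h'⟩ := List.mem_map.1 hmem
    injection h'
    omega
  calc _ ≤ avg (coinBias a T) A (fun ω' => ∑ S ∈ H,
        ind (e ∈ free I (stateBefore I a T ω r)) *
          (ind (ω' (.set (r + 1) 1 S) = true) * 1)) ω := by
        refine avg_mono_fiber hp fun ω' hag => ?_
        by_cases hmem : e ∈ preFree I a T ω' r 0
        · have h1 : e ∈ free I (stateBefore I a T ω r) := by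
            rw [heq ω' hag]
            rw [preFree, Nat.zero_div, Nat.zero_mod] at hmem
            exact iterFree_subset_phaseFree r 0 0 hmem
          rw [ind_of hmem, ind_of h1]
          simp only [one_mul, mul_one]
          rw [← card_filter_eq_sum_ind]
          norm_cast
          refine Finset.card_le_card fun S hS => ?_
          rw [Finset.mem_filter, mem_addedSets] at hS
          simp only [hH, Finset.mem_filter]
          rw [zero_mul, zero_add, zero_add] at hS
          exact ⟨⟨hS.1.1.1, hS.2⟩, hS.1.1.2⟩
        · rw [ind_of_not hmem, zero_mul]
          exact Finset.sum_nonneg fun _ _ => mul_nonneg (ind_nonneg _)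
            (mul_nonneg (ind_nonneg _) zero_le_one)
    _ = ∑ S ∈ H, ind (e ∈ free I (stateBefore I a T ω r)) * (setProb T 1 : ℝ) := by
        rw [avg_sum]
        refine Finset.sum_congr rfl fun S hS => ?_
        rw [Finset.mem_filter] at hS
        have hc : Coin.set (r + 1) 1 S ∈ A :=
          List.mem_map.2 ⟨S, (I.mem_iff S hS.1 e he).1 hS.2, rfl⟩
        rw [avg_mul_left, avg_ind_true_mul hc (fun _ _ _ => rfl), avg_const]
        simp only [mul_one]
        rfl
    _ = H.card * (setProb T 1 : ℝ) * ind (e ∈ free I (stateBefore I a T ω r)) := by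
        rw [Finset.sum_const, nsmul_eq_mul]; ring
    _ ≤ 2 * ind (e ∈ free I (stateBefore I a T ω r)) := by
        -- At most t sets contain `e`, each sampled with probability at most 2/t.
        refine mul_le_mul_of_nonneg_right ?_ (ind_nonneg _)
        have h1 : (H.card : ℝ) ≤ 2 ^ (T ^ 2) := by
          exact_mod_cast card_sets_containing_le (hb.2 e he) he
        have h2 : (setProb T 1 : ℝ) ≤ 2 / 2 ^ (T ^ 2) := by
          have := (Rat.cast_le (K := ℝ)).2 (setProb_le T 1)
          push_cast at this
          rwa [pow_one] at this
        calc _ ≤ (2 : ℝ) ^ (T ^ 2) * (2 / 2 ^ (T ^ 2)) :=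
              mul_le_mul h1 h2 (by exact_mod_cast setProb_nonneg T 1) (by positivity)
          _ = 2 := by field_simp
    _ = avg (coinBias a T) A
          (fun _ => 2 * ind (e ∈ free I (stateBefore I a T ω r))) ω := by rw [avg_const]
    _ ≤ _ := avg_mono_fiber hp fun ω' hag => by rw [heq ω' hag]

/-- An element stops being free at most once in a stage, so the sum telescopes. -/
theorem sum_ind_covered_le (hT : 0 < T) (ω : Samples) (r e n : ℕ) :
    ∑ κ ∈ Finset.range n, ind (e ∈ preFree I a T ω r κ ∧
        e ∉ iterFree I a T ω r (κ / T) (κ % T + 1)) ≤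
      ind (e ∈ free I (stateBefore I a T ω r)) - ind (e ∈ preFree I a T ω r n) := by
  induction n with
  | zero =>
    rw [Finset.sum_range_zero, sub_nonneg]
    refine ind_mono fun h => ?_
    rw [preFree, Nat.zero_div, Nat.zero_mod] at h
    exact iterFree_subset_phaseFree r 0 0 h
  | succ n ih =>
    rw [Finset.sum_range_succ]
    have h : ind (e ∈ preFree I a T ω r n ∧ e ∉ iterFree I a T ω r (n / T) (n % T + 1)) +
        ind (e ∈ preFree I a T ω r (n + 1)) ≤ ind (e ∈ preFree I a T ω r n) := by
      by_cases h1 : e ∈ preFree I a T ω r (n + 1)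
      · have h2 := preFree_succ_subset hT ω r n h1
        have h3 : e ∈ preFree I a T ω r n := iterFree_anti (Nat.le_succ _) h2
        rw [ind_of h1, ind_of_not (fun h => h.2 h2), ind_of h3, zero_add]
      · rw [ind_of_not h1, add_zero]
        exact ind_mono fun h => h.1
    linarith

/-- The 4 is 2 for the first iteration plus 2 times the telescoping sum for the later ones. -/
theorem sum_expect_multiplicity_le (hT : 0 < T) (hb : I.Bounded (2 ^ a) (2 ^ (T ^ 2)))
    {r e : ℕ} (hr : r < a) (he : e ∈ I.elts) {τ : ℝ}
    (hτ : ∀ j < T, prob I a T (fun ω => ¬NoBadNeighbor I a T e r j ω) ≤ τ) :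
    ∑ κ ∈ Finset.range (T ^ 2), expect I a T (fun ω => ind (e ∈ preFree I a T ω r κ) *
        (multiplicity I a T ω r (κ / T) (κ % T) e : ℝ)) ≤
      4 * prob I a T (fun ω => e ∈ free I (stateBefore I a T ω r)) +
        T ^ 2 * ((2 ^ (T ^ 2) + 2) * τ) := by
  obtain ⟨n, hn⟩ : ∃ n, T ^ 2 = n + 1 :=
    ⟨T ^ 2 - 1, by have : 0 < T ^ 2 := by positivity
                   omega⟩
  have hτ0 : 0 ≤ τ := (prob_nonneg _).trans (hτ 0 hT)
  have h1 : ∑ κ ∈ Finset.range n, expect I a T (fun ω =>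
      ind (e ∈ preFree I a T ω r (κ + 1)) *
        (multiplicity I a T ω r ((κ + 1) / T) ((κ + 1) % T) e : ℝ)) ≤
      ∑ κ ∈ Finset.range n, (2 * prob I a T (fun ω => e ∈ preFree I a T ω r κ ∧
        e ∉ iterFree I a T ω r (κ / T) (κ % T + 1)) + (2 ^ (T ^ 2) + 2) * τ) := by
    refine Finset.sum_le_sum fun κ hκ => ?_
    rw [Finset.mem_range] at hκ
    refine (expect_multiplicity_succ_le hT hb hr (by omega) he).trans ?_
    refine add_le_add_right (mul_le_mul_of_nonneg_left (hτ _ ?_) (by positivity)) _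
    rw [Nat.div_lt_iff_lt_mul hT, ← sq]
    omega
  have h2 : ∑ κ ∈ Finset.range n, prob I a T (fun ω => e ∈ preFree I a T ω r κ ∧
        e ∉ iterFree I a T ω r (κ / T) (κ % T + 1)) ≤
      prob I a T (fun ω => e ∈ free I (stateBefore I a T ω r)) := by
    simp only [prob]
    rw [← expect_sum]
    refine expect_mono fun ω => (sum_ind_covered_le hT ω r e n).trans ?_
    linarith [ind_nonneg (e ∈ preFree I a T ω r n)]
  rw [Finset.sum_add_distrib, ← Finset.mul_sum, Finset.sum_const, Finset.card_range,
    nsmul_eq_mul] at h1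
  have h3 := expect_multiplicity_zero_le hT hb hr he
  have h4 : (n : ℝ) ≤ (T : ℝ) ^ 2 := by
    have : n ≤ T ^ 2 := by omega
    exact_mod_cast this
  have h5 := mul_le_mul_of_nonneg_right h4
    (by positivity : 0 ≤ ((2 : ℝ) ^ (T ^ 2) + 2) * τ)
  have hsplit : ∑ κ ∈ Finset.range (T ^ 2), expect I a T (fun ω =>
      ind (e ∈ preFree I a T ω r κ) * (multiplicity I a T ω r (κ / T) (κ % T) e : ℝ)) =
      ∑ κ ∈ Finset.range n, expect I a T (fun ω => ind (e ∈ preFree I a T ω r (κ + 1)) *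
        (multiplicity I a T ω r ((κ + 1) / T) ((κ + 1) % T) e : ℝ)) +
      expect I a T (fun ω => ind (e ∈ preFree I a T ω r 0) *
        (multiplicity I a T ω r (0 / T) (0 % T) e : ℝ)) := by
    rw [hn, Finset.sum_range_succ']
  rw [hsplit]
  linarith

end Multiplicity


/-! ### The expected size of the cover -/

section Size

variable {I : SetSystem} {a T : ℕ}

theorem card_iterState_cover_le (ω : Samples) (r j ℓ : ℕ) :
    (iterState I a T ω r j ℓ).cover.card ≤ (phaseState I a T ω r j).cover.card +
      (badSets I a T ω (r + 1) (phaseFree I a T ω r j)).card +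
      ∑ l ∈ Finset.range ℓ, (addedSets I a T ω r j l).card := by
  induction ℓ with
  | zero => rw [Finset.sum_range_zero, add_zero]; exact Finset.card_union_le _ _
  | succ ℓ ih =>
    rw [iterState_succ, Finset.sum_range_succ, ← add_assoc]
    exact (Finset.card_union_le _ _).trans (Nat.add_le_add_right ih _)

theorem card_phaseState_cover_le (ω : Samples) (r j : ℕ) :
    (phaseState I a T ω r j).cover.card ≤ (stateBefore I a T ω r).cover.card +
      ∑ m ∈ Finset.range j, ((badSets I a T ω (r + 1) (phaseFree I a T ω r m)).card +
        ∑ l ∈ Finset.range T, (addedSets I a T ω r m l).card) := by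
  induction j with
  | zero => simp [phaseState_zero]
  | succ j ih =>
    rw [phaseState_succ, Finset.sum_range_succ]
    have := card_iterState_cover_le (I := I) (a := a) (T := T) ω r j T
    omega

theorem card_stateBefore_cover_le (ω : Samples) (n : ℕ) :
    (stateBefore I a T ω n).cover.card ≤ ∑ r ∈ Finset.range n, ∑ j ∈ Finset.range T,
      ((badSets I a T ω (r + 1) (phaseFree I a T ω r j)).card +
        ∑ l ∈ Finset.range T, (addedSets I a T ω r j l).card) := by
  induction n with
  | zero => simp [stateBefore]
  | succ n ih =>
    rw [stateBefore_succ, Finset.sum_range_succ]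
    have := card_phaseState_cover_le (I := I) (a := a) (T := T) ω n T
    omega

theorem sum_range_div_mod {T : ℕ} (hT : 0 < T) (f : ℕ → ℕ → ℕ) (n : ℕ) :
    ∑ κ ∈ Finset.range (n * T), f (κ / T) (κ % T) =
      ∑ j ∈ Finset.range n, ∑ l ∈ Finset.range T, f j l := by
  induction n with
  | zero => simp
  | succ n ih =>
    rw [Finset.sum_range_succ, ← ih, Nat.succ_mul, Finset.sum_range_add]
    congr 1
    refine Finset.sum_congr rfl fun l hl => ?_
    rw [Finset.mem_range] at hl
    rw [Nat.mul_comm n T, Nat.mul_add_div hT, Nat.mul_add_mod, Nat.div_eq_of_lt hl,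
      Nat.mod_eq_of_lt hl, add_zero]

/-- Choosing an uncovered element responsible for each set is injective, because an element
determines the set of smallest ID that contains it. -/
theorem card_cleanUp_le (C : Finset ℕ) : (cleanUp I C).card ≤ (I.uncovered C).card := by
  have h : ∀ S ∈ cleanUp I C, ∃ e ∈ I.uncovered C, e ∈ I.elemsOf S ∧
      ∀ S' ∈ I.sets, e ∈ I.elemsOf S' → S ≤ S' := fun S hS => (Finset.mem_filter.1 hS).2
  choose! f hf using h
  refine Finset.card_le_card_of_injOn f (fun S hS => (hf S hS).1) fun S hS S' hS' heq => ?_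
  have h1 := hf S hS
  have h2 := hf S' hS'
  refine le_antisymm (h1.2.2 S' (Finset.mem_filter.1 hS').1 ?_)
    (h2.2.2 S (Finset.mem_filter.1 hS).1 ?_)
  · rw [heq]; exact h2.2.1
  · rw [← heq]; exact h1.2.1

theorem mem_stateBefore_pretend {ω : Samples} {n e : ℕ} (h : e ∈ (stateBefore I a T ω n).pretend) :
    ∃ x ∈ Finset.range n ×ˢ Finset.range T,
      e ∈ badElts I a T ω (x.1 + 1) x.2 (phaseFree I a T ω x.1 x.2) := by
  have hphase : ∀ r j, e ∈ (phaseState I a T ω r j).pretend →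
      e ∈ (stateBefore I a T ω r).pretend ∨ ∃ m < j,
        e ∈ badElts I a T ω (r + 1) m (phaseFree I a T ω r m) := by
    intro r j
    induction j with
    | zero => exact Or.inl
    | succ j ih =>
      intro h
      rw [phaseState_succ, iterState_pretend, Finset.mem_union] at h
      rcases h with h | h
      · rcases ih h with h | ⟨m, hm, h⟩
        · exact Or.inl h
        · exact Or.inr ⟨m, by omega, h⟩
      · exact Or.inr ⟨j, by omega, h⟩
  induction n with
  | zero => simp [stateBefore] at h
  | succ n ih =>
    rw [stateBefore_succ] at h
    rcases hphase n T h with h | ⟨m, hm, h⟩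
    · obtain ⟨x, hx, h⟩ := ih h
      refine ⟨x, ?_, h⟩
      simp only [Finset.mem_product, Finset.mem_range] at hx ⊢
      omega
    · exact ⟨(n, m), by simp [hm], h⟩

/-- The last stage works with exact counts and threshold 1, so every element of a sampled set that
is still free is noticed. -/
theorem elemProb_last (ha : 0 < a) (hT : 0 < T) : elemProb a T a = 1 := by
  have h : (1 : ℚ) ≤ logFive a T := by exact_mod_cast logFive_pos ha hT
  unfold elemProb
  rw [mul_div_assoc, div_self (by positivity), mul_one]
  exact min_eq_left h

/-- At the end of the last stage, almost surely no element is free. -/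
theorem prob_uncovered_le (ha : 0 < a) (hT : 0 < T) (hb : I.Bounded (2 ^ a) (2 ^ (T ^ 2)))
    {e : ℕ} (he : e ∈ I.elts) :
    prob I a T (fun ω => e ∈ I.uncovered (mainLoop I a T ω).cover) ≤
      a * T * (10 * T * Real.exp (-(logFive a T / 8)) *
        ((2 : ℝ) ^ a * 2 ^ (T ^ 2) + 1) ^ T) := by
  calc _ ≤ prob I a T (fun ω => ∃ x ∈ Finset.range a ×ˢ Finset.range T,
        e ∈ badElts I a T ω (x.1 + 1) x.2 (phaseFree I a T ω x.1 x.2)) := by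
        refine prob_le_of_typical fun ω hω h => ?_
        rw [mainLoop_eq] at h
        apply mem_stateBefore_pretend
        by_contra hpre
        have hfree : e ∈ free I (stateBefore I a T ω a) := Finset.mem_sdiff.2 ⟨h, hpre⟩
        obtain ⟨S, hS, heS⟩ := I.coverable e he
        obtain ⟨n, rfl⟩ : ∃ n, a = n + 1 := ⟨a - 1, by omega⟩
        rw [stateBefore_succ] at hfree
        -- Almost surely the estimate is the exact count and is below 1, whereas `S` contains the
        -- free element `e`. So an uncovered element must be pretending.
        have h1 := estimate_lt_of_sampled (a := n + 1) hT hS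
          (sampled_of_typical (Nat.lt_succ_self n) hT hS hω)
        rw [estimate_of_typical (Nat.lt_succ_self n) hS (elemProb_last ha hT) hω,
          div_self (by positivity)] at h1
        have h2 : 0 < (part I S (phaseFree I (n + 1) T ω n T)).card :=
          Finset.card_pos.2 ⟨e, Finset.mem_inter.2 ⟨List.mem_toFinset.2 heS, hfree⟩⟩
        have h3 : (part I S (phaseFree I (n + 1) T ω n T)).card < 1 := by exact_mod_cast h1
        omega
    _ ≤ ∑ x ∈ Finset.range a ×ˢ Finset.range T, pretendProb I a T x.1 x.2 e :=
        prob_exists_le _ _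
    _ ≤ ∑ x ∈ Finset.range a ×ˢ Finset.range T, (10 * T * Real.exp (-(logFive a T / 8)) *
        ((2 : ℝ) ^ a * 2 ^ (T ^ 2) + 1) ^ T) := by
        refine Finset.sum_le_sum fun x hx => ?_
        simp only [Finset.mem_product, Finset.mem_range] at hx
        refine (pretendProb_le ha hT hb hx.1 x.2 hx.2 e he).trans ?_
        refine mul_le_mul_of_nonneg_left (pow_le_pow_right₀ ?_ hx.2.le) (by positivity)
        linarith [(by positivity : (0 : ℝ) ≤ (2 : ℝ) ^ a * 2 ^ (T ^ 2))]
    _ = _ := by simp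

theorem prob_not_noBadNeighbor_le_uniform (ha : 0 < a) (hT : 0 < T)
    (hb : I.Bounded (2 ^ a) (2 ^ (T ^ 2))) {r e : ℕ} (hr : r < a) (he : e ∈ I.elts) :
    ∀ j < T, prob I a T (fun ω => ¬NoBadNeighbor I a T e r j ω) ≤
      (2 : ℝ) ^ a * 2 ^ (T ^ 2) * (10 * T * Real.exp (-(logFive a T / 8)) *
        ((2 : ℝ) ^ a * 2 ^ (T ^ 2) + 1) ^ T) := by
  intro j hj
  refine prob_not_noBadNeighbor_le.trans ?_
  calc _ ≤ ∑ f ∈ elemNeighbors I e, (10 * T * Real.exp (-(logFive a T / 8)) *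
        ((2 : ℝ) ^ a * 2 ^ (T ^ 2) + 1) ^ T) := by
        refine Finset.sum_le_sum fun f hf => ?_
        refine (pretendProb_le ha hT hb hr j hj f (elemNeighbors_subset he hf)).trans ?_
        refine mul_le_mul_of_nonneg_left (pow_le_pow_right₀ ?_ hj.le) (by positivity)
        linarith [(by positivity : (0 : ℝ) ≤ (2 : ℝ) ^ a * 2 ^ (T ^ 2))]
    _ ≤ _ := by
        rw [Finset.sum_const, nsmul_eq_mul]
        refine mul_le_mul_of_nonneg_right ?_ (by positivity)
        exact_mod_cast card_elemNeighbors_le hb he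

theorem card_part_eq_sum {S : ℕ} {E : Finset ℕ} (hE : E ⊆ I.elts) :
    ((part I S E).card : ℝ) = ∑ e ∈ I.elts, ind (e ∈ I.elemsOf S) * ind (e ∈ E) := by
  have h1 : part I S E = I.elts.filter fun e => e ∈ I.elemsOf S ∧ e ∈ E := by
    ext e
    simp only [Finset.mem_inter, List.mem_toFinset, Finset.mem_filter]
    exact ⟨fun h => ⟨hE h.2, h⟩, fun h => h.2⟩
  rw [h1, card_filter_eq_sum_ind]
  refine Finset.sum_congr rfl fun e _ => ?_
  by_cases h2 : e ∈ I.elemsOf S <;> by_cases h3 : e ∈ E <;> simp [ind, h2, h3]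

/-- Weak duality. -/
theorem sum_le_sum_fractional {x : ℕ → ℝ} (hx : I.IsFractionalCover x) {w : ℕ → ℝ}
    (hw : ∀ e ∈ I.elts, 0 ≤ w e) :
    ∑ e ∈ I.elts, w e ≤ ∑ S ∈ I.sets, x S * ∑ e ∈ I.elts, ind (e ∈ I.elemsOf S) * w e := by
  calc _ ≤ ∑ e ∈ I.elts, (∑ S ∈ I.sets, ind (e ∈ I.elemsOf S) * x S) * w e := by
        refine Finset.sum_le_sum fun e he => le_mul_of_one_le_left (hw e he) ?_
        refine (hx.2 e he).trans (le_of_eq ?_)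
        rw [Finset.sum_filter]
        refine Finset.sum_congr rfl fun S _ => ?_
        by_cases h : e ∈ I.elemsOf S <;> simp [ind, h]
    _ = ∑ e ∈ I.elts, ∑ S ∈ I.sets, x S * (ind (e ∈ I.elemsOf S) * w e) :=
        Finset.sum_congr rfl fun e _ => by
          rw [Finset.sum_mul]
          exact Finset.sum_congr rfl fun S _ => by ring
    _ = _ := by
        rw [Finset.sum_comm]
        exact Finset.sum_congr rfl fun S _ => by rw [Finset.mul_sum]

/-- Weak duality with weight 1 on every element. It converts error terms proportional to the number
of elements into multiples of the fractional optimum. -/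
theorem card_elts_le_fractional {x : ℕ → ℝ} (hx : I.IsFractionalCover x) {s t : ℕ}
    (hb : I.Bounded s t) : (I.elts.card : ℝ) ≤ s * ∑ S ∈ I.sets, x S := by
  have h := sum_le_sum_fractional hx (w := fun _ => 1) fun _ _ => zero_le_one
  rw [Finset.sum_const, nsmul_eq_mul, mul_one] at h
  refine h.trans ?_
  rw [Finset.mul_sum]
  refine Finset.sum_le_sum fun S hS => ?_
  rw [mul_comm]
  refine mul_le_mul_of_nonneg_right ?_ (hx.1 S hS)
  simp only [mul_one]
  rw [← card_filter_eq_sum_ind]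
  have : (I.elts.filter fun e => e ∈ I.elemsOf S).card ≤ s := by
    refine le_trans (Finset.card_le_card (t := (I.elemsOf S).toFinset) fun e he => ?_)
      ((List.toFinset_card_le _).trans (hb.1 S hS))
    exact List.mem_toFinset.2 (Finset.mem_filter.1 he).2
  exact_mod_cast this

theorem sum_card_elemsOf_le {s t : ℕ} (hb : I.Bounded s t) :
    ∑ S ∈ I.sets, ((I.elemsOf S).toFinset.card : ℝ) ≤ I.elts.card * t := by
  calc _ = ∑ S ∈ I.sets, ∑ e ∈ I.elts, ind (e ∈ I.elemsOf S) := by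
        refine Finset.sum_congr rfl fun S hS => ?_
        rw [← card_filter_eq_sum_ind]
        congr 2
        ext e
        simp only [List.mem_toFinset, Finset.mem_filter]
        exact ⟨fun h => ⟨I.elemsOf_subset S hS e h, h⟩, fun h => h.2⟩
    _ = ∑ e ∈ I.elts, ∑ S ∈ I.sets, ind (e ∈ I.elemsOf S) := Finset.sum_comm
    _ ≤ ∑ e ∈ I.elts, (t : ℝ) := by
        refine Finset.sum_le_sum fun e he => ?_
        rw [← card_filter_eq_sum_ind]
        exact_mod_cast card_sets_containing_le (hb.2 e he) he
    _ = _ := by rw [Finset.sum_const, nsmul_eq_mul]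

/-- Sums over all sets of the probabilities of events that do not happen to the empty set. -/
theorem sum_prob_le {s t : ℕ} (hb : I.Bounded s t) {P : ℕ → Samples → Prop} {δ : ℝ}
    (hP : ∀ S ∈ I.sets, ∀ ω, P S ω → I.elemsOf S ≠ []) (hδ : 0 ≤ δ)
    (h : ∀ S ∈ I.sets, prob I a T (P S) ≤ δ) :
    ∑ S ∈ I.sets, prob I a T (P S) ≤ I.elts.card * t * δ := by
  calc _ ≤ ∑ S ∈ I.sets, ((I.elemsOf S).toFinset.card : ℝ) * δ := by
        refine Finset.sum_le_sum fun S hS => ?_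
        -- The number of nonempty sets is bounded by the number of incidences; empty sets are not,
        -- and must have probability zero.
        by_cases hne : I.elemsOf S = []
        · rw [hne, List.toFinset_nil, Finset.card_empty, Nat.cast_zero, zero_mul]
          exact prob_eq_zero_of_typical fun ω _ hω => hP S hS ω hω hne
        · refine (h S hS).trans (le_mul_of_one_le_left hδ ?_)
          have : 0 < (I.elemsOf S).toFinset.card :=
            Finset.card_pos.2 ((List.toFinset_nonempty_iff _).2 hne)
          exact_mod_cast this
    _ = (∑ S ∈ I.sets, ((I.elemsOf S).toFinset.card : ℝ)) * δ := by rw [Finset.sum_mul]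
    _ ≤ _ := mul_le_mul_of_nonneg_right (sum_card_elemsOf_le hb) hδ

/-- The added sets with many free elements are charged to these elements. -/
theorem card_addedSets_le (ω : Samples) (r j ℓ : ℕ) :
    ((addedSets I a T ω r j ℓ).card : ℝ) ≤
      ∑ S ∈ I.sets, ind (S ∈ addedSets I a T ω r j ℓ ∧
        2 * ((part I S (iterFree I a T ω r j ℓ)).card : ℚ) < 2 ^ a / 2 ^ (r + 1)) +
      2 * (2 ^ (r + 1) / 2 ^ a) * ∑ e ∈ I.elts, ind (e ∈ iterFree I a T ω r j ℓ) *
        (multiplicity I a T ω r j ℓ e : ℝ) := by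
  have h1 : ((addedSets I a T ω r j ℓ).card : ℝ) =
      ∑ S ∈ I.sets, ind (S ∈ addedSets I a T ω r j ℓ) := by
    rw [← card_filter_eq_sum_ind]
    congr 2
    ext S
    simp only [Finset.mem_filter]
    exact ⟨fun h => ⟨addedSets_subset r j ℓ h, h⟩, fun h => h.2⟩
  have h2 : ∑ e ∈ I.elts, ind (e ∈ iterFree I a T ω r j ℓ) *
      (multiplicity I a T ω r j ℓ e : ℝ) = ∑ S ∈ I.sets, ind (S ∈ addedSets I a T ω r j ℓ) *
        ((part I S (iterFree I a T ω r j ℓ)).card : ℝ) := by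
    calc _ = ∑ e ∈ I.elts, ∑ S ∈ I.sets, ind (S ∈ addedSets I a T ω r j ℓ) *
          (ind (e ∈ I.elemsOf S) * ind (e ∈ iterFree I a T ω r j ℓ)) := by
          refine Finset.sum_congr rfl fun e _ => ?_
          have h3 : (addedSets I a T ω r j ℓ).filter (fun S => e ∈ I.elemsOf S) =
              I.sets.filter fun S => S ∈ addedSets I a T ω r j ℓ ∧ e ∈ I.elemsOf S := by
            ext S
            simp only [Finset.mem_filter]
            exact ⟨fun h => ⟨addedSets_subset r j ℓ h.1, h⟩, fun h => h.2⟩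
          rw [multiplicity, h3, card_filter_eq_sum_ind, Finset.mul_sum]
          refine Finset.sum_congr rfl fun S _ => ?_
          by_cases h4 : S ∈ addedSets I a T ω r j ℓ <;> by_cases h5 : e ∈ I.elemsOf S <;>
            simp [ind, h4, h5]
      _ = _ := by
          rw [Finset.sum_comm]
          refine Finset.sum_congr rfl fun S _ => ?_
          rw [← Finset.mul_sum, card_part_eq_sum free_subset_elts]
  rw [h1, h2, Finset.mul_sum, ← Finset.sum_add_distrib]
  refine Finset.sum_le_sum fun S _ => ?_
  have hc : (0 : ℝ) ≤ 2 * (2 ^ (r + 1) / 2 ^ a) := by positivity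
  by_cases h4 : S ∈ addedSets I a T ω r j ℓ
  swap
  · rw [ind_of_not h4]
    linarith [ind_nonneg (S ∈ addedSets I a T ω r j ℓ ∧
      2 * ((part I S (iterFree I a T ω r j ℓ)).card : ℚ) < 2 ^ a / 2 ^ (r + 1))]
  by_cases h5 : 2 * ((part I S (iterFree I a T ω r j ℓ)).card : ℚ) < 2 ^ a / 2 ^ (r + 1)
  · rw [ind_of h4, ind_of (⟨h4, h5⟩ : _ ∧ _), one_mul]
    have := mul_nonneg hc (Nat.cast_nonneg (part I S (iterFree I a T ω r j ℓ)).card)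
    linarith
  · rw [ind_of h4, ind_of_not fun h => h5 h.2, zero_add, one_mul]
    have h6 : (2 ^ a / 2 ^ (r + 1) : ℝ) ≤ 2 * ((part I S (iterFree I a T ω r j ℓ)).card : ℝ) := by
      have := (Rat.cast_le (K := ℝ)).2 (not_lt.1 h5)
      push_cast at this
      exact this
    calc (1 : ℝ) = 2 ^ (r + 1) / 2 ^ a * (2 ^ a / 2 ^ (r + 1)) := by field_simp
      _ ≤ 2 ^ (r + 1) / 2 ^ a * (2 * ((part I S (iterFree I a T ω r j ℓ)).card : ℝ)) :=
          mul_le_mul_of_nonneg_left h6 (by positivity)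
      _ = _ := by ring

/-- The bound does not depend on the phase: a set that is bad in some phase meets the same condition
with the larger free set of the stage start. -/
theorem card_badSets_le (ω : Samples) (r j : ℕ) :
    ((badSets I a T ω (r + 1) (phaseFree I a T ω r j)).card : ℝ) ≤
      ∑ S ∈ I.sets, ind (logTen a T ≤
        (sampleB I ω (r + 1) S ∩ free I (stateBefore I a T ω r)).card) := by
  have h0 : phaseFree I a T ω r j ⊆ free I (stateBefore I a T ω r) := by
    rw [← phaseState_zero]
    exact phaseFree_anti (Nat.zero_le j)
  rw [badSets, card_filter_eq_sum_ind]
  refine Finset.sum_le_sum fun S _ => ind_mono fun h => le_trans h ?_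
  exact Finset.card_le_card (Finset.inter_subset_inter_left h0)

/-- The size of the cover, split into the contributions of the steps. -/
theorem card_phasedCover_le (hT : 0 < T) (ω : Samples) :
    ((phasedCover I a T ω).card : ℝ) ≤
      (∑ r ∈ Finset.range a, (T * (∑ S ∈ I.sets, ind (logTen a T ≤
          (sampleB I ω (r + 1) S ∩ free I (stateBefore I a T ω r)).card)) +
        ∑ κ ∈ Finset.range (T ^ 2), (∑ S ∈ I.sets, ind (S ∈ addedSets I a T ω r (κ / T) (κ % T) ∧
          2 * ((part I S (iterFree I a T ω r (κ / T) (κ % T))).card : ℚ) < 2 ^ a / 2 ^ (r + 1)) +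
          2 * (2 ^ (r + 1) / 2 ^ a) * ∑ e ∈ I.elts, ind (e ∈ preFree I a T ω r κ) *
            (multiplicity I a T ω r (κ / T) (κ % T) e : ℝ)))) +
      ∑ e ∈ I.elts, ind (e ∈ I.uncovered (mainLoop I a T ω).cover) := by
  have h1 : (phasedCover I a T ω).card ≤ (stateBefore I a T ω a).cover.card +
      (I.uncovered (mainLoop I a T ω).cover).card := by
    refine (Finset.card_union_le _ _).trans ?_
    rw [mainLoop_eq]
    exact Nat.add_le_add_left (card_cleanUp_le _) _
  have h2 : ((I.uncovered (mainLoop I a T ω).cover).card : ℝ) =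
      ∑ e ∈ I.elts, ind (e ∈ I.uncovered (mainLoop I a T ω).cover) := by
    rw [← card_filter_eq_sum_ind]
    congr 2
    ext e
    simp only [Finset.mem_filter]
    exact ⟨fun h => ⟨(Finset.mem_filter.1 h).1, h⟩, fun h => h.2⟩
  have h3 : ((phasedCover I a T ω).card : ℝ) ≤ ((stateBefore I a T ω a).cover.card : ℝ) +
      ((I.uncovered (mainLoop I a T ω).cover).card : ℝ) := by exact_mod_cast h1
  rw [← h2]
  refine h3.trans (add_le_add_left ?_ _)
  have h4 : ((stateBefore I a T ω a).cover.card : ℝ) ≤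
      ((∑ r ∈ Finset.range a, ∑ j ∈ Finset.range T,
        ((badSets I a T ω (r + 1) (phaseFree I a T ω r j)).card +
        ∑ l ∈ Finset.range T, (addedSets I a T ω r j l).card) : ℕ) : ℝ) := by
    exact_mod_cast card_stateBefore_cover_le ω a
  refine h4.trans ?_
  rw [Nat.cast_sum]
  refine Finset.sum_le_sum fun r _ => ?_
  rw [Finset.sum_add_distrib, Nat.cast_add, ← sum_range_div_mod hT, ← sq, Nat.cast_sum,
    Nat.cast_sum]
  refine add_le_add ?_ (Finset.sum_le_sum fun κ _ => card_addedSets_le ω r _ _)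
  calc _ ≤ ∑ j ∈ Finset.range T, ∑ S ∈ I.sets, ind (logTen a T ≤
          (sampleB I ω (r + 1) S ∩ free I (stateBefore I a T ω r)).card) :=
        Finset.sum_le_sum fun j _ => card_badSets_le ω r j
    _ = _ := by rw [Finset.sum_const, Finset.card_range, nsmul_eq_mul]

/-- The expected number of free elements of a set at the beginning of a stage. -/
theorem expect_card_part_le (ha : 0 < a) (hT : 0 < T)
    {r S : ℕ} (hlen : (I.elemsOf S).length ≤ 2 ^ a) (hr : r < a) (hS : S ∈ I.sets) :
    ∑ e ∈ I.elts, ind (e ∈ I.elemsOf S) *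
        prob I a T (fun ω => e ∈ free I (stateBefore I a T ω r)) ≤
      4 * (2 ^ a / 2 ^ (r + 1)) + 2 ^ a * ((T + 1) * Real.exp (-(logFive a T / 8))) := by
  have h1 : ∑ e ∈ I.elts, ind (e ∈ I.elemsOf S) *
      prob I a T (fun ω => e ∈ free I (stateBefore I a T ω r)) =
      expect I a T (fun ω => ((part I S (free I (stateBefore I a T ω r))).card : ℝ)) := by
    simp only [prob, ← expect_mul_left]
    rw [← expect_sum]
    congr 1
    funext ω
    rw [card_part_eq_sum free_subset_elts]
  rw [h1]
  calc _ ≤ expect I a T (fun ω => 4 * (2 ^ a / 2 ^ (r + 1)) + 2 ^ a *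
        ind (4 * (2 ^ a / 2 ^ (r + 1) : ℚ) <
          (part I S (free I (stateBefore I a T ω r))).card)) := by
        refine expect_mono fun ω => ?_
        by_cases h : 4 * (2 ^ a / 2 ^ (r + 1) : ℚ) <
          (part I S (free I (stateBefore I a T ω r))).card
        · rw [ind_of h]
          have h2 : (part I S (free I (stateBefore I a T ω r))).card ≤ 2 ^ a :=
            (Finset.card_le_card Finset.inter_subset_left).trans
              ((List.toFinset_card_le _).trans hlen)
          have h3 : ((part I S (free I (stateBefore I a T ω r))).card : ℝ) ≤ 2 ^ a := by
            exact_mod_cast h2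
          have h4 : (0 : ℝ) ≤ 4 * (2 ^ a / 2 ^ (r + 1)) := by positivity
          linarith
        · rw [ind_of_not h, mul_zero, add_zero]
          have := (Rat.cast_le (K := ℝ)).2 (not_lt.1 h)
          push_cast at this
          exact this
    _ ≤ _ := by
        rw [expect_add, expect_const, expect_mul_left]
        refine add_le_add_right (mul_le_mul_of_nonneg_left ?_ (by positivity)) _
        exact prob_large_part_stateBefore_le ha hT hlen hr hS

/-- Weak duality with the weight of `e` equal to its probability of being free. The constraint for
`S` is the expected size of its free part. -/
theorem sum_prob_free_le (ha : 0 < a) (hT : 0 < T) (hb : I.Bounded (2 ^ a) (2 ^ (T ^ 2)))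
    {x : ℕ → ℝ} (hx : I.IsFractionalCover x) {r : ℕ} (hr : r < a) :
    ∑ e ∈ I.elts, prob I a T (fun ω => e ∈ free I (stateBefore I a T ω r)) ≤
      (4 * (2 ^ a / 2 ^ (r + 1)) + 2 ^ a * ((T + 1) * Real.exp (-(logFive a T / 8)))) *
        ∑ S ∈ I.sets, x S := by
  refine (sum_le_sum_fractional hx fun _ _ => prob_nonneg _).trans ?_
  rw [Finset.mul_sum]
  refine Finset.sum_le_sum fun S hS => ?_
  rw [mul_comm]
  exact mul_le_mul_of_nonneg_right (expect_card_part_le ha hT (hb.1 S hS) hr hS) (hx.1 S hS)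

end Size


/-! ### Summing up the expected cost over the stages. -/

section ExpectedSize

variable {I : SetSystem} {a T : ℕ}

theorem elemsOf_ne_nil_of_bad (ha : 0 < a) (hT : 0 < T) {ω : Samples} {i S : ℕ} {E : Finset ℕ}
    (h : logTen a T ≤ (sampleB I ω i S ∩ E).card) : I.elemsOf S ≠ [] := by
  intro hnil
  have h1 : 0 < logTen a T := by unfold logTen; positivity
  have h2 : sampleB I ω i S = ∅ := by simp [sampleB, hnil]
  rw [h2, Finset.empty_inter, Finset.card_empty] at h
  omega

theorem elemsOf_ne_nil_of_added {ω : Samples} {r j ℓ S : ℕ} (h : S ∈ addedSets I a T ω r j ℓ) :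
    I.elemsOf S ≠ [] := by
  intro hnil
  have h1 := (mem_addedSets.1 h).2
  have h2 : sampleB I ω (r + 1) S = ∅ := by simp [sampleB, hnil]
  rw [estimate, h2, Finset.empty_inter, Finset.card_empty, Nat.cast_zero, zero_div] at h1
  have : (0 : ℚ) < 2 ^ a / 2 ^ (r + 1) := by positivity
  linarith

/-- The expected number of sets added in a stage. -/
theorem expect_stage_le (ha : 0 < a) (hT : 0 < T) (hb : I.Bounded (2 ^ a) (2 ^ (T ^ 2)))
    {x : ℕ → ℝ} (hx : I.IsFractionalCover x) {r : ℕ} (hr : r < a) {δ τ : ℝ}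
    (hδ : δ = Real.exp (-(logFive a T / 8)))
    (hτ : τ = (2 : ℝ) ^ a * 2 ^ (T ^ 2) * (10 * T * δ * ((2 : ℝ) ^ a * 2 ^ (T ^ 2) + 1) ^ T)) :
    expect I a T (fun ω => T * (∑ S ∈ I.sets, ind (logTen a T ≤
          (sampleB I ω (r + 1) S ∩ free I (stateBefore I a T ω r)).card)) +
        ∑ κ ∈ Finset.range (T ^ 2), (∑ S ∈ I.sets, ind (S ∈ addedSets I a T ω r (κ / T) (κ % T) ∧
          2 * ((part I S (iterFree I a T ω r (κ / T) (κ % T))).card : ℚ) < 2 ^ a / 2 ^ (r + 1)) +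
          2 * (2 ^ (r + 1) / 2 ^ a) * ∑ e ∈ I.elts, ind (e ∈ preFree I a T ω r κ) *
            (multiplicity I a T ω r (κ / T) (κ % T) e : ℝ))) ≤
      (32 + (2 ^ a * 2 ^ (T ^ 2) * (T * ((Real.exp 7 + (T + 1)) * δ) + T ^ 2 * δ) +
        8 * (2 ^ a * ((T + 1) * δ)) + 2 * (2 ^ a * (T ^ 2 * ((2 ^ (T ^ 2) + 2) * τ))))) *
          ∑ S ∈ I.sets, x S := by
  set X := ∑ S ∈ I.sets, x S with hX
  have hX0 : 0 ≤ X := Finset.sum_nonneg hx.1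
  have hδ0 : 0 ≤ δ := by rw [hδ]; positivity
  have hτ0 : 0 ≤ τ := by rw [hτ]; positivity
  have hn : (I.elts.card : ℝ) ≤ 2 ^ a * X := by
    have := card_elts_le_fractional hx hb
    push_cast at this
    exact this
  have hnt : ∀ y : ℝ, 0 ≤ y → (I.elts.card : ℝ) * ((2 ^ (T ^ 2) : ℕ) : ℝ) * y ≤
      2 ^ a * 2 ^ (T ^ 2) * y * X := by
    intro y hy
    push_cast
    have := mul_le_mul_of_nonneg_right hn (by positivity : 0 ≤ (2 : ℝ) ^ (T ^ 2) * y)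
    linarith
  have h1 : ∑ S ∈ I.sets, prob I a T (fun ω => logTen a T ≤
      (sampleB I ω (r + 1) S ∩ free I (stateBefore I a T ω r)).card) ≤
      2 ^ a * 2 ^ (T ^ 2) * ((Real.exp 7 + (T + 1)) * δ) * X := by
    refine (sum_prob_le hb (fun S _ ω h => elemsOf_ne_nil_of_bad ha hT h) (by positivity)
      fun S hS => ?_).trans (hnt _ (by positivity))
    rw [hδ]
    exact prob_bad_le ha hT (hb.1 S hS) hr hS
  have h2 : ∀ κ, ∑ S ∈ I.sets, prob I a T (fun ω => S ∈ addedSets I a T ω r (κ / T) (κ % T) ∧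
      2 * ((part I S (iterFree I a T ω r (κ / T) (κ % T))).card : ℚ) < 2 ^ a / 2 ^ (r + 1)) ≤
      2 ^ a * 2 ^ (T ^ 2) * δ * X := by
    intro κ
    refine (sum_prob_le hb (fun S _ ω h => elemsOf_ne_nil_of_added h.1) hδ0
      fun S hS => ?_).trans (hnt _ hδ0)
    rw [hδ]
    exact prob_added_small_le ha hT hr hS _ _
  have h3 : ∑ κ ∈ Finset.range (T ^ 2), ∑ e ∈ I.elts, expect I a T (fun ω =>
      ind (e ∈ preFree I a T ω r κ) * (multiplicity I a T ω r (κ / T) (κ % T) e : ℝ)) ≤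
      4 * ((4 * (2 ^ a / 2 ^ (r + 1)) + 2 ^ a * ((T + 1) * δ)) * X) +
        2 ^ a * X * (T ^ 2 * ((2 ^ (T ^ 2) + 2) * τ)) := by
    rw [Finset.sum_comm]
    calc _ ≤ ∑ e ∈ I.elts, (4 * prob I a T (fun ω => e ∈ free I (stateBefore I a T ω r)) +
          T ^ 2 * ((2 ^ (T ^ 2) + 2) * τ)) := by
          refine Finset.sum_le_sum fun e he => sum_expect_multiplicity_le hT hb hr he ?_
          rw [hτ, hδ]
          exact prob_not_noBadNeighbor_le_uniform ha hT hb hr he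
      _ = 4 * ∑ e ∈ I.elts, prob I a T (fun ω => e ∈ free I (stateBefore I a T ω r)) +
          I.elts.card * (T ^ 2 * ((2 ^ (T ^ 2) + 2) * τ)) := by
          rw [Finset.sum_add_distrib, ← Finset.mul_sum, Finset.sum_const, nsmul_eq_mul]
      _ ≤ _ := by
          refine add_le_add (mul_le_mul_of_nonneg_left ?_ (by norm_num))
            (mul_le_mul_of_nonneg_right hn (by positivity))
          rw [hδ]
          exact sum_prob_free_le ha hT hb hx hr
  rw [expect_add, expect_mul_left, expect_sum, expect_sum]
  simp only [expect_add, expect_mul_left, expect_sum]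
  rw [Finset.sum_add_distrib, ← Finset.mul_sum]
  have h4 : ∑ κ ∈ Finset.range (T ^ 2), ∑ S ∈ I.sets, prob I a T (fun ω =>
      S ∈ addedSets I a T ω r (κ / T) (κ % T) ∧
      2 * ((part I S (iterFree I a T ω r (κ / T) (κ % T))).card : ℚ) < 2 ^ a / 2 ^ (r + 1)) ≤
      T ^ 2 * (2 ^ a * 2 ^ (T ^ 2) * δ * X) := by
    refine (Finset.sum_le_sum fun κ _ => h2 κ).trans (le_of_eq ?_)
    rw [Finset.sum_const, Finset.card_range, nsmul_eq_mul]
    push_cast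
    rfl
  have hc0 : (0 : ℝ) ≤ 2 * (2 ^ (r + 1) / 2 ^ a) := by positivity
  have hc2 : (2 : ℝ) * (2 ^ (r + 1) / 2 ^ a) ≤ 2 := by
    have : (2 : ℝ) ^ (r + 1) / 2 ^ a ≤ 1 := by
      rw [div_le_one (by positivity)]
      exact pow_le_pow_right₀ (by norm_num) hr
    linarith
  -- The threshold cancels in the main term: charge 2/θ, four charges per free element, free part
  -- 4θ, in total 2·4·4 = 32. In the error terms 1/θ is merely bounded by 1.
  have hc1 : (2 : ℝ) * (2 ^ (r + 1) / 2 ^ a) * (2 ^ a / 2 ^ (r + 1)) = 2 := by field_simp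
  have h5 := mul_le_mul_of_nonneg_left h3 hc0
  have h6 := mul_le_mul_of_nonneg_left h1 (by positivity : (0 : ℝ) ≤ T)
  have h7 : 2 * (2 ^ (r + 1) / 2 ^ a) * (4 * ((4 * (2 ^ a / 2 ^ (r + 1)) +
      2 ^ a * ((T + 1) * δ)) * X) + 2 ^ a * X * (T ^ 2 * ((2 ^ (T ^ 2) + 2) * τ))) ≤
      32 * X + 2 * (4 * (2 ^ a * ((T + 1) * δ) * X) +
        2 ^ a * X * (T ^ 2 * ((2 ^ (T ^ 2) + 2) * τ))) := by
    have h8 := mul_le_mul_of_nonneg_right hc2 (by positivity : 0 ≤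
      4 * ((2 : ℝ) ^ a * ((T + 1) * δ) * X) + 2 ^ a * X * (T ^ 2 * ((2 ^ (T ^ 2) + 2) * τ)))
    calc _ = 16 * (2 * (2 ^ (r + 1) / 2 ^ a) * (2 ^ a / 2 ^ (r + 1))) * X +
          2 * (2 ^ (r + 1) / 2 ^ a) * (4 * ((2 : ℝ) ^ a * ((T + 1) * δ) * X) +
          2 ^ a * X * (T ^ 2 * ((2 ^ (T ^ 2) + 2) * τ))) := by ring
      _ ≤ _ := by rw [hc1]; linarith
  calc _ ≤ T * (2 ^ a * 2 ^ (T ^ 2) * ((Real.exp 7 + (T + 1)) * δ) * X) +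
        (T ^ 2 * (2 ^ a * 2 ^ (T ^ 2) * δ * X) + (32 * X +
        2 * (4 * (2 ^ a * ((T + 1) * δ) * X) +
          2 ^ a * X * (T ^ 2 * ((2 ^ (T ^ 2) + 2) * τ))))) :=
        add_le_add h6 (add_le_add h4 (h5.trans h7))
    _ = _ := by ring

theorem exp_seven_le : Real.exp 7 ≤ 1100 := by
  have h : Real.exp 7 = Real.exp 1 ^ 7 := by rw [← Real.exp_nat_mul]; norm_num
  rw [h]
  calc Real.exp 1 ^ 7 ≤ 2.7182818286 ^ 7 :=
        pow_le_pow_left₀ (Real.exp_pos 1).le Real.exp_one_lt_d9.le 7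
    _ ≤ 1100 := by norm_num

theorem cast_le_two_pow (n : ℕ) : (n : ℝ) ≤ 2 ^ n := by
  exact_mod_cast Nat.lt_two_pow_self.le

/-- Every factor `a`, `T`, T², 2^a, 2^(T²) is at most M = st, so each error term is at most a
constant times (M+1)^(T+5)·δ. -/
theorem error_le (hT : 0 < T) {δ τ M : ℝ} (hδ : 0 ≤ δ)
    (hM : M = (2 : ℝ) ^ a * 2 ^ (T ^ 2)) (hτ : τ = M * (10 * T * δ * (M + 1) ^ T)) :
    a * (2 ^ a * 2 ^ (T ^ 2) * (T * ((Real.exp 7 + (T + 1)) * δ) + T ^ 2 * δ) +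
        8 * (2 ^ a * ((T + 1) * δ)) + 2 * (2 ^ a * (T ^ 2 * ((2 ^ (T ^ 2) + 2) * τ)))) +
      2 ^ a * (a * T * (10 * T * δ * (M + 1) ^ T)) ≤ 1200 * ((M + 1) ^ (T + 5) * δ) := by
  set W := M + 1 with hW
  have hM1 : 1 ≤ M := by
    rw [hM]; exact one_le_mul_of_one_le_of_one_le (one_le_pow₀ (by norm_num))
      (one_le_pow₀ (by norm_num))
  have hs : (2 : ℝ) ^ a ≤ M := by
    rw [hM]; exact le_mul_of_one_le_right (by positivity) (one_le_pow₀ (by norm_num))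
  have ht : (2 : ℝ) ^ (T ^ 2) ≤ M := by
    rw [hM]; exact le_mul_of_one_le_left (by positivity) (one_le_pow₀ (by norm_num))
  have ha : (a : ℝ) ≤ M := (cast_le_two_pow a).trans hs
  have hT1 : (1 : ℝ) ≤ T := by exact_mod_cast hT
  have hT2 : (T : ℝ) ^ 2 ≤ M := by
    have := cast_le_two_pow (T ^ 2)
    push_cast at this
    exact this.trans ht
  have hTM : (T : ℝ) ≤ M := by nlinarith
  have hW1 : 1 ≤ W := by linarith
  have hMW : M ≤ W := by linarith
  have ht1 : (1 : ℝ) ≤ 2 ^ (T ^ 2) := one_le_pow₀ (by norm_num)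
  have hP1 : 1 ≤ W ^ T := one_le_pow₀ hW1
  have ha0 : (0 : ℝ) ≤ a := by positivity
  have hM0 : 0 ≤ M := by linarith
  have h7 := exp_seven_le
  have e1 : a * (2 ^ a * 2 ^ (T ^ 2) * (T * ((Real.exp 7 + (T + 1)) * δ) + T ^ 2 * δ)) ≤
      1103 * (M ^ 3 * δ) := by
    have : T * (Real.exp 7 + (T + 1)) + T ^ 2 ≤ 1103 * (T : ℝ) ^ 2 := by nlinarith
    calc _ = a * M * ((T * (Real.exp 7 + (T + 1)) + T ^ 2) * δ) := by rw [hM]; ring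
      _ ≤ M * M * ((1103 * M) * δ) := by
          refine mul_le_mul (mul_le_mul_of_nonneg_right ha hM0)
            (mul_le_mul_of_nonneg_right (by linarith) hδ) (by positivity) (by positivity)
      _ = _ := by ring
  have e2 : a * (8 * (2 ^ a * ((T + 1) * δ))) ≤ 16 * (M ^ 3 * δ) := by
    calc _ = 8 * (a * 2 ^ a * (T + 1) * δ) := by ring
      _ ≤ 8 * (M * M * (2 * M) * δ) := by
          refine mul_le_mul_of_nonneg_left (mul_le_mul_of_nonneg_right ?_ hδ) (by norm_num)
          exact mul_le_mul (mul_le_mul ha hs (by positivity) hM0) (by linarith) (by positivity)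
            (by positivity)
      _ = _ := by ring
  have e3 : a * (2 * (2 ^ a * (T ^ 2 * ((2 ^ (T ^ 2) + 2) * τ)))) ≤ 60 * (M ^ 5 * W ^ T * δ) := by
    calc _ = 20 * (a * T ^ 2 * (2 ^ a * (2 ^ (T ^ 2) + 2)) * M * T * (W ^ T * δ)) := by
          rw [hτ]; ring
      _ ≤ 20 * (M * M * (3 * M) * M * M * (W ^ T * δ)) := by
          refine mul_le_mul_of_nonneg_left (mul_le_mul_of_nonneg_right ?_ (by positivity))
            (by norm_num)
          refine mul_le_mul (mul_le_mul_of_nonneg_right (mul_le_mul (mul_le_mul ha hT2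
            (by positivity) hM0) ?_ (by positivity) (by positivity)) hM0) hTM (by positivity)
            (by positivity)
          calc (2 : ℝ) ^ a * (2 ^ (T ^ 2) + 2) ≤ 2 ^ a * (3 * 2 ^ (T ^ 2)) :=
                mul_le_mul_of_nonneg_left (by linarith) (by positivity)
            _ = 3 * M := by rw [hM]; ring
      _ = _ := by ring
  have e4 : 2 ^ a * (a * T * (10 * T * δ * W ^ T)) ≤ 10 * (M ^ 3 * W ^ T * δ) := by
    calc _ = 10 * (2 ^ a * a * T ^ 2 * (W ^ T * δ)) := by ring
      _ ≤ 10 * (M * M * M * (W ^ T * δ)) := by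
          refine mul_le_mul_of_nonneg_left (mul_le_mul_of_nonneg_right ?_ (by positivity))
            (by norm_num)
          exact mul_le_mul (mul_le_mul hs ha (by positivity) hM0) hT2 (by positivity)
            (by positivity)
      _ = _ := by ring
  have h35 : M ^ 3 ≤ W ^ 5 :=
    (pow_le_pow_left₀ hM0 hMW 3).trans (pow_le_pow_right₀ hW1 (by norm_num))
  have h55 : M ^ 5 ≤ W ^ 5 := pow_le_pow_left₀ hM0 hMW 5
  have f1 : M ^ 3 * δ ≤ W ^ 5 * W ^ T * δ := by
    refine mul_le_mul_of_nonneg_right (h35.trans ?_) hδ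
    exact le_mul_of_one_le_right (by positivity) hP1
  have f2 : M ^ 5 * W ^ T * δ ≤ W ^ 5 * W ^ T * δ :=
    mul_le_mul_of_nonneg_right (mul_le_mul_of_nonneg_right h55 (by positivity)) hδ
  have f3 : M ^ 3 * W ^ T * δ ≤ W ^ 5 * W ^ T * δ :=
    mul_le_mul_of_nonneg_right (mul_le_mul_of_nonneg_right h35 (by positivity)) hδ
  have hpow : W ^ (T + 5) * δ = W ^ 5 * W ^ T * δ := by rw [pow_add]; ring
  have hpos : 0 ≤ W ^ 5 * W ^ T * δ := by positivity
  rw [hpow]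
  linarith

/-- With m = aT² the power is at most exp(3m(m+5)) while the exponential is exp(-m^5/8). The fifth
powers in the sampling rate thus beat the accumulated union bounds. -/
theorem pow_mul_exp_le (ha : 0 < a) (hT : 0 < T) :
    ((2 : ℝ) ^ a * 2 ^ (T ^ 2) + 1) ^ (T + 5) * Real.exp (-(logFive a T / 8)) ≤
      Real.exp 100 := by
  set m := a * T ^ 2 with hm
  have hT2 : 0 < T ^ 2 := by positivity
  have ham : a ≤ m := Nat.le_mul_of_pos_right _ hT2
  have hTm2 : T ^ 2 ≤ m := Nat.le_mul_of_pos_left _ ha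
  have hTm : T ≤ m := (Nat.le_self_pow (by norm_num) T).trans hTm2
  have hm1 : 1 ≤ m := by omega
  have hW : (2 : ℝ) ^ a * 2 ^ (T ^ 2) + 1 ≤ Real.exp (3 * m) := by
    have h1 : (2 : ℝ) ^ a * 2 ^ (T ^ 2) + 1 ≤ 2 ^ (3 * m) := by
      rw [← pow_add]
      calc (2 : ℝ) ^ (a + T ^ 2) + 1 ≤ 2 ^ (a + T ^ 2) + 2 ^ (a + T ^ 2) :=
            add_le_add_right (one_le_pow₀ (by norm_num)) _
        _ = 2 ^ (a + T ^ 2 + 1) := by ring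
        _ ≤ _ := pow_le_pow_right₀ (by norm_num) (by omega)
    have h2 : (2 : ℝ) ≤ Real.exp 1 := by linarith [Real.exp_one_gt_d9]
    calc _ ≤ (2 : ℝ) ^ (3 * m) := h1
      _ ≤ Real.exp 1 ^ (3 * m) := pow_le_pow_left₀ (by norm_num) h2 _
      _ = _ := by rw [← Real.exp_nat_mul]; push_cast; ring_nf
  have hD : (logFive a T : ℝ) = (m : ℝ) ^ 5 := by
    rw [hm]; unfold logFive; push_cast; ring
  calc _ ≤ Real.exp (3 * m) ^ (T + 5) * Real.exp (-(logFive a T / 8)) :=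
        mul_le_mul_of_nonneg_right (pow_le_pow_left₀ (by positivity) hW _) (Real.exp_pos _).le
    _ ≤ Real.exp (3 * m) ^ (m + 5) * Real.exp (-(logFive a T / 8)) :=
        mul_le_mul_of_nonneg_right (pow_le_pow_right₀ (Real.one_le_exp (by positivity))
          (by omega)) (Real.exp_pos _).le
    _ = Real.exp (3 * m * (m + 5) - (m : ℝ) ^ 5 / 8) := by
        rw [← Real.exp_nat_mul, ← Real.exp_add, hD]
        congr 1
        push_cast
        ring
    _ ≤ _ := by
        refine Real.exp_le_exp.2 ?_
        -- Small m are checked one by one; from 4 on, m^5/8 ≥ 8m² makes the exponent negative.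
        by_cases h4 : m < 4
        · interval_cases m <;> norm_num
        · have h4' : (4 : ℝ) ≤ m := by exact_mod_cast not_lt.1 h4
          have h5 : (64 : ℝ) ≤ (m : ℝ) ^ 3 := by
            calc (64 : ℝ) = 4 ^ 3 := by norm_num
              _ ≤ _ := pow_le_pow_left₀ (by norm_num) h4' 3
          have h6 : (64 : ℝ) * (m : ℝ) ^ 2 ≤ (m : ℝ) ^ 5 := by
            calc (64 : ℝ) * (m : ℝ) ^ 2 ≤ (m : ℝ) ^ 3 * (m : ℝ) ^ 2 :=
                  mul_le_mul_of_nonneg_right h5 (by positivity)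
              _ = _ := by ring
          nlinarith

/-- The expected size of the cover in terms of a fractional set cover. -/
theorem expect_card_phasedCover_le (ha : 0 < a) (hT : 0 < T)
    (hb : I.Bounded (2 ^ a) (2 ^ (T ^ 2))) {x : ℕ → ℝ} (hx : I.IsFractionalCover x) :
    expect I a T (fun ω => ((phasedCover I a T ω).card : ℝ)) ≤
      (32 + 1200 * Real.exp 100) * a * ∑ S ∈ I.sets, x S := by
  set X := ∑ S ∈ I.sets, x S with hX
  have hX0 : 0 ≤ X := Finset.sum_nonneg hx.1
  set δ := Real.exp (-((logFive a T : ℝ) / 8)) with hδ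
  set M := (2 : ℝ) ^ a * 2 ^ (T ^ 2) with hM
  set τ := M * (10 * T * δ * (M + 1) ^ T) with hτ
  have hδ0 : 0 ≤ δ := (Real.exp_pos _).le
  refine (expect_mono fun ω => card_phasedCover_le hT ω).trans ?_
  rw [expect_add, expect_sum, expect_sum]
  have h1 := Finset.sum_le_sum fun r (hr : r ∈ Finset.range a) =>
    expect_stage_le ha hT hb hx (Finset.mem_range.1 hr) hδ hτ
  have h2 : ∑ e ∈ I.elts, prob I a T (fun ω => e ∈ I.uncovered (mainLoop I a T ω).cover) ≤
      2 ^ a * X * (a * T * (10 * T * δ * (M + 1) ^ T)) := by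
    calc _ ≤ ∑ e ∈ I.elts, (a * T * (10 * T * δ * (M + 1) ^ T)) :=
          Finset.sum_le_sum fun e he => prob_uncovered_le ha hT hb he
      _ = I.elts.card * (a * T * (10 * T * δ * (M + 1) ^ T)) := by
          rw [Finset.sum_const, nsmul_eq_mul]
      _ ≤ _ := by
          refine mul_le_mul_of_nonneg_right ?_ (by positivity)
          have := card_elts_le_fractional hx hb
          push_cast at this
          exact this
  rw [Finset.sum_const, Finset.card_range, nsmul_eq_mul] at h1
  have h3 := mul_le_mul_of_nonneg_right (error_le (a := a) hT hδ0 hM hτ) hX0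
  have h4 := pow_mul_exp_le ha hT
  have h5 : 1200 * ((M + 1) ^ (T + 5) * δ) * X ≤ 1200 * Real.exp 100 * a * X := by
    refine mul_le_mul_of_nonneg_right ?_ hX0
    have ha1 : (1 : ℝ) ≤ a := by exact_mod_cast ha
    calc _ ≤ 1200 * Real.exp 100 := mul_le_mul_of_nonneg_left h4 (by norm_num)
      _ ≤ _ := le_mul_of_one_le_right (by positivity) ha1
  refine (add_le_add h1 h2).trans ?_
  calc _ = 32 * a * X + (a * (2 ^ a * 2 ^ (T ^ 2) * (T * ((Real.exp 7 + (T + 1)) * δ) +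
        T ^ 2 * δ) + 8 * (2 ^ a * ((T + 1) * δ)) +
        2 * (2 ^ a * (T ^ 2 * ((2 ^ (T ^ 2) + 2) * τ)))) +
        2 ^ a * (a * T * (10 * T * δ * (M + 1) ^ T))) * X := by ring
    _ ≤ 32 * a * X + 1200 * Real.exp 100 * a * X := by linarith
    _ = _ := by ring

theorem phasedCover_congr {ω ω' : Samples} (h : ∀ c ∈ coins I a T, ω c = ω' c) :
    phasedCover I a T ω = phasedCover I a T ω' := by
  have : stateBefore I a T ω a = stateBefore I a T ω' a := by
    refine stateBefore_congr (fun i h1 h2 S hS e he => h _ ?_)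
      fun i h1 h2 k h3 h4 S hS => h _ ?_
    · exact (elem_mem_coins I a T).2 ⟨⟨h1, h2⟩, hS, he⟩
    · exact (set_mem_coins I a T).2 ⟨⟨h1, h2⟩, ⟨h3, h4⟩, hS⟩
  rw [phasedCover, phasedCover, mainLoop_eq, mainLoop_eq, this]

/-- The bridge from the infinite product measure to the finite average used in the analysis: only
the coins named by `I` matter. -/
theorem integrable_and_integral_card_phasedCover (I : SetSystem) (a T : ℕ) :
    Integrable (fun ω : Samples => ((phasedCover I a T ω).card : ℝ)) (sampleLaw a T) ∧
      ∫ ω, ((phasedCover I a T ω).card : ℝ) ∂(sampleLaw a T) =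
        expect I a T (fun ω => ((phasedCover I a T ω).card : ℝ)) :=
  integrable_and_integral_eq_avg (fun c => ⟨coinProb a T c, coinProb_mem a T c⟩) (coins I a T)
    (fun ω ω' h => by rw [phasedCover_congr h]) fun _ => false

/-- The expected size of the cover is within a logarithmic factor of the fractional optimum. -/
theorem integral_card_phasedCover_le (ha : 0 < a) (hT : 0 < T)
    (hb : I.Bounded (2 ^ a) (2 ^ (T ^ 2))) :
    ∫ ω, ((phasedCover I a T ω).card : ℝ) ∂(sampleLaw a T) ≤
      (32 + 1200 * Real.exp 100) * a * I.opt := by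
  rw [(integrable_and_integral_card_phasedCover I a T).2]
  have hC : 0 < (32 + 1200 * Real.exp 100) * (a : ℝ) := by
    have := Real.exp_pos 100
    positivity
  rw [← div_le_iff₀' hC]
  -- The infimum is over a nonempty set: weight 1 on every set is a fractional cover.
  refine le_csInf ⟨_, fun _ => 1, ⟨fun _ _ => zero_le_one, fun e he => ?_⟩, rfl⟩ ?_
  · obtain ⟨S, hS, h⟩ := I.coverable e he
    rw [Finset.sum_const, nsmul_eq_mul, mul_one]
    exact_mod_cast Finset.card_pos.2 ⟨S, Finset.mem_filter.2 ⟨hS, h⟩⟩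
  · rintro v ⟨x, hx, rfl⟩
    rw [div_le_iff₀' hC]
    exact expect_card_phasedCover_le ha hT hb hx

end ExpectedSize


/-! ### Reading the samples off the tape -/

section Decoding

/-- The name of a coin as a number. -/
def Coin.code : Coin → ℕ
  | .elem i S e => 2 * Nat.pair i (Nat.pair S e)
  | .set i k S => 2 * Nat.pair i (Nat.pair k S) + 1

theorem Coin.code_injective : Function.Injective Coin.code := by
  rintro (⟨i, S, e⟩ | ⟨i, k, S⟩) (⟨i', S', e'⟩ | ⟨i', k', S'⟩) h
  · simp only [Coin.code] at h
    have h1 : Nat.pair i (Nat.pair S e) = Nat.pair i' (Nat.pair S' e') := by omega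
    simp only [Nat.pair_eq_pair] at h1
    simp [h1]
  · simp only [Coin.code] at h
    omega
  · simp only [Coin.code] at h
    omega
  · simp only [Coin.code] at h
    have h1 : Nat.pair i (Nat.pair k S) = Nat.pair i' (Nat.pair k' S') := by omega
    simp only [Nat.pair_eq_pair] at h1
    simp [h1]

/-- The number of tape bits that are reserved for a coin. -/
def bitCount (a T : ℕ) : ℕ := a + T ^ 2

/-- The number of bit patterns for which a coin shows `true`. -/
def coinWeight (a T : ℕ) : Coin → ℕ
  | .elem i _ _ => min (2 ^ bitCount a T) (logFive a T * 2 ^ i * 2 ^ (T ^ 2))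
  | .set _ k _ => min (2 ^ bitCount a T) (2 ^ k * 2 ^ a)

theorem coinWeight_le (a T : ℕ) (c : Coin) : coinWeight a T c ≤ 2 ^ bitCount a T := by
  cases c <;> exact min_le_left _ _

/-- All probabilities are dyadic with the common denominator 2^(a + T²), so a bounded number of tape
bits simulates each coin exactly. -/
theorem coinProb_eq (a T : ℕ) (c : Coin) :
    coinProb a T c = coinWeight a T c / 2 ^ bitCount a T := by
  have h : (0 : ℚ) < 2 ^ bitCount a T := by positivity
  cases c with
  | elem i S e =>
    simp only [coinProb, coinWeight, elemProb]
    push_cast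
    rw [← min_div_div_right h.le, div_self h.ne', bitCount, pow_add]
    congr 1
    field_simp
  | set i k S =>
    simp only [coinProb, coinWeight, setProb]
    push_cast
    rw [← min_div_div_right h.le, div_self h.ne', bitCount, pow_add]
    congr 1
    field_simp

/-- A numbering of the bit patterns. -/
noncomputable def patternIndex (m : ℕ) : (Fin m → Bool) ≃ Fin (2 ^ m) :=
  Fintype.equivFinOfCardEq (by simp)

/-- The outcome of a coin in terms of its bits. -/
noncomputable def decideCoin (a T : ℕ) (c : Coin) (b : Fin (bitCount a T) → Bool) : Bool :=
  decide ((patternIndex (bitCount a T) b : ℕ) < coinWeight a T c)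

/-- The position on the tape of a bit of a coin. -/
def bitPosition (c : Coin) (n : ℕ) : ℕ := Nat.pair c.code n

/-- The samples encoded by a tape. -/
noncomputable def decodeTape (a T : ℕ) (τ : Tape) : Samples := fun c =>
  decideCoin a T c fun n => τ (bitPosition c n)

/-- The law of a fair bit. -/
noncomputable abbrev fairBit : Measure Bool :=
  bernoulliMeasure true false ⟨1 / 2, by norm_num, by norm_num⟩

theorem fairBit_singleton (b : Bool) : fairBit {b} = 2⁻¹ := by
  have h : (fairBit).real {b} = 2⁻¹ := by
    rw [bernoulliMeasure_real_apply _ (measurableSet_singleton _)]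
    cases b <;> simp
    norm_num
  rw [← ENNReal.ofReal_toReal (measure_ne_top fairBit {b}), ← measureReal_def, h,
    ENNReal.ofReal_inv_of_pos (by norm_num)]
  simp

theorem infinitePi_fairBit_apply (m : ℕ) (A : Finset (Fin m → Bool)) :
    (Measure.infinitePi fun _ : Fin m => fairBit).real A = A.card / 2 ^ m := by
  rw [measureReal_def, ← sum_measure_singleton]
  simp only [Measure.infinitePi_singleton_of_fintype, fairBit_singleton, Finset.prod_const,
    Finset.card_univ, Fintype.card_fin, Finset.sum_const, nsmul_eq_mul]
  rw [ENNReal.toReal_mul, ENNReal.toReal_pow, ENNReal.toReal_inv]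
  simp [div_eq_mul_inv]

/-- The bit patterns are equally likely and exactly `coinWeight` of them have index below the
weight; which numbering is used is irrelevant. -/
theorem map_decideCoin (a T : ℕ) (c : Coin) :
    (Measure.infinitePi fun _ : Fin (bitCount a T) => fairBit).map (decideCoin a T c) =
      bernoulliMeasure true false ⟨coinProb a T c, coinProb_mem a T c⟩ := by
  classical
  set μ := Measure.infinitePi fun _ : Fin (bitCount a T) => fairBit
  have hmeas : Measurable (decideCoin a T c) := measurable_of_finite _
  have : IsProbabilityMeasure (μ.map (decideCoin a T c)) :=
    Measure.isProbabilityMeasure_map hmeas.aemeasurable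
  have htrue : (μ.map (decideCoin a T c)).real {true} = coinProb a T c := by
    rw [map_measureReal_apply hmeas (measurableSet_singleton _)]
    have h1 : decideCoin a T c ⁻¹' {true} = ((Finset.univ.filter fun n : Fin (2 ^ bitCount a T) =>
        (n : ℕ) < coinWeight a T c).map (patternIndex (bitCount a T)).symm.toEmbedding :
        Finset (Fin (bitCount a T) → Bool)) := by
      ext b
      simp [decideCoin]
    rw [h1, infinitePi_fairBit_apply, Finset.card_map, Fin.card_filter_val_lt,
      min_eq_right (coinWeight_le a T c), coinProb_eq]
    push_cast
    rfl
  have hfalse : ∀ (ν : Measure Bool) [IsProbabilityMeasure ν],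
      ν.real {false} = 1 - ν.real {true} := by
    intro ν _
    rw [← probReal_compl_eq_one_sub (measurableSet_singleton _)]
    congr 1
    ext b
    cases b <;> simp
  have htrue' : (bernoulliMeasure true false
      (⟨coinProb a T c, coinProb_mem a T c⟩ : unitInterval)).real {true} = coinProb a T c := by
    rw [bernoulliMeasure_real_apply _ (measurableSet_singleton _)]
    simp
  refine Measure.ext_of_singleton fun b => ?_
  rw [← ENNReal.toReal_eq_toReal_iff' (measure_ne_top _ _) (measure_ne_top _ _),
    ← measureReal_def, ← measureReal_def]
  cases b
  · rw [hfalse, hfalse, htrue, htrue']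
  · rw [htrue, htrue']

/-- Distinct coins read disjoint parts of the tape, since `bitPosition` is injective. So reading,
grouping by coin and deciding each coin separately preserve the product structure. -/
theorem measurePreserving_decodeTape (a T : ℕ) :
    MeasurePreserving (decodeTape a T) tapeLaw (sampleLaw a T) := by
  have hm : ∀ c, Measurable (decideCoin a T c) := fun c => measurable_of_finite _
  have hinj : Function.Injective fun x : Coin × Fin (bitCount a T) => bitPosition x.1 x.2 := by
    rintro ⟨c, n⟩ ⟨c', n'⟩ h
    simp only [bitPosition, Nat.pair_eq_pair] at h
    rw [Coin.code_injective h.1, Fin.ext h.2]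
  have h1 : MeasurePreserving (fun (τ : Tape) (x : Coin × Fin (bitCount a T)) =>
      τ (bitPosition x.1 x.2)) tapeLaw (Measure.infinitePi fun _ => fairBit) :=
    ⟨by fun_prop, Measure.map_infinitePi_infinitePi_of_inj (P := fun _ => fairBit) hinj⟩
  have h2 : MeasurePreserving (MeasurableEquiv.curry Coin (Fin (bitCount a T)) Bool)
      (Measure.infinitePi fun _ => fairBit)
      (Measure.infinitePi fun _ => Measure.infinitePi fun _ => fairBit) :=
    ⟨by fun_prop, Measure.infinitePi_map_curry fun _ _ => fairBit⟩
  have h3 : MeasurePreserving (fun (x : Coin → Fin (bitCount a T) → Bool) c =>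
      decideCoin a T c (x c)) (Measure.infinitePi fun _ => Measure.infinitePi fun _ => fairBit)
      (sampleLaw a T) := by
    refine ⟨?_, ?_⟩
    · exact measurable_pi_lambda _ fun c => (hm c).comp (measurable_pi_apply c)
    · rw [Measure.infinitePi_map_pi _ hm]
      simp only [map_decideCoin]
      rfl
  exact h3.comp (h2.comp h1)

end Decoding


/-! ### Adaptive procedures with results of an arbitrary type -/

/-- An adaptive procedure that returns a result of type `α`. -/
inductive Proc (α : Type)
  | pure (x : α)
  | ask (q : Query) (next : Option ℕ → Proc α)
  | readBit (position : ℕ) (next : Bool → Proc α)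

namespace Proc

variable {α β : Type}

/-- The result of a procedure. -/
def run (I : SetSystem) (τ : Tape) : Proc α → α
  | pure x => x
  | ask q next => (next (I.answer q)).run I τ
  | readBit n next => (next (τ n)).run I τ

/-- The number of neighbor queries of a procedure. -/
def cost (I : SetSystem) (τ : Tape) : Proc α → ℕ
  | pure _ => 0
  | ask q next => (next (I.answer q)).cost I τ + 1
  | readBit n next => (next (τ n)).cost I τ

/-- Sequential composition. -/
def bind (f : α → Proc β) : Proc α → Proc β
  | pure x => f x
  | ask q next => ask q fun o => (next o).bind f
  | readBit n next => readBit n fun b => (next b).bind f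

/-- A procedure with a yes/no answer. -/
def toProcedure : Proc Bool → Procedure
  | pure x => .halt x
  | ask q next => .ask q fun o => (next o).toProcedure
  | readBit n next => .readBit n fun b => (next b).toProcedure

theorem output_toProcedure (I : SetSystem) (τ : Tape) (P : Proc Bool) :
    P.toProcedure.output I τ = P.run I τ := by
  induction P with
  | pure x => rfl
  | ask q next ih => exact ih _
  | readBit n next ih => exact ih _

theorem queries_toProcedure (I : SetSystem) (τ : Tape) (P : Proc Bool) :
    P.toProcedure.queries I τ = P.cost I τ := by
  induction P with
  | pure x => rfl
  | ask q next ih => exact congrArg (· + 1) (ih _)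
  | readBit n next ih => exact ih _

theorem run_bind (I : SetSystem) (τ : Tape) (f : α → Proc β) (P : Proc α) :
    (P.bind f).run I τ = (f (P.run I τ)).run I τ := by
  induction P with
  | pure x => rfl
  | ask q next ih => exact ih _
  | readBit n next ih => exact ih _

theorem cost_bind (I : SetSystem) (τ : Tape) (f : α → Proc β) (P : Proc α) :
    (P.bind f).cost I τ = P.cost I τ + (f (P.run I τ)).cost I τ := by
  induction P with
  | pure x => simp [bind, cost, run]
  | ask q next ih => simp only [bind, cost, run]; rw [ih]; omega
  | readBit n next ih => exact ih _

/-- The procedure `P` returns `x` and asks at most `n` queries. -/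
def Computes (I : SetSystem) (τ : Tape) (P : Proc α) (x : α) (n : ℕ) : Prop :=
  P.run I τ = x ∧ P.cost I τ ≤ n

variable {I : SetSystem} {τ : Tape}

theorem Computes.pure (x : α) : Computes I τ (.pure x) x 0 := ⟨rfl, le_rfl⟩

theorem Computes.mono {P : Proc α} {x : α} {m n : ℕ} (h : Computes I τ P x m) (hmn : m ≤ n) :
    Computes I τ P x n := ⟨h.1, h.2.trans hmn⟩

theorem Computes.bind {P : Proc α} {x : α} {m n : ℕ} {f : α → Proc β} {y : β}
    (h : Computes I τ P x m) (h' : Computes I τ (f x) y n) :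
    Computes I τ (P.bind f) y (m + n) := by
  refine ⟨?_, ?_⟩
  · rw [run_bind, h.1, h'.1]
  · rw [cost_bind, h.1]
    exact Nat.add_le_add h.2 h'.2

/-- Apply a function to the result. -/
def map (g : α → β) (P : Proc α) : Proc β := P.bind fun x => .pure (g x)

theorem Computes.map {P : Proc α} {x : α} {m : ℕ} (h : Computes I τ P x m) (g : α → β) :
    Computes I τ (P.map g) (g x) m :=
  h.bind (f := fun x => .pure (g x)) (Computes.pure (g x))

/-- Run a procedure for all entries of a list. -/
def mapList (f : α → Proc β) : List α → Proc (List β)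
  | [] => .pure []
  | x :: l => (f x).bind fun y => (mapList f l).map (y :: ·)

theorem Computes.mapList {f : α → Proc β} {g : α → β} {n : ℕ} {l : List α}
    (h : ∀ x ∈ l, Computes I τ (f x) (g x) n) :
    Computes I τ (Proc.mapList f l) (l.map g) (l.length * n) := by
  induction l with
  | nil => exact (Computes.pure _).mono (Nat.zero_le _)
  | cons x l ih =>
    have h1 := h x List.mem_cons_self
    have h2 := ih fun y hy => h y (List.mem_cons_of_mem _ hy)
    refine (h1.bind (h2.map _)).mono (le_of_eq ?_)
    rw [List.length_cons]
    ring

/-- Filter a list by a procedure. -/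
def filterList (p : α → Proc Bool) : List α → Proc (List α)
  | [] => .pure []
  | x :: l => (p x).bind fun b => (filterList p l).map fun l' => if b then x :: l' else l'

theorem Computes.filterList {p : α → Proc Bool} {q : α → Bool} {n : ℕ} {l : List α}
    (h : ∀ x ∈ l, Computes I τ (p x) (q x) n) :
    Computes I τ (Proc.filterList p l) (l.filter q) (l.length * n) := by
  induction l with
  | nil => exact (Computes.pure _).mono (Nat.zero_le _)
  | cons x l ih =>
    have h1 := h x List.mem_cons_self
    have h2 := ih fun y hy => h y (List.mem_cons_of_mem _ hy)
    have h3 := (h1.bind (f := fun b => (Proc.filterList p l).map fun l' =>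
      if b then x :: l' else l') (h2.map _)).mono (n := (x :: l).length * n)
        (le_of_eq (by rw [List.length_cons]; ring))
    rw [List.filter_cons]
    exact h3

/-- Does the procedure answer yes for some entry of the list? -/
def anyList (p : α → Proc Bool) (l : List α) : Proc Bool :=
  (filterList p l).map fun l' => !l'.isEmpty

theorem Computes.anyList {p : α → Proc Bool} {q : α → Bool} {n : ℕ} {l : List α}
    (h : ∀ x ∈ l, Computes I τ (p x) (q x) n) :
    Computes I τ (Proc.anyList p l) (l.any q) (l.length * n) := by
  have h1 := (Computes.filterList h).map fun l' => !l'.isEmpty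
  have h2 : (!(l.filter q).isEmpty) = l.any q := by
    rw [Bool.eq_iff_iff]
    simp
  rwa [h2] at h1

/-- Run the second procedure if the first one answers yes, and answer no otherwise. -/
def andThen (P P' : Proc Bool) : Proc Bool := P.bind fun b => if b then P' else .pure false

/-- The second procedure has to be correct and cheap only if the first answers yes. This lets later
bounds assume that an element is still free. -/
theorem Computes.andThen {P P' : Proc Bool} {x y : Bool} {m n : ℕ} (h : Computes I τ P x m)
    (h' : x = true → Computes I τ P' y n) : Computes I τ (P.andThen P') (x && y) (m + n) := by
  refine h.bind ?_
  cases x with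
  | false => exact (Computes.pure false).mono (Nat.zero_le _)
  | true => exact h' rfl

/-- A neighbor query. -/
def query (q : Query) : Proc (Option ℕ) := .ask q .pure

theorem Computes.query (q : Query) : Computes I τ (Proc.query q) (I.answer q) 1 := ⟨rfl, le_rfl⟩

/-- Read a bit of the tape. -/
def bit (n : ℕ) : Proc Bool := .readBit n .pure

theorem Computes.bit (n : ℕ) : Computes I τ (Proc.bit n) (τ n) 0 := ⟨rfl, le_rfl⟩

/-- Read a coin off the tape. -/
noncomputable def coin (a T : ℕ) (c : Coin) : Proc Bool :=
  (mapList (fun n => bit (bitPosition c n)) (List.range (bitCount a T))).map fun l =>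
    decideCoin a T c fun n => l.getD n false

/-- Tape bits are not neighbor queries, so a coin is free of charge. -/
theorem Computes.coin (a T : ℕ) (c : Coin) :
    Computes I τ (Proc.coin a T c) (decodeTape a T τ c) 0 := by
  have h := (Computes.mapList (I := I) (τ := τ) (l := List.range (bitCount a T))
    fun n _ => Computes.bit (bitPosition c n)).map fun l =>
      decideCoin a T c fun n => l.getD n false
  rw [Nat.mul_zero] at h
  have h2 : (decideCoin a T c fun n : Fin (bitCount a T) =>
      ((List.range (bitCount a T)).map fun n => τ (bitPosition c n)).getD n false) =
      decodeTape a T τ c := by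
    unfold decodeTape
    congr 1
    funext n
    simp
  rwa [h2] at h

theorem filterMap_getElem?_range (l : List ℕ) {n : ℕ} (h : l.length ≤ n) :
    ((List.range n).map fun i => l[i]?).filterMap id = l := by
  induction l generalizing n with
  | nil => simp
  | cons x l ih =>
    obtain ⟨m, rfl⟩ : ∃ m, n = m + 1 := ⟨n - 1, by simp at h; omega⟩
    rw [List.range_succ_eq_map]
    simp only [List.map_cons, List.map_map, List.filterMap_cons]
    have := ih (n := m) (by simpa using h)
    simpa [Function.comp_def] using this

/-- List the elements of a set. -/
def elems (s S : ℕ) : Proc (List ℕ) :=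
  (mapList (fun n => query (.elemOf S n)) (List.range s)).map (List.filterMap id)

/-- Always `s` queries are asked; those beyond the end of the list return `none` and are dropped. -/
theorem Computes.elems {s t S : ℕ} (hb : I.Bounded s t) (hS : S ∈ I.sets) :
    Computes I τ (Proc.elems s S) (I.elemsOf S) s := by
  have h := (Computes.mapList (I := I) (τ := τ) (l := List.range s)
    fun n _ => Computes.query (.elemOf S n)).map (List.filterMap id)
  simp only [SetSystem.answer, if_pos hS, List.length_range, Nat.mul_one] at h
  rwa [filterMap_getElem?_range _ (hb.1 S hS)] at h

/-- List the sets that contain an element. -/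
def sets (t e : ℕ) : Proc (List ℕ) :=
  (mapList (fun n => query (.setOf e n)) (List.range t)).map (List.filterMap id)

theorem Computes.sets {s t e : ℕ} (hb : I.Bounded s t) (he : e ∈ I.elts) :
    Computes I τ (Proc.sets t e) (I.setsOf e) t := by
  have h := (Computes.mapList (I := I) (τ := τ) (l := List.range t)
    fun n _ => Computes.query (.setOf e n)).map (List.filterMap id)
  simp only [SetSystem.answer, if_pos he, List.length_range, Nat.mul_one] at h
  rwa [filterMap_getElem?_range _ (hb.2 e he)] at h

end Proc


/-! ### Simulating a phase -/

section Simulation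

open Proc

variable (a T i : ℕ) (isFree : ℕ → Proc Bool)

/-- Is the estimate large when `n` elements of the sample are free? -/
def isHeavy (n : ℕ) : Bool := decide ((2 ^ a / 2 ^ i : ℚ) ≤ n / elemProb a T i)

/-- List the free elements of `B_i(S)`. -/
noncomputable def partProc (S : ℕ) : Proc (List ℕ) :=
  (Proc.elems (2 ^ a) S).bind fun l =>
    (filterList (fun e => Proc.coin a T (.elem i S e)) l).bind (filterList isFree)

/-- List the sets of `𝒮̂_{i,k}` that contain `e`. -/
noncomputable def sparseProc (k e : ℕ) : Proc (List ℕ) :=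
  (Proc.sets (2 ^ (T ^ 2)) e).bind fun l =>
    (filterList (fun S => Proc.coin a T (.set i k S)) l).bind
      (filterList fun S => (partProc a T i isFree S).map fun l => isHeavy a T i l.length)

/-- Is `e` free after the first two steps of phase `j`? -/
noncomputable def baseProc (j e : ℕ) : Proc Bool :=
  (isFree e).andThen
    ((((Proc.sets (2 ^ (T ^ 2)) e).bind (anyList fun S => (partProc a T i isFree S).map fun l =>
        decide (logTen a T ≤ l.length))).map not).andThen
      ((anyList (fun k => (sparseProc a T i isFree k e).map fun l =>
        decide (logTen a T * 2 ^ T ≤ l.length)) (List.range' (j * T + 1) T)).map not))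

/-- Is `e` free after iteration `k`, given a procedure for the time before this iteration? -/
noncomputable def stepProc (k : ℕ) (cur : ℕ → Proc Bool) (e : ℕ) : Proc Bool :=
  (cur e).andThen (((sparseProc a T i isFree k e).bind (anyList fun S =>
    (partProc a T i isFree S).bind fun l =>
      (filterList cur l).map fun l' => isHeavy a T i l'.length)).map not)

/-- Is `e` free after `ℓ` iterations of phase `j`? -/
noncomputable def iterProc (j : ℕ) : ℕ → ℕ → Proc Bool
  | 0 => baseProc a T i isFree j
  | ℓ + 1 => stepProc a T i isFree (j * T + (ℓ + 1)) (iterProc j ℓ)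

/-- Is `S` added in phase `j`? -/
noncomputable def joinProc (j S : ℕ) : Proc Bool :=
  (partProc a T i isFree S).bind fun l =>
    if logTen a T ≤ l.length then .pure true
    else anyList (fun ℓ => (Proc.coin a T (.set i (j * T + (ℓ + 1)) S)).andThen
      ((filterList (iterProc a T i isFree j ℓ) l).map fun l' => isHeavy a T i l'.length))
      (List.range T)

end Simulation

/-! ### Correctness and cost of simulating one phase. -/

section Correctness

open Proc

variable {I : SetSystem} {a T r j Q : ℕ} {τ : Tape} {ω : Samples} {isFree : ℕ → Proc Bool}

theorem length_filter_elemsOf {S : ℕ} (hS : S ∈ I.sets) (i : ℕ) (ω : Samples) {E : Finset ℕ}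
    {p : ℕ → Bool} (hp : ∀ e ∈ I.elemsOf S, p e = true ↔ ω (.elem i S e) = true ∧ e ∈ E) :
    ((I.elemsOf S).filter p).length = (sampleB I ω i S ∩ E).card := by
  rw [← List.toFinset_card_of_nodup ((I.nodup_elemsOf S hS).filter _)]
  congr 1
  ext e
  simp only [List.mem_toFinset, List.mem_filter, Finset.mem_inter, sampleB, Finset.mem_filter]
  constructor
  · rintro ⟨h1, h2⟩
    have := (hp e h1).1 h2
    exact ⟨⟨h1, this.1⟩, this.2⟩
  · rintro ⟨⟨h1, h2⟩, h3⟩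
    exact ⟨h1, (hp e h1).2 ⟨h2, h3⟩⟩

theorem isHeavy_eq {i S n : ℕ} {E : Finset ℕ} (h : n = (sampleB I ω i S ∩ E).card) :
    isHeavy a T i n = decide ((2 ^ a / 2 ^ i : ℚ) ≤ estimate I a T ω i S E) := by
  rw [isHeavy, estimate, h]

/-- The list of the elements of `B_i(S)` that lie in `E`. -/
def partList (I : SetSystem) (ω : Samples) (i S : ℕ) (E : Finset ℕ) : List ℕ :=
  ((I.elemsOf S).filter fun e => ω (.elem i S e)).filter fun e => decide (e ∈ E)

theorem mem_partList {i S e : ℕ} {E : Finset ℕ} : e ∈ partList I ω i S E ↔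
    (e ∈ I.elemsOf S ∧ ω (.elem i S e) = true) ∧ e ∈ E := by
  simp only [partList, List.mem_filter, decide_eq_true_eq]

theorem length_partList {i S : ℕ} (hS : S ∈ I.sets) (E : Finset ℕ) :
    (partList I ω i S E).length = (sampleB I ω i S ∩ E).card := by
  rw [partList, List.filter_filter]
  refine length_filter_elemsOf hS i ω fun e _ => ?_
  simp [and_comm]

theorem length_filter_partList {i S : ℕ} (hS : S ∈ I.sets) {E E' : Finset ℕ} (hE : E' ⊆ E) :
    ((partList I ω i S E).filter fun e => decide (e ∈ E')).length =
      (sampleB I ω i S ∩ E').card := by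
  rw [partList, List.filter_filter, List.filter_filter]
  refine length_filter_elemsOf hS i ω fun e _ => ?_
  simp only [Bool.and_eq_true, decide_eq_true_eq]
  have := @hE e
  tauto

/-- The list of the sets of `𝒮̂_{i,k}` that contain `e`. -/
def sparseList (I : SetSystem) (a T : ℕ) (ω : Samples) (i k e : ℕ) (E : Finset ℕ) : List ℕ :=
  ((I.setsOf e).filter fun S => ω (.set i k S)).filter fun S =>
    decide ((2 ^ a / 2 ^ i : ℚ) ≤ estimate I a T ω i S E)

theorem mem_sparseList {i k e S : ℕ} {E : Finset ℕ} (he : e ∈ I.elts) :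
    S ∈ sparseList I a T ω i k e E ↔ S ∈ sparseS I a T ω i k E ∧ e ∈ I.elemsOf S := by
  simp only [sparseList, List.mem_filter, mem_sparseS, decide_eq_true_eq]
  constructor
  · rintro ⟨⟨h1, h2⟩, h3⟩
    have hS := I.setsOf_subset e he S h1
    exact ⟨⟨⟨hS, h2⟩, h3⟩, (I.mem_iff S hS e he).2 h1⟩
  · rintro ⟨⟨⟨hS, h2⟩, h3⟩, h4⟩
    exact ⟨⟨(I.mem_iff S hS e he).1 h4, h2⟩, h3⟩

theorem length_sparseList {i k e : ℕ} {E : Finset ℕ} (he : e ∈ I.elts) :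
    (sparseList I a T ω i k e E).length =
      ((sparseS I a T ω i k E).filter fun S => e ∈ I.elemsOf S).card := by
  have hnd : (sparseList I a T ω i k e E).Nodup := ((I.nodup_setsOf e he).filter _).filter _
  rw [← List.toFinset_card_of_nodup hnd]
  congr 1
  ext S
  rw [List.mem_toFinset, Finset.mem_filter]
  exact mem_sparseList he

theorem mem_badSets {i S : ℕ} {E : Finset ℕ} : S ∈ badSets I a T ω i E ↔
    S ∈ I.sets ∧ logTen a T ≤ (sampleB I ω i S ∩ E).card := by
  rw [badSets, Finset.mem_filter]

theorem computes_partProc (hb : I.Bounded (2 ^ a) (2 ^ (T ^ 2))) (hω : ω = decodeTape a T τ)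
    {i S : ℕ} {E : Finset ℕ}
    (hfree : ∀ e ∈ I.elts, Computes I τ (isFree e) (decide (e ∈ E)) Q) (hS : S ∈ I.sets) :
    Computes I τ (partProc a T i isFree S) (partList I ω i S E) (2 ^ a + 2 ^ a * Q) := by
  have h1 := Computes.elems (τ := τ) hb hS
  have h2 : Computes I τ (filterList (fun e => Proc.coin a T (.elem i S e)) (I.elemsOf S))
      ((I.elemsOf S).filter fun e => ω (.elem i S e)) ((I.elemsOf S).length * 0) := by
    rw [hω]
    exact Computes.filterList fun e _ => Computes.coin a T _
  have h3 : Computes I τ (filterList isFree ((I.elemsOf S).filter fun e => ω (.elem i S e)))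
      (partList I ω i S E) (((I.elemsOf S).filter fun e => ω (.elem i S e)).length * Q) :=
    Computes.filterList fun e he =>
      hfree e (I.elemsOf_subset S hS e (List.mem_filter.1 he).1)
  refine (h1.bind (h2.bind h3)).mono (Nat.add_le_add_left ?_ _)
  rw [Nat.mul_zero, Nat.zero_add]
  exact Nat.mul_le_mul_right _ ((List.length_filter_le _ _).trans (hb.1 S hS))

theorem computes_sparseProc (hb : I.Bounded (2 ^ a) (2 ^ (T ^ 2))) (hω : ω = decodeTape a T τ)
    {i k e : ℕ} {E : Finset ℕ}
    (hfree : ∀ e ∈ I.elts, Computes I τ (isFree e) (decide (e ∈ E)) Q) (he : e ∈ I.elts) :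
    Computes I τ (sparseProc a T i isFree k e) (sparseList I a T ω i k e E)
      (2 ^ (T ^ 2) + 2 ^ (T ^ 2) * (2 ^ a + 2 ^ a * Q)) := by
  have h1 := Computes.sets (τ := τ) hb he
  have h2 : Computes I τ (filterList (fun S => Proc.coin a T (.set i k S)) (I.setsOf e))
      ((I.setsOf e).filter fun S => ω (.set i k S)) ((I.setsOf e).length * 0) := by
    rw [hω]
    exact Computes.filterList fun S _ => Computes.coin a T _
  have h3 : Computes I τ (filterList
      (fun S => (partProc a T i isFree S).map fun l => isHeavy a T i l.length)
      ((I.setsOf e).filter fun S => ω (.set i k S))) (sparseList I a T ω i k e E)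
      (((I.setsOf e).filter fun S => ω (.set i k S)).length * (2 ^ a + 2 ^ a * Q)) := by
    refine Computes.filterList fun S hS => ?_
    have hS' := I.setsOf_subset e he S (List.mem_filter.1 hS).1
    rw [← isHeavy_eq (length_partList hS' E)]
    exact (computes_partProc hb hω hfree hS').map fun l => isHeavy a T i l.length
  refine (h1.bind (h2.bind h3)).mono (Nat.add_le_add_left ?_ _)
  rw [Nat.mul_zero, Nat.zero_add]
  exact Nat.mul_le_mul_right _ ((List.length_filter_le _ _).trans (hb.2 e he))

theorem mem_iterFree_zero {e : ℕ} : e ∈ iterFree I a T ω r j 0 ↔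
    e ∈ phaseFree I a T ω r j ∧
      (∀ S ∈ badSets I a T ω (r + 1) (phaseFree I a T ω r j), e ∉ I.elemsOf S) ∧
      e ∉ badElts I a T ω (r + 1) j (phaseFree I a T ω r j) := by
  rw [mem_free, mem_free, iterState_zero_cover, iterState_pretend]
  simp only [Finset.mem_union, not_or]
  constructor
  · rintro ⟨⟨h1, h2⟩, h3, h4⟩
    exact ⟨⟨⟨h1, fun S hS => h2 S (Or.inl hS)⟩, h3⟩, fun S hS => h2 S (Or.inr hS), h4⟩
  · rintro ⟨⟨⟨h1, h2⟩, h3⟩, h4, h5⟩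
    exact ⟨⟨h1, fun S hS => hS.elim (h2 S) (h4 S)⟩, h3, h5⟩

theorem mem_iterFree_succ {e ℓ : ℕ} : e ∈ iterFree I a T ω r j (ℓ + 1) ↔
    e ∈ iterFree I a T ω r j ℓ ∧ ∀ S ∈ addedSets I a T ω r j ℓ, e ∉ I.elemsOf S := by
  rw [mem_free, mem_free, iterState_succ]
  simp only [Finset.mem_union]
  constructor
  · rintro ⟨⟨h1, h2⟩, h3⟩
    exact ⟨⟨⟨h1, fun S hS => h2 S (Or.inl hS)⟩, h3⟩, fun S hS => h2 S (Or.inr hS)⟩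
  · rintro ⟨⟨⟨h1, h2⟩, h3⟩, h4⟩
    exact ⟨⟨h1, fun S hS => hS.elim (h2 S) (h4 S)⟩, h3⟩

theorem computes_baseProc (hb : I.Bounded (2 ^ a) (2 ^ (T ^ 2))) (hω : ω = decodeTape a T τ)
    (hfree : ∀ e ∈ I.elts, Computes I τ (isFree e) (decide (e ∈ phaseFree I a T ω r j)) Q)
    {e : ℕ} (he : e ∈ I.elts) :
    Computes I τ (baseProc a T (r + 1) isFree j e) (decide (e ∈ iterFree I a T ω r j 0))
      (Q + ((2 ^ (T ^ 2) + 2 ^ (T ^ 2) * (2 ^ a + 2 ^ a * Q)) +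
        T * (2 ^ (T ^ 2) + 2 ^ (T ^ 2) * (2 ^ a + 2 ^ a * Q)))) := by
  set E := phaseFree I a T ω r j with hE
  have h1 : Computes I τ ((Proc.sets (2 ^ (T ^ 2)) e).bind (anyList fun S =>
      (partProc a T (r + 1) isFree S).map fun l => decide (logTen a T ≤ l.length)))
      ((I.setsOf e).any fun S => decide (logTen a T ≤ (partList I ω (r + 1) S E).length))
      (2 ^ (T ^ 2) + 2 ^ (T ^ 2) * (2 ^ a + 2 ^ a * Q)) := by
    refine ((Computes.sets hb he).bind (Computes.anyList fun S hS => ?_)).mono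
      (Nat.add_le_add_left (Nat.mul_le_mul_right _ (hb.2 e he)) _)
    exact (computes_partProc hb hω hfree (I.setsOf_subset e he S hS)).map
      fun l => decide (logTen a T ≤ l.length)
  have h2 : Computes I τ (anyList (fun k => (sparseProc a T (r + 1) isFree k e).map fun l =>
        decide (logTen a T * 2 ^ T ≤ l.length)) (List.range' (j * T + 1) T))
      ((List.range' (j * T + 1) T).any fun k => decide (logTen a T * 2 ^ T ≤
        (sparseList I a T ω (r + 1) k e E).length))
      (T * (2 ^ (T ^ 2) + 2 ^ (T ^ 2) * (2 ^ a + 2 ^ a * Q))) := by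
    refine (Computes.anyList fun k _ => ?_).mono (le_of_eq (by rw [List.length_range']))
    exact (computes_sparseProc hb hω hfree he).map fun l =>
      decide (logTen a T * 2 ^ T ≤ l.length)
  have h3 := (hfree e he).andThen fun _ => (h1.map not).andThen fun _ => h2.map not
  have h4 : (decide (e ∈ E) && (!((I.setsOf e).any fun S =>
      decide (logTen a T ≤ (partList I ω (r + 1) S E).length)) &&
      !((List.range' (j * T + 1) T).any fun k => decide (logTen a T * 2 ^ T ≤
        (sparseList I a T ω (r + 1) k e E).length)))) =
      decide (e ∈ iterFree I a T ω r j 0) := by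
    rw [Bool.eq_iff_iff]
    simp only [Bool.and_eq_true, decide_eq_true_eq, Bool.not_eq_true', List.any_eq_false]
    rw [mem_iterFree_zero]
    refine and_congr_right fun heE => and_congr ?_ ?_
    · constructor
      · intro h S hS heS
        have hS' := mem_badSets.1 hS
        refine h S ((I.mem_iff S hS'.1 e he).1 heS) ?_
        rw [length_partList hS'.1]
        exact hS'.2
      · intro h S hS hlen
        have hS' := I.setsOf_subset e he S hS
        rw [length_partList hS'] at hlen
        exact h S (mem_badSets.2 ⟨hS', hlen⟩) ((I.mem_iff S hS' e he).2 hS)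
    · rw [mem_badElts]
      simp only [not_and, not_exists, List.mem_range'_1, Finset.mem_Icc]
      have hidx : (j + 1) * T = j * T + T := by ring
      constructor
      · intro h _ k hk hcard
        rw [← length_sparseList he] at hcard
        exact h k ⟨hk.1, by omega⟩ hcard
      · intro h k hk hlen
        rw [length_sparseList he] at hlen
        exact h heE k ⟨hk.1, by omega⟩ hlen
  rw [h4] at h3
  exact h3

theorem mem_iterFree_succ_iff_sparseList {e ℓ : ℕ} (he : e ∈ I.elts) :
    (decide (e ∈ iterFree I a T ω r j ℓ) &&
      !((sparseList I a T ω (r + 1) (j * T + (ℓ + 1)) e (phaseFree I a T ω r j)).any fun S =>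
        isHeavy a T (r + 1) ((partList I ω (r + 1) S (phaseFree I a T ω r j)).filter
          fun e => decide (e ∈ iterFree I a T ω r j ℓ)).length)) =
      decide (e ∈ iterFree I a T ω r j (ℓ + 1)) := by
  have hheavy : ∀ S ∈ I.sets, isHeavy a T (r + 1)
      ((partList I ω (r + 1) S (phaseFree I a T ω r j)).filter
        fun e => decide (e ∈ iterFree I a T ω r j ℓ)).length =
      decide ((2 ^ a / 2 ^ (r + 1) : ℚ) ≤
        estimate I a T ω (r + 1) S (iterFree I a T ω r j ℓ)) := fun S hS =>
    isHeavy_eq (length_filter_partList hS (iterFree_subset_phaseFree r j ℓ))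
  rw [Bool.eq_iff_iff]
  simp only [Bool.and_eq_true, decide_eq_true_eq, Bool.not_eq_true', List.any_eq_false]
  rw [mem_iterFree_succ]
  refine and_congr_right fun _ => ?_
  constructor
  · intro h S hS heS
    rw [addedSets, Finset.mem_filter] at hS
    refine h S ((mem_sparseList he).2 ⟨hS.1, heS⟩) ?_
    rw [hheavy S (sparseS_subset _ _ _ hS.1)]
    exact decide_eq_true hS.2
  · intro h S hS hlen
    have hS' := (mem_sparseList he).1 hS
    rw [hheavy S (sparseS_subset _ _ _ hS'.1), decide_eq_true_eq] at hlen
    refine h S ?_ hS'.2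
    rw [addedSets, Finset.mem_filter]
    exact ⟨hS'.1, hlen⟩

/-- Otherwise `e` would have started to pretend at the beginning of the phase. -/
theorem length_sparseList_le {e k : ℕ} (hk : j * T < k) (hk' : k ≤ j * T + T) (he : e ∈ I.elts)
    (hmem : e ∈ iterFree I a T ω r j 0) :
    (sparseList I a T ω (r + 1) k e (phaseFree I a T ω r j)).length ≤ logTen a T * 2 ^ T := by
  rw [mem_iterFree_zero] at hmem
  rw [length_sparseList he]
  by_contra! hlt
  refine hmem.2.2 (mem_badElts.2 ⟨hmem.1, k, Finset.mem_Icc.2 ⟨hk, ?_⟩, hlt.le⟩)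
  rwa [Nat.succ_mul]

/-- Otherwise `S` would have been added as a bad set and `e` would be covered. -/
theorem length_partList_le_logTen {e S : ℕ} (hS : S ∈ I.sets) (he : e ∈ I.elemsOf S)
    (hmem : e ∈ iterFree I a T ω r j 0) :
    (partList I ω (r + 1) S (phaseFree I a T ω r j)).length ≤ logTen a T := by
  rw [mem_iterFree_zero] at hmem
  rw [length_partList hS]
  by_contra! hlt
  exact hmem.2.1 S (mem_badSets.2 ⟨hS, hlt.le⟩) he

/-- The recursive calls are made only if `e` is still free. Then few candidate sets remain, each
with few sampled free elements, so `R` is multiplied by 1 + N²·2^T and not by st; the factor st hits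
only the phase-start cost `Q`. -/
theorem computes_stepProc (hb : I.Bounded (2 ^ a) (2 ^ (T ^ 2))) (hω : ω = decodeTape a T τ)
    (hfree : ∀ e ∈ I.elts, Computes I τ (isFree e) (decide (e ∈ phaseFree I a T ω r j)) Q)
    {ℓ R : ℕ} (hℓ : ℓ < T) {cur : ℕ → Proc Bool}
    (hcur : ∀ e ∈ I.elts, Computes I τ (cur e) (decide (e ∈ iterFree I a T ω r j ℓ)) R)
    {e : ℕ} (he : e ∈ I.elts) :
    Computes I τ (stepProc a T (r + 1) isFree (j * T + (ℓ + 1)) cur e)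
      (decide (e ∈ iterFree I a T ω r j (ℓ + 1)))
      (R + ((2 ^ (T ^ 2) + 2 ^ (T ^ 2) * (2 ^ a + 2 ^ a * Q)) +
        logTen a T * 2 ^ T * ((2 ^ a + 2 ^ a * Q) + logTen a T * R))) := by
  rw [← mem_iterFree_succ_iff_sparseList he]
  refine (hcur e he).andThen fun hmem => ?_
  have hmem0 := iterFree_anti (Nat.zero_le ℓ) (of_decide_eq_true hmem)
  have hlen := length_sparseList_le (k := j * T + (ℓ + 1)) (by omega) (by omega) he hmem0
  have hS : ∀ S ∈ sparseList I a T ω (r + 1) (j * T + (ℓ + 1)) e (phaseFree I a T ω r j),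
      Computes I τ ((partProc a T (r + 1) isFree S).bind fun l =>
        (filterList cur l).map fun l' => isHeavy a T (r + 1) l'.length)
        (isHeavy a T (r + 1) ((partList I ω (r + 1) S (phaseFree I a T ω r j)).filter
          fun e => decide (e ∈ iterFree I a T ω r j ℓ)).length)
        ((2 ^ a + 2 ^ a * Q) + logTen a T * R) := by
    intro S hS
    rw [mem_sparseList he] at hS
    have hSI := sparseS_subset _ _ _ hS.1
    refine (computes_partProc hb hω hfree hSI).bind ?_
    refine ((Computes.filterList fun f hf => ?_).map
      fun l' => isHeavy a T (r + 1) l'.length).mono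
        (Nat.mul_le_mul_right _ (length_partList_le_logTen hSI hS.2 hmem0))
    exact hcur f (I.elemsOf_subset S hSI f (mem_partList.1 hf).1.1)
  exact (((computes_sparseProc hb hω hfree he).bind (Computes.anyList hS)).mono
    (Nat.add_le_add_left (Nat.mul_le_mul_right _ hlen) _)).map not

/-- A bound for the number of queries of `iterProc`. -/
def iterCost (a T Q : ℕ) : ℕ → ℕ
  | 0 => Q + ((2 ^ (T ^ 2) + 2 ^ (T ^ 2) * (2 ^ a + 2 ^ a * Q)) +
        T * (2 ^ (T ^ 2) + 2 ^ (T ^ 2) * (2 ^ a + 2 ^ a * Q)))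
  | ℓ + 1 => iterCost a T Q ℓ + ((2 ^ (T ^ 2) + 2 ^ (T ^ 2) * (2 ^ a + 2 ^ a * Q)) +
        logTen a T * 2 ^ T * ((2 ^ a + 2 ^ a * Q) + logTen a T * iterCost a T Q ℓ))

theorem computes_iterProc (hb : I.Bounded (2 ^ a) (2 ^ (T ^ 2))) (hω : ω = decodeTape a T τ)
    (hfree : ∀ e ∈ I.elts, Computes I τ (isFree e) (decide (e ∈ phaseFree I a T ω r j)) Q)
    {ℓ : ℕ} (hℓ : ℓ ≤ T) : ∀ e ∈ I.elts,
    Computes I τ (iterProc a T (r + 1) isFree j ℓ e) (decide (e ∈ iterFree I a T ω r j ℓ))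
      (iterCost a T Q ℓ) := by
  induction ℓ with
  | zero => exact fun e he => computes_baseProc hb hω hfree he
  | succ ℓ ih =>
    exact fun e he => computes_stepProc hb hω hfree (by omega) (ih (by omega)) he

theorem iterCost_mono (a T Q : ℕ) {ℓ ℓ' : ℕ} (h : ℓ ≤ ℓ') :
    iterCost a T Q ℓ ≤ iterCost a T Q ℓ' := by
  induction h with
  | refl => exact le_rfl
  | step _ ih => exact ih.trans (Nat.le_add_right _ _)

/-- If `S` is not bad, fewer than `logTen a T` sampled elements have to be followed through the
iterations. -/
theorem computes_joinProc (hb : I.Bounded (2 ^ a) (2 ^ (T ^ 2))) (hω : ω = decodeTape a T τ)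
    (hfree : ∀ e ∈ I.elts, Computes I τ (isFree e) (decide (e ∈ phaseFree I a T ω r j)) Q)
    {S : ℕ} (hS : S ∈ I.sets) :
    Computes I τ (joinProc a T (r + 1) isFree j S)
      (decide (S ∈ badSets I a T ω (r + 1) (phaseFree I a T ω r j) ∨
        ∃ ℓ ∈ Finset.range T, S ∈ addedSets I a T ω r j ℓ))
      ((2 ^ a + 2 ^ a * Q) + T * (logTen a T * iterCost a T Q T)) := by
  set E := phaseFree I a T ω r j with hE
  refine (computes_partProc hb hω hfree hS).bind ?_
  by_cases hlen : logTen a T ≤ (partList I ω (r + 1) S E).length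
  · rw [if_pos hlen]
    rw [length_partList hS] at hlen
    have hbad : S ∈ badSets I a T ω (r + 1) E := mem_badSets.2 ⟨hS, hlen⟩
    rw [decide_eq_true (Or.inl hbad)]
    exact (Computes.pure true).mono (Nat.zero_le _)
  · rw [if_neg hlen]
    have hval : (List.range T).any (fun ℓ => ω (.set (r + 1) (j * T + (ℓ + 1)) S) &&
        isHeavy a T (r + 1) ((partList I ω (r + 1) S E).filter
          fun e => decide (e ∈ iterFree I a T ω r j ℓ)).length) =
        decide (S ∈ badSets I a T ω (r + 1) E ∨
          ∃ ℓ ∈ Finset.range T, S ∈ addedSets I a T ω r j ℓ) := by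
      rw [Bool.eq_iff_iff]
      simp only [List.any_eq_true, List.mem_range, Bool.and_eq_true, decide_eq_true_eq,
        Finset.mem_range]
      have hnb : S ∉ badSets I a T ω (r + 1) E := fun h => by
        rw [length_partList hS] at hlen
        exact hlen (mem_badSets.1 h).2
      simp only [hnb, false_or]
      refine exists_congr fun ℓ => and_congr_right fun _ => ?_
      rw [isHeavy_eq (length_filter_partList hS (iterFree_subset_phaseFree r j ℓ)),
        decide_eq_true_eq, mem_addedSets]
      simp [hS]
    rw [← hval]
    refine (Computes.anyList (n := 0 + logTen a T * iterCost a T Q T)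
      fun ℓ hℓ => ?_).mono (by rw [List.length_range, Nat.zero_add])
    rw [List.mem_range] at hℓ
    have hcoin : Computes I τ (Proc.coin a T (.set (r + 1) (j * T + (ℓ + 1)) S))
      (ω (.set (r + 1) (j * T + (ℓ + 1)) S)) 0 := by
      rw [hω]
      exact Computes.coin a T _
    refine hcoin.andThen fun _ => ?_
    refine ((Computes.filterList fun f hf => ?_).map
      fun l' => isHeavy a T (r + 1) l'.length).mono
        (Nat.mul_le_mul (not_le.1 hlen).le (iterCost_mono a T Q hℓ.le))
    exact computes_iterProc hb hω hfree hℓ.le f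
      (I.elemsOf_subset S hS f (mem_partList.1 hf).1.1)

end Correctness


/-! ### Simulating the algorithm -/

section Simulation

open Proc

variable (a T : ℕ)

/-- Is an element free after `j` phases of stage `r + 1`, given a procedure for the beginning of the
stage? -/
noncomputable def phaseProc (r : ℕ) (start : ℕ → Proc Bool) : ℕ → ℕ → Proc Bool
  | 0 => start
  | j + 1 => iterProc a T (r + 1) (phaseProc r start j) j T

/-- Is an element free after `r` stages? -/
noncomputable def stageProc : ℕ → ℕ → Proc Bool
  | 0 => fun _ => .pure true
  | r + 1 => phaseProc a T r (stageProc r) T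

/-- Is `S` added in some stage? -/
noncomputable def loopProc (S : ℕ) : Proc Bool :=
  anyList (fun r => anyList (fun j =>
    joinProc a T (r + 1) (phaseProc a T r (stageProc a T r) j) j S) (List.range T)) (List.range a)

/-- Is `S` the set of smallest ID containing some element that the stages leave uncovered? -/
noncomputable def cleanUpProc (S : ℕ) : Proc Bool :=
  (Proc.elems (2 ^ a) S).bind (anyList fun e => (Proc.sets (2 ^ (T ^ 2)) e).bind fun l =>
    (anyList (loopProc a T) l).map fun b => !b && l.all fun S' => decide (S ≤ S'))

/-- Is `S` returned by the algorithm? -/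
noncomputable def coverProc (S : ℕ) : Proc Bool :=
  (loopProc a T S).bind fun b => (cleanUpProc a T S).map fun b' => b || b'

/-- A bound for the number of queries needed to decide whether an element is free after `n`
phases. -/
def phaseCost : ℕ → ℕ
  | 0 => 0
  | n + 1 => iterCost a T (phaseCost n) T

/-- A bound for the number of queries of `loopProc`. -/
def loopCost : ℕ :=
  a * (T * ((2 ^ a + 2 ^ a * phaseCost a T (a * T)) + T * (logTen a T * phaseCost a T (a * T))))

/-- A bound for the number of queries of `coverProc`. -/
def coverCost : ℕ :=
  loopCost a T + (2 ^ a + 2 ^ a * (2 ^ (T ^ 2) + 2 ^ (T ^ 2) * loopCost a T))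

end Simulation

theorem le_iterCost_zero (a T Q : ℕ) : Q ≤ iterCost a T Q 0 := Nat.le_add_right _ _

theorem phaseCost_mono (a T : ℕ) : Monotone (phaseCost a T) :=
  monotone_nat_of_le_succ fun _ =>
    (le_iterCost_zero a T _).trans (iterCost_mono a T _ (Nat.zero_le T))

/-! ### Correctness of the simulation across phases, stages and the clean-up. -/

section Correctness

open Proc

variable {I : SetSystem} {a T : ℕ} {τ : Tape} {ω : Samples}

theorem computes_phaseProc (hb : I.Bounded (2 ^ a) (2 ^ (T ^ 2))) (hω : ω = decodeTape a T τ)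
    {r n : ℕ} {start : ℕ → Proc Bool}
    (hstart : ∀ e ∈ I.elts, Computes I τ (start e)
      (decide (e ∈ phaseFree I a T ω r 0)) (phaseCost a T n)) (j : ℕ) :
    ∀ e ∈ I.elts, Computes I τ (phaseProc a T r start j e)
      (decide (e ∈ phaseFree I a T ω r j)) (phaseCost a T (n + j)) := by
  induction j with
  | zero => exact hstart
  | succ j ih =>
    intro e he
    have h := computes_iterProc hb hω ih le_rfl e he
    rw [phaseFree, phaseState_succ]
    exact h

theorem computes_stageProc (hb : I.Bounded (2 ^ a) (2 ^ (T ^ 2))) (hω : ω = decodeTape a T τ)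
    (r : ℕ) : ∀ e ∈ I.elts, Computes I τ (stageProc a T r e)
      (decide (e ∈ phaseFree I a T ω r 0)) (phaseCost a T (r * T)) := by
  induction r with
  | zero =>
    intro e he
    -- Initially every element is free, so the constant answer needs no query.
    have hmem : e ∈ phaseFree I a T ω 0 0 := by
      rw [phaseFree, mem_free]
      exact ⟨⟨he, fun S hS => absurd hS (Finset.notMem_empty S)⟩, Finset.notMem_empty e⟩
    rw [decide_eq_true hmem]
    exact (Computes.pure true).mono (Nat.zero_le _)
  | succ r ih =>
    intro e he
    rw [phaseFree, phaseState_zero, stateBefore_succ, Nat.succ_mul]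
    exact computes_phaseProc hb hω ih T e he

theorem exists_mem_range_succ {p : ℕ → Prop} {n : ℕ} :
    (∃ m ∈ Finset.range (n + 1), p m) ↔ (∃ m ∈ Finset.range n, p m) ∨ p n := by
  rw [Finset.range_add_one, Finset.exists_mem_insert, or_comm]

theorem mem_iterState_cover {r j ℓ S : ℕ} : S ∈ (iterState I a T ω r j ℓ).cover ↔
    S ∈ (phaseState I a T ω r j).cover ∨
      S ∈ badSets I a T ω (r + 1) (phaseFree I a T ω r j) ∨
      ∃ m ∈ Finset.range ℓ, S ∈ addedSets I a T ω r j m := by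
  induction ℓ with
  | zero => rw [iterState_zero_cover]; simp
  | succ ℓ ih =>
    rw [iterState_succ, Finset.mem_union, ih, exists_mem_range_succ]
    exact or_assoc.trans (or_congr_right or_assoc)

theorem mem_phaseState_cover {r j S : ℕ} : S ∈ (phaseState I a T ω r j).cover ↔
    S ∈ (stateBefore I a T ω r).cover ∨ ∃ m ∈ Finset.range j,
      S ∈ badSets I a T ω (r + 1) (phaseFree I a T ω r m) ∨
      ∃ ℓ ∈ Finset.range T, S ∈ addedSets I a T ω r m ℓ := by
  induction j with
  | zero => rw [phaseState_zero]; simp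
  | succ j ih =>
    rw [phaseState_succ, mem_iterState_cover, ih, exists_mem_range_succ]
    exact or_assoc

theorem mem_stateBefore_cover {r S : ℕ} : S ∈ (stateBefore I a T ω r).cover ↔
    ∃ m ∈ Finset.range r, ∃ j ∈ Finset.range T,
      S ∈ badSets I a T ω (m + 1) (phaseFree I a T ω m j) ∨
      ∃ ℓ ∈ Finset.range T, S ∈ addedSets I a T ω m j ℓ := by
  induction r with
  | zero => simp [stateBefore]
  | succ r ih =>
    rw [stateBefore_succ, mem_phaseState_cover, ih, exists_mem_range_succ]

theorem computes_loopProc (hb : I.Bounded (2 ^ a) (2 ^ (T ^ 2))) (hω : ω = decodeTape a T τ)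
    {S : ℕ} (hS : S ∈ I.sets) :
    Computes I τ (loopProc a T S) (decide (S ∈ (mainLoop I a T ω).cover)) (loopCost a T) := by
  have hjoin : ∀ r ∈ List.range a, ∀ j ∈ List.range T, Computes I τ
      (joinProc a T (r + 1) (phaseProc a T r (stageProc a T r) j) j S)
      (decide (S ∈ badSets I a T ω (r + 1) (phaseFree I a T ω r j) ∨
        ∃ ℓ ∈ Finset.range T, S ∈ addedSets I a T ω r j ℓ))
      ((2 ^ a + 2 ^ a * phaseCost a T (a * T)) +
        T * (logTen a T * phaseCost a T (a * T))) := by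
    intro r hr j hj
    rw [List.mem_range] at hr hj
    -- Phases are numbered consecutively through the stages, so monotonicity replaces every cost by
    -- that of all aT phases.
    have hn : r * T + j + 1 ≤ a * T := by
      calc r * T + j + 1 ≤ (r + 1) * T := by rw [Nat.succ_mul]; omega
        _ ≤ a * T := Nat.mul_le_mul_right _ hr
    have h := computes_joinProc hb hω (computes_phaseProc hb hω (computes_stageProc hb hω r) j) hS
    refine h.mono (Nat.add_le_add (Nat.add_le_add_left (Nat.mul_le_mul_left _ ?_) _)
      (Nat.mul_le_mul_left _ (Nat.mul_le_mul_left _ ?_)))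
    · exact phaseCost_mono a T (by omega)
    · exact phaseCost_mono a T hn
  have h := Computes.anyList fun r hr => Computes.anyList (hjoin r hr)
  rw [List.length_range, List.length_range] at h
  have hval : ((List.range a).any fun r => (List.range T).any fun j =>
      decide (S ∈ badSets I a T ω (r + 1) (phaseFree I a T ω r j) ∨
        ∃ ℓ ∈ Finset.range T, S ∈ addedSets I a T ω r j ℓ)) =
      decide (S ∈ (mainLoop I a T ω).cover) := by
    rw [Bool.eq_iff_iff, decide_eq_true_eq, mainLoop_eq, mem_stateBefore_cover]
    simp only [List.any_eq_true, List.mem_range, Finset.mem_range, decide_eq_true_eq]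
  rw [hval] at h
  exact h

theorem computes_cleanUpProc (hb : I.Bounded (2 ^ a) (2 ^ (T ^ 2))) (hω : ω = decodeTape a T τ)
    {S : ℕ} (hS : S ∈ I.sets) :
    Computes I τ (cleanUpProc a T S) (decide (S ∈ cleanUp I (mainLoop I a T ω).cover))
      (2 ^ a + 2 ^ a * (2 ^ (T ^ 2) + 2 ^ (T ^ 2) * loopCost a T)) := by
  have h1 : ∀ e ∈ I.elemsOf S, Computes I τ ((Proc.sets (2 ^ (T ^ 2)) e).bind fun l =>
      (anyList (loopProc a T) l).map fun b => !b && l.all fun S' => decide (S ≤ S'))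
      (!((I.setsOf e).any fun S' => decide (S' ∈ (mainLoop I a T ω).cover)) &&
        (I.setsOf e).all fun S' => decide (S ≤ S'))
      (2 ^ (T ^ 2) + 2 ^ (T ^ 2) * loopCost a T) := by
    intro e he
    have he' := I.elemsOf_subset S hS e he
    refine ((Computes.sets hb he').bind ((Computes.anyList fun S' hS' => ?_).map
      fun b => !b && (I.setsOf e).all fun S' => decide (S ≤ S'))).mono
        (Nat.add_le_add_left (Nat.mul_le_mul_right _ (hb.2 e he')) _)
    exact computes_loopProc hb hω (I.setsOf_subset e he' S' hS')
  have h := ((Computes.elems hb hS).bind (Computes.anyList h1)).mono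
    (Nat.add_le_add_left (Nat.mul_le_mul_right _ (hb.1 S hS)) _)
  have hval : ((I.elemsOf S).any fun e =>
      (!((I.setsOf e).any fun S' => decide (S' ∈ (mainLoop I a T ω).cover)) &&
        (I.setsOf e).all fun S' => decide (S ≤ S'))) =
      decide (S ∈ cleanUp I (mainLoop I a T ω).cover) := by
    have hsub : (mainLoop I a T ω).cover ⊆ I.sets := by
      rw [mainLoop_eq]
      exact stateBefore_cover_subset_sets a
    rw [Bool.eq_iff_iff, decide_eq_true_eq, cleanUp, Finset.mem_filter]
    simp only [List.any_eq_true, Bool.and_eq_true, Bool.not_eq_true', List.any_eq_false,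
      List.all_eq_true, decide_eq_true_eq, SetSystem.uncovered, Finset.mem_filter]
    constructor
    · rintro ⟨e, he, h2, h3⟩
      have he' := I.elemsOf_subset S hS e he
      exact ⟨hS, e, ⟨he', fun S' hS' heS' => h2 S' ((I.mem_iff S' (hsub hS') e he').1 heS') hS'⟩,
        he, fun S' hS' heS' => h3 S' ((I.mem_iff S' hS' e he').1 heS')⟩
    · rintro ⟨_, e, ⟨he', h2⟩, he, h3⟩
      refine ⟨e, he, fun S' hS' hc => ?_, fun S' hS' => ?_⟩
      · exact h2 S' hc ((I.mem_iff S' (hsub hc) e he').2 hS')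
      · have hS'' := I.setsOf_subset e he' S' hS'
        exact h3 S' hS'' ((I.mem_iff S' hS'' e he').2 hS')
  rw [hval] at h
  exact h

theorem computes_coverProc (hb : I.Bounded (2 ^ a) (2 ^ (T ^ 2))) {S : ℕ} (hS : S ∈ I.sets) :
    Computes I τ (coverProc a T S) (decide (S ∈ phasedCover I a T (decodeTape a T τ)))
      (coverCost a T) := by
  have h := (computes_loopProc (τ := τ) hb rfl hS).bind
    (f := fun b => (cleanUpProc a T S).map fun b' => b || b')
    ((computes_cleanUpProc (τ := τ) hb rfl hS).map fun b' =>
      decide (S ∈ (mainLoop I a T (decodeTape a T τ)).cover) || b')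
  rw [phasedCover]
  simp only [Finset.mem_union, Bool.decide_or]
  exact h

end Correctness

/-! ### The LCA -/

/-- The LCA that simulates the algorithm. -/
noncomputable def phasedLCA (a T : ℕ) : LCA := fun S => (coverProc a T S).toProcedure

theorem cover_phasedLCA {I : SetSystem} {a T : ℕ} (hb : I.Bounded (2 ^ a) (2 ^ (T ^ 2)))
    (τ : Tape) : (phasedLCA a T).cover I τ = phasedCover I a T (decodeTape a T τ) := by
  ext S
  rw [LCA.cover, Finset.mem_filter]
  constructor
  · rintro ⟨hS, h⟩
    rw [phasedLCA, Proc.output_toProcedure, (computes_coverProc hb hS).1] at h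
    exact of_decide_eq_true h
  · intro h
    have hS := (isSetCover_phasedCover I a T _).1 h
    refine ⟨hS, ?_⟩
    rw [phasedLCA, Proc.output_toProcedure, (computes_coverProc hb hS).1]
    exact decide_eq_true h

theorem queries_phasedLCA_le {I : SetSystem} {a T : ℕ} (hb : I.Bounded (2 ^ a) (2 ^ (T ^ 2)))
    (τ : Tape) {S : ℕ} (hS : S ∈ I.sets) :
    (phasedLCA a T S).queries I τ ≤ coverCost a T := by
  rw [phasedLCA, Proc.queries_toProcedure]
  exact (computes_coverProc hb hS).2


/-! ### The query complexity -/

/-- The factor by which one phase increases the bound on the number of queries. -/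
def phaseFactor (a T : ℕ) : ℕ :=
  (3 * (logTen a T ^ 2 * 2 ^ T)) ^ T * (8 * T * logTen a T * 2 ^ T) * 2 ^ (a + T ^ 2)

theorem logTen_pos {a T : ℕ} (ha : 0 < a) (hT : 0 < T) : 0 < logTen a T := by
  unfold logTen
  positivity

/-- The cost satisfies an affine recursion. Adding the multiple 3N·2^T·K of K = st(Q+1) absorbs the
inhomogeneous part and leaves a geometric one with ratio 3N²·2^T. -/
theorem iterCost_add_le {a T : ℕ} (ha : 0 < a) (hT : 0 < T) (Q ℓ : ℕ) :
    iterCost a T Q ℓ + 3 * logTen a T * 2 ^ T * (2 ^ (a + T ^ 2) * (Q + 1)) ≤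
      (3 * (logTen a T ^ 2 * 2 ^ T)) ^ ℓ *
        ((8 * T * logTen a T * 2 ^ T) * (2 ^ (a + T ^ 2) * (Q + 1))) := by
  have hN : 1 ≤ logTen a T := logTen_pos ha hT
  have hP : 2 ≤ 2 ^ T := by
    calc 2 = 2 ^ 1 := rfl
      _ ≤ 2 ^ T := Nat.pow_le_pow_right (by norm_num) hT
  set N := logTen a T
  set P := 2 ^ T
  set K := 2 ^ (a + T ^ 2) * (Q + 1) with hK
  have hs : 1 ≤ 2 ^ a := Nat.one_le_two_pow
  have ht : 1 ≤ 2 ^ (T ^ 2) := Nat.one_le_two_pow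
  have hM : 2 ^ (a + T ^ 2) = 2 ^ (T ^ 2) * 2 ^ a := by rw [pow_add, mul_comm]
  have hQK : Q + 1 ≤ K := Nat.le_mul_of_pos_left _ (by positivity)
  have htK : 2 ^ (T ^ 2) ≤ K := by
    rw [hK, hM, mul_assoc]
    exact Nat.le_mul_of_pos_right _ (by positivity)
  have hsK : 2 ^ a + 2 ^ a * Q ≤ K := by
    rw [hK, hM, mul_assoc]
    calc 2 ^ a + 2 ^ a * Q = 2 ^ a * (Q + 1) := by ring
      _ ≤ _ := Nat.le_mul_of_pos_left _ (by positivity)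
  have hstK : 2 ^ (T ^ 2) * (2 ^ a + 2 ^ a * Q) = K := by
    rw [hK, hM]
    ring
  have hNP : 1 ≤ N * P := Nat.mul_pos hN (by omega)
  induction ℓ with
  | zero =>
    rw [iterCost, hstK, pow_zero, one_mul]
    have hX : 2 ^ (T ^ 2) + K ≤ 2 * K := by omega
    have hTX : T * (2 ^ (T ^ 2) + K) ≤ T * (2 * K) := Nat.mul_le_mul_left _ hX
    have hTK : K ≤ T * K := Nat.le_mul_of_pos_left _ hT
    have h1 : T * K ≤ T * (N * P) * K :=
      Nat.mul_le_mul_right _ (Nat.le_mul_of_pos_right _ hNP)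
    have h2 : N * P * K ≤ T * (N * P) * K :=
      Nat.mul_le_mul_right _ (Nat.le_mul_of_pos_left _ hT)
    nlinarith
  | succ ℓ ih =>
    rw [iterCost, hstK]
    set R := iterCost a T Q ℓ
    set D := 3 * N * P * K with hD
    have hA : 2 ≤ N ^ 2 * P := hP.trans (Nat.le_mul_of_pos_left _ (pow_pos hN 2))
    have h1 : N * P * (2 ^ a + 2 ^ a * Q + N * R) ≤ N * P * (K + N * R) :=
      Nat.mul_le_mul_left _ (Nat.add_le_add_right hsK _)
    have h2 : K ≤ N * P * K := Nat.le_mul_of_pos_left _ hNP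
    have h3 : R + (2 ^ (T ^ 2) + K + N * P * (2 ^ a + 2 ^ a * Q + N * R)) + D ≤
        3 * (N ^ 2 * P) * (R + D) := by
      have e1 : N * P * (K + N * R) = N * P * K + N ^ 2 * P * R := by ring
      have e2 : 2 * (R + D) ≤ N ^ 2 * P * (R + D) := Nat.mul_le_mul_right _ hA
      have e3 : D = 3 * (N * P * K) := by rw [hD]; ring
      nlinarith
    calc _ ≤ 3 * (N ^ 2 * P) * (R + D) := h3
      _ ≤ 3 * (N ^ 2 * P) * _ := Nat.mul_le_mul_left _ ih
      _ = _ := by ring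

/-- The summand 1 matches the `Q + 1` in the bound for one phase and makes the recursion purely
multiplicative. -/
theorem phaseCost_add_one_le {a T : ℕ} (ha : 0 < a) (hT : 0 < T) (n : ℕ) :
    phaseCost a T n + 1 ≤ phaseFactor a T ^ n := by
  induction n with
  | zero => simp [phaseCost]
  | succ n ih =>
    have h := iterCost_add_le ha hT (phaseCost a T n) T
    have hN := logTen_pos ha hT
    have h1 : 1 ≤ 3 * logTen a T * 2 ^ T * (2 ^ (a + T ^ 2) * (phaseCost a T n + 1)) :=
      Nat.succ_le_of_lt (by positivity)
    calc phaseCost a T (n + 1) + 1 ≤ _ := (Nat.add_le_add_left h1 _).trans h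
      _ = phaseFactor a T * (phaseCost a T n + 1) := by rw [phaseFactor]; ring
      _ ≤ phaseFactor a T * phaseFactor a T ^ n := Nat.mul_le_mul_left _ ih
      _ = _ := by rw [pow_succ, mul_comm]

theorem coverCost_le {a T : ℕ} (ha : 0 < a) (hT : 0 < T) :
    coverCost a T ≤ phaseFactor a T ^ (4 * (a * T)) := by
  have hY := phaseCost_add_one_le ha hT (a * T)
  set Y := phaseFactor a T ^ (a * T)
  have hN := logTen_pos ha hT
  set Z := phaseFactor a T with hZ
  have hZle : 8 * logTen a T * 2 ^ (a + T ^ 2) ≤ Z := by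
    rw [hZ, phaseFactor]
    refine Nat.mul_le_mul_right _ ?_
    calc 8 * logTen a T ≤ 8 * T * logTen a T * 2 ^ T := by
          have h1 : 1 ≤ T * 2 ^ T := Nat.succ_le_of_lt (by positivity)
          calc 8 * logTen a T = 8 * logTen a T * 1 := (mul_one _).symm
            _ ≤ 8 * logTen a T * (T * 2 ^ T) := Nat.mul_le_mul_left _ h1
            _ = _ := by ring
      _ ≤ _ := Nat.le_mul_of_pos_left _ (by positivity)
  have hlog : a * T ^ 2 ≤ logTen a T := by
    rw [logTen]
    exact Nat.mul_le_mul (Nat.le_self_pow (by norm_num) a) (Nat.le_self_pow (by norm_num) _)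
  have hM : 2 ^ (a + T ^ 2) = 2 ^ a * 2 ^ (T ^ 2) := pow_add _ _ _
  set N := logTen a T
  have hs : 1 ≤ 2 ^ a := Nat.one_le_two_pow
  have ht : 1 ≤ 2 ^ (T ^ 2) := Nat.one_le_two_pow
  set M := 2 ^ (a + T ^ 2)
  have hsM : 2 ^ a ≤ M := by rw [hM]; exact Nat.le_mul_of_pos_right _ (by positivity)
  have hM1 : 1 ≤ M := hs.trans hsM
  have hY1 : 1 ≤ Y := (Nat.le_add_left 1 _).trans hY
  have hloop : loopCost a T ≤ 2 * N * N * M * Y := by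
    calc loopCost a T
        = a * T * (2 ^ a * (phaseCost a T (a * T) + 1)) +
            (a * T ^ 2) * N * phaseCost a T (a * T) := by rw [loopCost]; ring
      _ ≤ N * (M * Y) + N * N * Y := by
          refine Nat.add_le_add ?_ (Nat.mul_le_mul (Nat.mul_le_mul_right _ hlog) (by omega))
          refine Nat.mul_le_mul (le_trans ?_ hlog) (Nat.mul_le_mul hsM hY)
          exact Nat.mul_le_mul_left _ (Nat.le_self_pow (by norm_num) _)
      _ ≤ N * N * (M * Y) + N * N * (M * Y) :=
          Nat.add_le_add (Nat.mul_le_mul_right _ (Nat.le_mul_of_pos_left _ hN))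
            (Nat.mul_le_mul_left _ (Nat.le_mul_of_pos_left _ hM1))
      _ = _ := by ring
  have hZ1 : 1 ≤ Z := le_trans (Nat.succ_le_of_lt (by positivity)) hZle
  set W := 2 * N * N * M * Y
  have hW : 1 ≤ W := Nat.succ_le_of_lt (by positivity)
  have hMW : W ≤ M * W := Nat.le_mul_of_pos_left _ hM1
  have hMW' : M ≤ M * W := Nat.le_mul_of_pos_right _ hW
  calc coverCost a T = loopCost a T + 2 ^ a + M + M * loopCost a T := by
        rw [coverCost, hM]; ring
    _ ≤ W + M + M + M * W := by
        have := Nat.mul_le_mul_left M hloop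
        omega
    _ ≤ 4 * M * W := by
        rw [mul_assoc]
        omega
    _ = (8 * N * M) * (N * M) * Y := by ring
    _ ≤ Z * Z * Y := by
        refine Nat.mul_le_mul_right _ (Nat.mul_le_mul hZle (le_trans ?_ hZle))
        rw [mul_assoc]
        exact Nat.le_mul_of_pos_left _ (by norm_num)
    _ = Z ^ (2 + a * T) := by rw [pow_add]; ring
    _ ≤ Z ^ (4 * (a * T)) := by
        -- 2 + aT ≤ 4aT, as aT ≥ 1.
        refine Nat.pow_le_pow_right hZ1 ?_
        have : 1 ≤ a * T := Nat.mul_pos ha hT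
        omega

theorem sq_succ_le_four_mul_two_pow (n : ℕ) : (n + 1) ^ 2 ≤ 4 * 2 ^ n := by
  induction n with
  | zero => norm_num
  | succ n ih =>
    rcases n with _ | _ | n
    · norm_num
    · norm_num
    · have h : 2 ^ (n + 2 + 1) = 2 ^ (n + 1 + 1) * 2 := pow_succ 2 (n + 2)
      have h' : (n + 1 + 1 + 1 + 1) ^ 2 ≤ (n + 1 + 1 + 1) ^ 2 * 2 := by
        nlinarith [Nat.zero_le (n * n)]
      rw [h, ← mul_assoc]
      exact h'.trans (Nat.mul_le_mul_right 2 ih)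

/-- Here T·log a ≤ (log a)² + T², and (log a)² = O(a). So the polylogarithmic factors, even raised
to the power T, stay polynomial in st. -/
theorem pow_le_two_pow_add {a T : ℕ} (ha : 0 < a) : a ^ T ≤ 2 ^ (4 * a + T ^ 2) := by
  have h1 : a ≤ 2 ^ (Nat.log 2 a + 1) := (Nat.lt_pow_succ_log_self (by norm_num) a).le
  have h2 : (Nat.log 2 a + 1) ^ 2 ≤ 4 * a :=
    (sq_succ_le_four_mul_two_pow _).trans
      (Nat.mul_le_mul_left _ (Nat.pow_log_le_self 2 ha.ne'))
  set L := Nat.log 2 a + 1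
  calc a ^ T ≤ (2 ^ L) ^ T := Nat.pow_le_pow_left h1 T
    _ = 2 ^ (L * T) := (pow_mul _ _ _).symm
    _ ≤ 2 ^ (4 * a + T ^ 2) := by
      refine Nat.pow_le_pow_right (by norm_num) ?_
      have : L * T ≤ L ^ 2 + T ^ 2 := by
        rcases le_total L T with h | h
        · exact (Nat.mul_le_mul_right _ h).trans (by rw [sq T]; exact Nat.le_add_left _ _)
        · exact (Nat.mul_le_mul_left _ h).trans (by rw [sq L]; exact Nat.le_add_right _ _)
      omega

/-- The decisive factor is (2^T)^T = 2^(T²), the bound on the degree. All other factors are powers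
of `a` and `T`, at most T-th powers up to constants, or single exponentials. -/
theorem phaseFactor_le {a T : ℕ} (ha : 0 < a) :
    phaseFactor a T ≤ (2 ^ (a + T ^ 2)) ^ 160 := by
  set M := 2 ^ (a + T ^ 2) with hM
  have hTT : T ≤ T ^ 2 := Nat.le_self_pow (by norm_num) T
  have hpow : ∀ {m n : ℕ}, m ≤ n * (a + T ^ 2) → 2 ^ m ≤ M ^ n := by
    intro m n h
    rw [hM, ← pow_mul, mul_comm]
    exact Nat.pow_le_pow_right (by norm_num) h
  have hM2 : 2 ≤ M := by
    have := hpow (m := 1) (n := 1) (by omega)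
    simpa using this
  have haT : a ^ T ≤ M ^ 4 := (pow_le_two_pow_add ha).trans (hpow (by omega))
  have hTle : T ≤ 2 ^ T := Nat.lt_two_pow_self.le
  have hTpow : T ^ T ≤ M := by
    calc T ^ T ≤ (2 ^ T) ^ T := Nat.pow_le_pow_left hTle T
      _ = 2 ^ (T ^ 2) := by rw [← pow_mul, sq]
      _ ≤ M ^ 1 := hpow (by omega)
      _ = M := pow_one M
  have h2T : 2 ^ T ≤ M := by simpa using hpow (m := T) (n := 1) (by omega)
  have haM : a ≤ M := Nat.lt_two_pow_self.le.trans (by simpa using hpow (m := a) (n := 1) (by omega))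
  have hTM : T ≤ M := hTle.trans h2T
  have hN : logTen a T ≤ M ^ 30 := by
    calc logTen a T = a ^ 10 * T ^ 20 := by rw [logTen]; ring
      _ ≤ M ^ 10 * M ^ 20 := Nat.mul_le_mul (Nat.pow_le_pow_left haM _) (Nat.pow_le_pow_left hTM _)
      _ = M ^ 30 := by rw [← pow_add]
  have h1 : (3 * (logTen a T ^ 2 * 2 ^ T)) ^ T ≤ M ^ 123 := by
    calc (3 * (logTen a T ^ 2 * 2 ^ T)) ^ T
        = 3 ^ T * ((a ^ T) ^ 20 * (T ^ T) ^ 40) * 2 ^ (T ^ 2) := by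
          have e : logTen a T ^ 2 = a ^ 20 * T ^ 40 := by rw [logTen]; ring
          rw [e, mul_pow, mul_pow, mul_pow, ← pow_mul, ← pow_mul, ← pow_mul, ← pow_mul, ← pow_mul,
            sq T, mul_comm 20 T, mul_comm 40 T]
          ring
      _ ≤ M ^ 2 * ((M ^ 4) ^ 20 * M ^ 40) * M ^ 1 := by
          refine Nat.mul_le_mul (Nat.mul_le_mul ?_ (Nat.mul_le_mul (Nat.pow_le_pow_left haT _)
            (Nat.pow_le_pow_left hTpow _))) (hpow (by omega))
          calc 3 ^ T ≤ (2 ^ 2) ^ T := Nat.pow_le_pow_left (by norm_num) T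
            _ = 2 ^ (2 * T) := (pow_mul _ _ _).symm
            _ ≤ M ^ 2 := hpow (by omega)
      _ = M ^ 123 := by ring
  have h2 : 8 * T * logTen a T * 2 ^ T ≤ M ^ 35 := by
    calc 8 * T * logTen a T * 2 ^ T ≤ M ^ 3 * M * M ^ 30 * M := by
          refine Nat.mul_le_mul (Nat.mul_le_mul (Nat.mul_le_mul ?_ hTM) hN) h2T
          calc 8 = 2 ^ 3 := rfl
            _ ≤ M ^ 3 := Nat.pow_le_pow_left hM2 3
      _ = M ^ 35 := by ring
  calc phaseFactor a T ≤ M ^ 123 * M ^ 35 * M := Nat.mul_le_mul (Nat.mul_le_mul h1 h2) le_rfl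
    _ = M ^ 159 := by ring
    _ ≤ M ^ 160 := Nat.pow_le_pow_right (by omega) (by norm_num)

/-! ### Rounding the parameters -/

theorem SetSystem.Bounded.mono {I : SetSystem} {s t s' t' : ℕ} (h : I.Bounded s t) (hs : s ≤ s')
    (ht : t ≤ t') : I.Bounded s' t' :=
  ⟨fun S hS => (h.1 S hS).trans hs, fun e he => (h.2 e he).trans ht⟩

theorem numStages_pos {s : ℕ} (hs : 2 ≤ s) : 0 < numStages s :=
  Nat.clog_pos (by norm_num) hs

theorem le_two_pow_numStages (s : ℕ) : s ≤ 2 ^ numStages s := Nat.le_pow_clog (by norm_num) s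

theorem two_pow_numStages_le {s : ℕ} (hs : 2 ≤ s) : 2 ^ numStages s ≤ s ^ 2 := by
  have h := Nat.pow_pred_clog_lt_self (b := 2) (by norm_num) (x := s) (by omega)
  have hpos := numStages_pos hs
  have e : numStages s = (Nat.clog 2 s).pred + 1 := (Nat.succ_pred_eq_of_pos hpos).symm
  rw [e, pow_succ, sq]
  exact Nat.mul_le_mul h.le hs

theorem one_le_logb_two {n : ℕ} (hn : 2 ≤ n) : 1 ≤ Real.logb 2 n := by
  rw [Real.le_logb_iff_rpow_le (by norm_num) (by positivity)]
  simpa using (by exact_mod_cast hn : (2 : ℝ) ≤ n)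

theorem numStages_le {s : ℕ} (hs : 2 ≤ s) : (numStages s : ℝ) ≤ 2 * Real.logb 2 s := by
  have h : ((2 : ℝ) ^ numStages s) ≤ (s : ℝ) ^ 2 := by exact_mod_cast two_pow_numStages_le hs
  have h2 := Real.logb_le_logb_of_le (b := 2) (by norm_num) (by positivity) h
  rw [Real.logb_pow, Real.logb_pow] at h2
  simpa using h2

theorem one_le_sqrt_logb_two {t : ℕ} (ht : 2 ≤ t) : 1 ≤ √(Real.logb 2 t) :=
  Real.one_le_sqrt.2 (one_le_logb_two ht)

theorem phaseLength_pos {t : ℕ} (ht : 2 ≤ t) : 0 < phaseLength t :=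
  Nat.ceil_pos.2 (lt_of_lt_of_le one_pos (one_le_sqrt_logb_two ht))

theorem phaseLength_le {t : ℕ} (ht : 2 ≤ t) : (phaseLength t : ℝ) ≤ 2 * √(Real.logb 2 t) := by
  have h := Nat.ceil_lt_add_one (Real.sqrt_nonneg (Real.logb 2 t))
  have h1 := one_le_sqrt_logb_two ht
  rw [phaseLength]
  linarith

theorem le_two_pow_phaseLength {t : ℕ} (ht : 2 ≤ t) : t ≤ 2 ^ (phaseLength t ^ 2) := by
  have h0 : (0 : ℝ) < t := by positivity
  have h1 : Real.logb 2 t ≤ (phaseLength t : ℝ) ^ 2 := Real.sqrt_le_left (by positivity) |>.1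
    (Nat.le_ceil _)
  rw [Real.logb_le_iff_le_rpow (by norm_num) h0] at h1
  exact_mod_cast h1

/-- Rounding at most doubles √(log t), so log t grows by a factor of at most 4. -/
theorem two_pow_phaseLength_le {t : ℕ} (ht : 2 ≤ t) : 2 ^ (phaseLength t ^ 2) ≤ t ^ 4 := by
  have h0 : (0 : ℝ) < t := by positivity
  have hL := one_le_logb_two ht
  have h1 : (phaseLength t : ℝ) ^ 2 ≤ Real.logb 2 ((t : ℝ) ^ 4) := by
    rw [Real.logb_pow]
    calc (phaseLength t : ℝ) ^ 2 ≤ (2 * √(Real.logb 2 t)) ^ 2 :=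
          pow_le_pow_left₀ (by positivity) (phaseLength_le ht) 2
      _ = 4 * Real.logb 2 t := by
          rw [mul_pow, Real.sq_sqrt (by linarith)]
          norm_num
      _ = _ := by norm_num
  rw [Real.le_logb_iff_rpow_le (by norm_num) (by positivity)] at h1
  exact_mod_cast h1

/-- The constant is 4·160·4·4: the rounded st is at most (st)^4, a phase costs a 160th power, the
exponent is 4aT, and rounding gives aT ≤ 4·log s·√(log t). -/
theorem coverCost_le_rpow {s t : ℕ} (hs : 2 ≤ s) (ht : 2 ≤ t) :
    (coverCost (numStages s) (phaseLength t) : ℝ) ≤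
      ((s : ℝ) * t) ^ (10240 * Real.logb 2 s * √(Real.logb 2 t)) := by
  have ha := numStages_pos hs
  have hT := phaseLength_pos ht
  have hle := numStages_le hs
  have hle' := phaseLength_le ht
  have hM : 2 ^ (numStages s + phaseLength t ^ 2) ≤ (s * t) ^ 4 := by
    rw [pow_add, mul_pow]
    exact Nat.mul_le_mul ((two_pow_numStages_le hs).trans
      (Nat.pow_le_pow_right (by omega) (by norm_num))) (two_pow_phaseLength_le ht)
  have h : coverCost (numStages s) (phaseLength t) ≤
      (s * t) ^ (2560 * (numStages s * phaseLength t)) := by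
    calc coverCost (numStages s) (phaseLength t)
        ≤ (((2 ^ (numStages s + phaseLength t ^ 2)) ^ 160)) ^
            (4 * (numStages s * phaseLength t)) :=
          (coverCost_le ha hT).trans (Nat.pow_le_pow_left (phaseFactor_le ha) _)
      _ ≤ (((s * t) ^ 4) ^ 160) ^ (4 * (numStages s * phaseLength t)) :=
          Nat.pow_le_pow_left (Nat.pow_le_pow_left hM _) _
      _ = _ := by rw [← pow_mul, ← pow_mul]; congr 1; ring
  have hst : (1 : ℝ) ≤ (s : ℝ) * t := by
    exact_mod_cast Nat.mul_pos (by omega : 0 < s) (by omega : 0 < t)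
  calc (coverCost (numStages s) (phaseLength t) : ℝ)
      ≤ ((s : ℝ) * t) ^ (2560 * (numStages s * phaseLength t)) := by exact_mod_cast h
    _ = ((s : ℝ) * t) ^ ((2560 * (numStages s * phaseLength t) : ℕ) : ℝ) :=
        (Real.rpow_natCast _ _).symm
    _ ≤ _ := by
        refine Real.rpow_le_rpow_of_exponent_le hst ?_
        push_cast
        have := mul_le_mul hle hle' (by positivity)
          ((Nat.cast_nonneg _).trans hle)
        linarith

theorem SetSystem.opt_nonneg (I : SetSystem) : 0 ≤ I.opt := by
  refine Real.sInf_nonneg ?_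
  rintro v ⟨x, hx, rfl⟩
  exact Finset.sum_nonneg hx.1

end SetCover

theorem mainTheorem5 :
    ∃ C : ℝ, 0 < C ∧ ∀ s t : ℕ, 2 ≤ s → 2 ≤ t →
      -- the algorithm, run with `s` and `t` rounded up so that `log s` and `√(log t)` are integers,
      -- returns a set cover of expected size `O(log s) · OPT`
      (∀ I : SetCover.SetSystem, I.Bounded s t →
        (∀ ω : SetCover.Samples, I.IsSetCover
          (SetCover.phasedCover I (SetCover.numStages s) (SetCover.phaseLength t) ω)) ∧
        Integrable (fun ω : SetCover.Samples =>
            ((SetCover.phasedCover I (SetCover.numStages s) (SetCover.phaseLength t) ω).card : ℝ))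
          (SetCover.sampleLaw (SetCover.numStages s) (SetCover.phaseLength t)) ∧
        ∫ ω, ((SetCover.phasedCover I (SetCover.numStages s)
              (SetCover.phaseLength t) ω).card : ℝ)
            ∂(SetCover.sampleLaw (SetCover.numStages s) (SetCover.phaseLength t))
          ≤ C * Real.logb 2 s * I.opt) ∧
      -- it is simulated by an LCA with query complexity `(st) ^ O(log s · √(log t))`
      ∃ L : SetCover.LCA, ∃ D : SetCover.Tape → SetCover.Samples,
        MeasurePreserving D SetCover.tapeLaw
          (SetCover.sampleLaw (SetCover.numStages s) (SetCover.phaseLength t)) ∧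
        ∀ I : SetCover.SetSystem, I.Bounded s t →
          (∀ τ : SetCover.Tape,
            L.cover I τ = SetCover.phasedCover I (SetCover.numStages s)
              (SetCover.phaseLength t) (D τ) ∧
            I.IsSetCover (L.cover I τ) ∧
            ∀ S ∈ I.sets, ((L S).queries I τ : ℝ) ≤
              ((s : ℝ) * t) ^ (C * Real.logb 2 s * √(Real.logb 2 t))) ∧
          Integrable (fun τ : SetCover.Tape => ((L.cover I τ).card : ℝ)) SetCover.tapeLaw ∧
          ∫ τ, ((L.cover I τ).card : ℝ) ∂SetCover.tapeLaw ≤ C * Real.logb 2 s * I.opt := by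
  set A : ℝ := 32 + 1200 * Real.exp 100 with hA
  have hA0 : 0 < A := by positivity
  -- The factor 2 on `A` pays for rounding log s up; 10240 is the constant in the query exponent.
  refine ⟨2 * A + 10240, by positivity, fun s t hs ht => ?_⟩
  have ha := SetCover.numStages_pos hs
  have hT := SetCover.phaseLength_pos ht
  have hb : ∀ {I : SetCover.SetSystem}, I.Bounded s t → I.Bounded (2 ^ SetCover.numStages s)
      (2 ^ (SetCover.phaseLength t ^ 2)) := fun h =>
    h.mono (SetCover.le_two_pow_numStages s) (SetCover.le_two_pow_phaseLength ht)
  have hlog := SetCover.one_le_logb_two hs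
  have hsqrt := SetCover.one_le_sqrt_logb_two ht
  have hexp : ∀ {I : SetCover.SetSystem}, I.Bounded s t →
      ∫ ω, ((SetCover.phasedCover I (SetCover.numStages s) (SetCover.phaseLength t) ω).card : ℝ)
        ∂(SetCover.sampleLaw (SetCover.numStages s) (SetCover.phaseLength t)) ≤
      (2 * A + 10240) * Real.logb 2 s * I.opt := by
    intro I hI
    refine (SetCover.integral_card_phasedCover_le ha hT (hb hI)).trans
      (mul_le_mul_of_nonneg_right ?_ I.opt_nonneg)
    have h := mul_le_mul_of_nonneg_left (SetCover.numStages_le hs) hA0.le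
    rw [← hA]
    nlinarith
  have hD := SetCover.measurePreserving_decodeTape (SetCover.numStages s) (SetCover.phaseLength t)
  refine ⟨fun I hI => ⟨SetCover.isSetCover_phasedCover I _ _,
    (SetCover.integrable_and_integral_card_phasedCover I _ _).1, hexp hI⟩,
    SetCover.phasedLCA (SetCover.numStages s) (SetCover.phaseLength t),
    SetCover.decodeTape _ _, hD, fun I hI => ?_⟩
  have hcover := SetCover.cover_phasedLCA (hb hI)
  have hint := (SetCover.integrable_and_integral_card_phasedCover I (SetCover.numStages s)
    (SetCover.phaseLength t)).1
  refine ⟨fun τ => ⟨hcover τ, ?_, fun S hS => ?_⟩, ?_, ?_⟩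
  · rw [hcover τ]
    exact SetCover.isSetCover_phasedCover I _ _ _
  · have h1 : (((SetCover.phasedLCA (SetCover.numStages s) (SetCover.phaseLength t)) S).queries I τ
        : ℝ) ≤ SetCover.coverCost (SetCover.numStages s) (SetCover.phaseLength t) := by
      exact_mod_cast SetCover.queries_phasedLCA_le (hb hI) τ hS
    refine h1.trans ((SetCover.coverCost_le_rpow hs ht).trans ?_)
    refine Real.rpow_le_rpow_of_exponent_le ?_ ?_
    · exact_mod_cast Nat.mul_pos (by omega : 0 < s) (by omega : 0 < t)
    · refine mul_le_mul_of_nonneg_right (mul_le_mul_of_nonneg_right ?_ ?_) ?_ <;> linarith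
  · simp only [hcover]
    exact hD.integrable_comp_of_integrable hint
  · simp only [hcover]
    refine le_trans (le_of_eq ?_) (hexp hI)
    rw [← hD.map_eq] at hint ⊢
    exact (integral_map hD.measurable.aemeasurable hint.aestronglyMeasurable).symm
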